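/- Let $k$ be a field of characteristic $\neq 2$ and let $A=\bigoplus_j A^j$ be a $\mathbb Z$-graded $k$-vector space, with suspension $A[1]^j=A^{j-1}$. Put $TA=\bigoplus_n A[1]^{\otimes n}$ (with the deconcatenation coproduct) and $T^MA=\bigoplus_{r,s\ge 0}A[1]^{\otimes r}\otimes M[1]\otimes A[1]^{\otimes s}$. Let $\mathrm{Coder}(TA)$ be the coderivations of $TA$ with components $A[1]^{\otimes n}\to A[1]$, $n\ge 1$, and let $\mathrm{Comap}(T^AA,T^{A^*}A)$ be the bicomodule maps, given by components $\langle\cdots\rangle_{r,s}\colon A^{\otimes r}\otimes A\otimes A^{\otimes s}\otimes A\to k$. For $f\in\mathrm{Coder}(TA)$ let $f^A,f^{A^*}$ be the induced coderivations of $T^AA$, $T^{A^*}A$, and let $\delta_f(i)=f^{A^*}\circ i-(-1)^{|f||i|}\,i\circ f^A$. Let $\mathfrak h=\bigoplus_a\mathfrak h^a$ with $$\mathfrak h^a=\mathrm{Coder}(TA)^{-a}\oplus\mathrm{Comap}(T^AA,T^{A^*}A)^{1-a},\qquad [(f,i),(g,j)]=\bigl([f,g],\ \delta_f(j)-(-1)^{|f||g|}\delta_g(i)\bigr).$$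 Let $(A,D,I)$ be an $A_\infty$ algebra with $\infty$-inner product: $D\in\mathrm{Coder}(TA)^{-1}$, $D^2=0$, $I\in\mathrm{Comap}(T^AA,T^{A^*}A)^0$, $\delta_D(I)=0$. Let $d=[(D,I),\cdot\,]$ on $\mathfrak h$ and $H(\mathfrak h)=\bigoplus_j H^j(\mathfrak h)=\ker d/\operatorname{Im}d$. For a $\mathbb Z$-graded (graded commutative) local Artin $k$-algebra $R$ with residue field $k$ and maximal ideal $m$, a deformation of $(A,D,I)$ over $R$ is an $A_\infty$ structure over $R$ with $\infty$-inner product, $(D',I')$, on $A\otimes R$ that reduces to $(D,I)$ modulo $m$. Two deformations $(D',I')$, $(D'',I'')$ are equivalent if there are a coalgebra automorphism $\lambda$ of $T(A\otimes R)$ over $R$ (degree $0$, $\lambda(1)=1$, $\lambda\equiv\mathrm{id}$ modulo $m$) and a comap $\rho$ of degree $1$ with $\rho\equiv 0$ modulo $m$ such that $\lambda D'=D''\lambda$ and $I'-\widetilde\lambda\circ(I'')^{\lambda}\circ\overline\lambda=\delta_{D'}(\rho)$, where $\widetilde\lambda\circ(I'')^{\lambda}\circ\overline\lambda$ is the pull-back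 of $I''$ along $\lambda$. Let $\mathrm{Def}(R)$ be the set of equivalence classes, a functor of $R$. A local moduli space $\mathcal M$ of $A_\infty$ structures with $\infty$-inner products at $(D,I)$ is a projective system $\mathcal O=(\mathcal O_a)$ of such algebras $R$ over a nonempty directed set (the functions at the base point $0$) together with a natural bijection $\hom(\mathcal O,R)=\varinjlim_a\hom(\mathcal O_a,R)\simeq\mathrm{Def}(R)$, given by a compatible system of deformation classes $[(D_a,I_a)]\in\mathrm{Def}(\mathcal O_a)$. Its graded tangent space is $T_0(\mathcal M)=\bigoplus_jT_0^j$, where $T_0^j$ consists of the continuous derivations $\mathcal O\to k$ at the base point supported in degree $j-1$, that is, the direct limit of the derivations $\xi\colon\mathcal O_a\to k$ supported in degree $j-1$ (equivalently, $T_0^j=\hom(\mathcal O,k[t_j]/t_j^2)$ with $\deg t_j=j-1$). **Corollary.** For every local moduli space $\mathcal M$ of $A_\infty$ structures with $\infty$-inner products at $(D,I)$ there is an isomorphism of graded $k$-vector spaces (matching $T_0^j$ with $H^j(\mathfrak h)$) $$T_0(\mathcal M)\;\cong\;H(\mathfrak h).$$ It sends the tangent vector of a derivation $\xi$ of $\mathcal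 O_a$ supported in degree $j-1$ to the class of the derivative $(f,i)\in\mathfrak h^j$ of $(D_a,I_a)$ along $\xi$, given by $f(x)=(-1)^{(j-1)|x|}(\mathrm{id}\otimes\xi)D_a(x)$ and $i(z)=(-1)^{(j-1)(|z|+1)}\,\xi(I_a(z))$ (degrees $|x|,|z|$ counted in $A[1]$); this pair is always a cocycle. -/

import Mathlib

open scoped TensorProduct DirectSum

universe u v w

namespace InftyInner

noncomputable section

/-! ### Signs and gradings -/

section Signs

variable {k : Type u} [Field k]

/-- The trivial grading of the ground field: everything sits in degree `0`. -/
def triv (k : Type u) [Field k] : ℤ → Submodule k k := fun i => if i = 0 then ⊤ else ⊥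

instance : DirectSum.Decomposition (triv k) :=
  DirectSum.Decomposition.ofLinearMap (triv k)
    (DirectSum.lof k ℤ (fun i => triv k i) 0 ∘ₗ
      LinearMap.codRestrict (triv k 0) LinearMap.id (fun x => by simp [triv]))
    (by ext; simp)
    (by
      refine DirectSum.linearMap_ext k fun i => LinearMap.ext fun x => ?_
      obtain ⟨x, hx⟩ := x
      by_cases hi : i = 0
      · subst hi; ext; simp [LinearMap.codRestrict]
      · have h0 : (⟨x, hx⟩ : triv k i) = 0 := Subtype.ext (by simpa [triv, hi] using hx)
        rw [h0]; simp)

/-- The sign `(-1)^n`, as a scalar. -/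
def eps (k : Type u) [Field k] (n : ℤ) : k := ((n.negOnePow : ℤ) : k)

/-- The involution `x ↦ (-1)^{|x|} x` of a graded vector space. -/
def sign {M : Type*} [AddCommGroup M] [Module k M] (𝒢 : ℤ → Submodule k M)
    [DirectSum.Decomposition 𝒢] : M →ₗ[k] M :=
  DirectSum.coeLinearMap 𝒢 ∘ₗ
    DirectSum.lmap (fun i : ℤ => eps k i • (LinearMap.id : 𝒢 i →ₗ[k] 𝒢 i)) ∘ₗ
      (DirectSum.decomposeLinearEquiv 𝒢).toLinearMap

/-- The `p`-th power of a sign involution: `x ↦ (-1)^{p |x|} x`. -/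
def tw {M : Type*} [AddCommMonoid M] [Module k M] (s : M →ₗ[k] M) (p : ℤ) : M →ₗ[k] M :=
  if Even p then LinearMap.id else s

variable {X Y Z R : Type*} [AddCommMonoid X] [Module k X] [AddCommMonoid Y] [Module k Y]
  [AddCommMonoid Z] [Module k Z] [Ring R] [Algebra k R]

/-- The Koszul sign `x ⊗ y ↦ (-1)^{|x| |y|} x ⊗ y`, written through the sign involutions
`sX`, `sY` of the two factors (the characteristic is not `2`). -/
def koszul (sX : X →ₗ[k] X) (sY : Y →ₗ[k] Y) : X ⊗[k] Y →ₗ[k] X ⊗[k] Y :=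
  (2 : k)⁻¹ • (LinearMap.id + TensorProduct.map sX LinearMap.id
    + TensorProduct.map LinearMap.id sY + (-1 : k) • TensorProduct.map sX sY)

variable (R) in
/-- `x ↦ x ⊗ 1`. -/
def incl : X →ₗ[k] X ⊗[k] R := (TensorProduct.mk k X R).flip 1

/-- Collecting coefficients on the right:
`(x ⊗ r) ⊗ (y ⊗ s) ↦ (-1)^{|r| |y|} (x ⊗ y) ⊗ r s`. -/
def juxt (sR : R →ₗ[k] R) (sY : Y →ₗ[k] Y) :
    (X ⊗[k] R) ⊗[k] (Y ⊗[k] R) →ₗ[k] (X ⊗[k] Y) ⊗[k] R :=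
  TensorProduct.map LinearMap.id (LinearMap.mul' k R) ∘ₗ
    koszul (TensorProduct.map LinearMap.id sY) (TensorProduct.map sR LinearMap.id) ∘ₗ
      (TensorProduct.tensorTensorTensorComm k X R Y R).toLinearMap

/-- The right `R`-linear extension `x ⊗ r ↦ F(x) r` of a map `F : X → Y ⊗ R`. -/
def ext (F : X →ₗ[k] Y ⊗[k] R) : X ⊗[k] R →ₗ[k] Y ⊗[k] R :=
  TensorProduct.map LinearMap.id (LinearMap.mul' k R) ∘ₗ
    (TensorProduct.assoc k Y R R).toLinearMap ∘ₗ TensorProduct.map F LinearMap.id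

/-- The right `R`-linear extension `x ⊗ r ↦ i(x) r` of a map `i : X → R`. -/
def extR (i : X →ₗ[k] R) : X ⊗[k] R →ₗ[k] R :=
  LinearMap.mul' k R ∘ₗ TensorProduct.map i LinearMap.id

/-- Composition of right `R`-linear maps `X ⊗ R → Y ⊗ R → Z ⊗ R`, each given by its
restriction to `X`, resp. `Y`. -/
def comp (F : Y →ₗ[k] Z ⊗[k] R) (G : X →ₗ[k] Y ⊗[k] R) : X →ₗ[k] Z ⊗[k] R := ext F ∘ₗ G

/-- The grading of a tensor product of graded vector spaces by total degree. -/
def tdeg (𝒢 : ℤ → Submodule k X) (ℋ : ℤ → Submodule k Y) (d : ℤ) : Submodule k (X ⊗[k] Y) :=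
  ⨆ q : ℤ, LinearMap.range (TensorProduct.map (𝒢 (d - q)).subtype (ℋ q).subtype)

end Signs

/-! ### The tensor coalgebra -/

section Coalgebra

variable (k : Type u) [Field k] (A : Type v) [AddCommGroup A] [Module k A]

/-- The underlying space of `TA = T(A[1])`. -/
abbrev Bar : Type (max u v) := TensorAlgebra k A

/-- The underlying space of `T^A A = ⨁ A[1]^{⊗ k} ⊗ A[1] ⊗ A[1]^{⊗ l}`. -/
abbrev BiBar : Type (max u v) := Bar k A ⊗[k] (A ⊗[k] Bar k A)

/-- A letter `a` sends `(x, y)` to `(a x, 1 ⊗ a x + (a ⊗ 1) y)`; auxiliary for `deconc`. -/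
def deconcStep : A →ₗ[k] Module.End k (Bar k A × (Bar k A ⊗[k] Bar k A)) :=
  LinearMap.mk₂ k
    (fun a p => (TensorAlgebra.ι k a * p.1,
      1 ⊗ₜ[k] (TensorAlgebra.ι k a * p.1) + (TensorAlgebra.ι k a ⊗ₜ[k] 1) * p.2))
    (by intro a b p; ext1 <;> simp [add_mul, TensorProduct.tmul_add, TensorProduct.add_tmul]; abel)
    (by intro c a p; ext1 <;> simp [← TensorProduct.smul_tmul'])
    (by intro a p q; ext1 <;> simp [mul_add, TensorProduct.tmul_add]; abel)
    (by intro c a p; ext1 <;> simp)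

/-- Deconcatenation `Δ(a₁ ⋯ aₙ) = ∑ᵢ (a₁ ⋯ aᵢ) ⊗ (aᵢ₊₁ ⋯ aₙ)`, `0 ≤ i ≤ n`;
see `deconc_one` and `deconc_ι_mul`. -/
def deconc : Bar k A →ₗ[k] Bar k A ⊗[k] Bar k A where
  toFun x := (TensorAlgebra.lift k (deconcStep k A) x (1, 1 ⊗ₜ[k] 1)).2
  map_add' x y := by simp
  map_smul' c x := by simp

theorem deconc_one : deconc k A 1 = 1 ⊗ₜ[k] 1 := by simp [deconc]

theorem deconc_fst (x : Bar k A) (q : Bar k A × (Bar k A ⊗[k] Bar k A)) :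
    (TensorAlgebra.lift k (deconcStep k A) x q).1 = x * q.1 := by
  induction x using TensorAlgebra.induction generalizing q with
  | algebraMap r => simp [Algebra.smul_def]
  | ι a => simp [deconcStep]
  | mul x y hx hy => simp [hx, hy, mul_assoc]
  | add x y hx hy => simp [hx, hy, add_mul]

theorem deconc_ι_mul (a : A) (x : Bar k A) :
    deconc k A (TensorAlgebra.ι k a * x) =
      1 ⊗ₜ[k] (TensorAlgebra.ι k a * x) + (TensorAlgebra.ι k a ⊗ₜ[k] 1) * deconc k A x := by
  have h := deconc_fst k A x (1, 1 ⊗ₜ[k] 1)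
  simp only [mul_one] at h
  simp only [deconc, LinearMap.coe_mk, AddHom.coe_mk, map_mul, TensorAlgebra.lift_ι_apply,
    Module.End.mul_apply]
  rw [show ∀ p, deconcStep k A a p = (TensorAlgebra.ι k a * p.1,
      1 ⊗ₜ[k] (TensorAlgebra.ι k a * p.1) + (TensorAlgebra.ι k a ⊗ₜ[k] 1) * p.2) from
    fun p => rfl, h]

/-- A letter `a` sends `(c, b)` to `(0, c a)`; auxiliary for `pr`. -/
def prStep : A →ₗ[k] Module.End k (k × A) :=
  LinearMap.mk₂ k (fun a p => (0, p.1 • a))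
    (by intro a b p; ext1 <;> simp)
    (by intro c a p; ext1 <;> simp [smul_smul, mul_comm])
    (by intro a p q; ext1 <;> simp [add_smul])
    (by intro c a p; ext1 <;> simp [mul_smul])

/-- The projection `pr_A : TA → A` to the words of length one. -/
def pr : Bar k A →ₗ[k] A where
  toFun x := (TensorAlgebra.lift k (prStep k A) x (1, 0)).2
  map_add' x y := by simp
  map_smul' c x := by simp

theorem pr_one : pr k A 1 = 0 := by simp [pr]

theorem pr_ι (a : A) : pr k A (TensorAlgebra.ι k a) = a := by simp [pr, prStep]

theorem pr_ι_mul_ι_mul (a b : A) (x : Bar k A) :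
    pr k A (TensorAlgebra.ι k a * (TensorAlgebra.ι k b * x)) = 0 := by simp [pr, prStep]

/-- `x ⊗ a ⊗ y ↦ x a y`, forgetting which letter is the module element. -/
def word : BiBar k A →ₗ[k] Bar k A :=
  LinearMap.mul' k (Bar k A) ∘ₗ TensorProduct.map LinearMap.id
    (LinearMap.mul' k (Bar k A) ∘ₗ TensorProduct.map (TensorAlgebra.ι k) LinearMap.id)

/-- `x ⊗ a ⊗ y ↦ ∑ x' ⊗ ((x'' ⊗ a ⊗ y') ⊗ y'')`, with `Δ x = ∑ x' ⊗ x''`, `Δ y = ∑ y' ⊗ y''`. -/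
def split : BiBar k A →ₗ[k] Bar k A ⊗[k] (BiBar k A ⊗[k] Bar k A) :=
  TensorProduct.map LinearMap.id
      ((TensorProduct.assoc k (Bar k A) (A ⊗[k] Bar k A) (Bar k A)).symm.toLinearMap ∘ₗ
        TensorProduct.map LinearMap.id
          (TensorProduct.assoc k A (Bar k A) (Bar k A)).symm.toLinearMap) ∘ₗ
    (TensorProduct.assoc k (Bar k A) (Bar k A)
      (A ⊗[k] (Bar k A ⊗[k] Bar k A))).toLinearMap ∘ₗ
    TensorProduct.map (deconc k A) (TensorProduct.map LinearMap.id (deconc k A))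

/-- The space in which both the elements `(f, i)` of the graded Lie algebra (for `R = k`) and the
`A_∞` structures with `∞`-inner product on `A ⊗ R` live.

The first entry is a right `R`-linear map `TA ⊗ R → TA ⊗ R`, given by its restriction to `TA`.
The second entry is a comap `T^A A ⊗ R → T^{A*} A ⊗ R`, given by its lowest components
`⟨ ⋯ ⟩_{k,l} : A^{⊗ k} ⊗ A ⊗ A^{⊗ l} ⊗ A → R`; the last factor `A` is the argument of the
value in `A* = hom(A, R)`. -/
abbrev Cochain (R : Type*) [Ring R] [Algebra k R] : Type _ :=
  (Bar k A →ₗ[k] Bar k A ⊗[k] R) × (BiBar k A ⊗[k] A →ₗ[k] R)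

end Coalgebra

section Structures

variable {k : Type u} [Field k] {A : Type v} [AddCommGroup A] [Module k A]
  (𝒜 : ℤ → Submodule k A)

/-- The grading of the suspension: `A[1]^j = A^{j-1}`. -/
def susp : ℤ → Submodule k A := fun j => 𝒜 (j - 1)

/-- The grading of `TA = T(A[1])`. -/
def barDeg (d : ℤ) : Submodule k (Bar k A) :=
  Submodule.span k {x | ∃ l : List (ℤ × A), (∀ p ∈ l, p.2 ∈ susp 𝒜 p.1) ∧
    (l.map Prod.fst).sum = d ∧ (l.map fun p => TensorAlgebra.ι k p.2).prod = x}

/-- The grading of `T^A A ⊗ A[1]`. -/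
def pairDeg : ℤ → Submodule k (BiBar k A ⊗[k] A) :=
  tdeg (tdeg (barDeg 𝒜) (tdeg (susp 𝒜) (barDeg 𝒜))) (susp 𝒜)

variable [DirectSum.Decomposition 𝒜]

/-- The sign involution of `A[1]`. -/
def sA : A →ₗ[k] A := -sign 𝒜

/-- The sign involution of `TA`. -/
def sT : Bar k A →ₗ[k] Bar k A := (TensorAlgebra.lift k (TensorAlgebra.ι k ∘ₗ sA 𝒜)).toLinearMap

/-- The sign involution of `T^A A`. -/
def sP : BiBar k A →ₗ[k] BiBar k A :=
  TensorProduct.map (sT 𝒜) (TensorProduct.map (sA 𝒜) (sT 𝒜))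

/-- The cyclic rotation
`x ⊗ a ⊗ y ⊗ b ↦ ∑ ± (x'' ⊗ a ⊗ y') ⊗ (y'' ⊗ b ⊗ x')`, where `x'` jumps over all the rest. -/
def rot : BiBar k A ⊗[k] A →ₗ[k] BiBar k A ⊗[k] BiBar k A :=
  (TensorProduct.map LinearMap.id (TensorProduct.assoc k (Bar k A) A (Bar k A)).toLinearMap) ∘ₗ
  (TensorProduct.assoc k (BiBar k A) (Bar k A ⊗[k] A) (Bar k A)).toLinearMap ∘ₗ
  (TensorProduct.map (TensorProduct.assoc k (BiBar k A) (Bar k A) A).toLinearMap LinearMap.id) ∘ₗ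
  (TensorProduct.comm k (Bar k A) ((BiBar k A ⊗[k] Bar k A) ⊗[k] A)).toLinearMap ∘ₗ
  koszul (sT 𝒜) (TensorProduct.map (TensorProduct.map (sP 𝒜) (sT 𝒜)) (sA 𝒜)) ∘ₗ
  (TensorProduct.assoc k (Bar k A) (BiBar k A ⊗[k] Bar k A) A).toLinearMap ∘ₗ
  TensorProduct.map (split k A) LinearMap.id

variable {R : Type w} [Ring R] [Algebra k R] (ℛ : ℤ → Submodule k R) [DirectSum.Decomposition ℛ]

/-- `f` is a coderivation of degree `p` of `T(A ⊗ R) = TA ⊗ R` over `R` (without component in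
tensor length zero): it has degree `p` and `Δ f = (f ⊗ id + id ⊗ f) Δ`. -/
structure IsCoder (p : ℤ) (f : Bar k A →ₗ[k] Bar k A ⊗[k] R) : Prop where
  map_one : f 1 = 0
  degree : ∀ d, ∀ x ∈ barDeg 𝒜 d, f x ∈ tdeg (barDeg 𝒜) ℛ (d + p)
  coleibniz : TensorProduct.map (deconc k A) LinearMap.id ∘ₗ f =
    juxt (sign ℛ) (sT 𝒜) ∘ₗ
      (TensorProduct.map f (incl R) + TensorProduct.map (incl R ∘ₗ tw (sT 𝒜) p) f) ∘ₗ deconc k A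

/-- `L` is a map of coalgebras `T(A ⊗ R) → T(A ⊗ R)` over `R`, of degree `0` and
preserving the unit `1`. -/
structure IsCoalgMap (L : Bar k A →ₗ[k] Bar k A ⊗[k] R) : Prop where
  map_one : L 1 = 1 ⊗ₜ[k] 1
  degree : ∀ d, ∀ x ∈ barDeg 𝒜 d, L x ∈ tdeg (barDeg 𝒜) ℛ d
  counit : TensorProduct.map (TensorAlgebra.algebraMapInv (R := k) (M := A)).toLinearMap
      LinearMap.id ∘ₗ L = incl R ∘ₗ (TensorAlgebra.algebraMapInv (R := k) (M := A)).toLinearMap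
  comul : TensorProduct.map (deconc k A) LinearMap.id ∘ₗ L =
    juxt (sign ℛ) (sT 𝒜) ∘ₗ TensorProduct.map L L ∘ₗ deconc k A

/-- `f^A : T^A A → T^A A`, the coderivation over `f` (of degree `p`) induced by `f`:
`x ⊗ a ⊗ y ↦ f(x) ⊗ a ⊗ y + ∑ ± x' ⊗ pr_A f(x'' a y') ⊗ y'' ± x ⊗ a ⊗ f(y)`. -/
def coderA (p : ℤ) (f : Bar k A →ₗ[k] Bar k A ⊗[k] R) : BiBar k A →ₗ[k] BiBar k A ⊗[k] R :=
  let sAT := TensorProduct.map (sA 𝒜) (sT 𝒜)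
  juxt (sign ℛ) sAT ∘ₗ TensorProduct.map f (incl R)
  + juxt (sign ℛ) sAT ∘ₗ
      TensorProduct.map (incl R ∘ₗ tw (sT 𝒜) p)
        (juxt (sign ℛ) (sT 𝒜) ∘ₗ
          TensorProduct.map (TensorProduct.map (pr k A) LinearMap.id ∘ₗ f ∘ₗ word k A)
            (incl R)) ∘ₗ split k A
  + juxt (sign ℛ) sAT ∘ₗ
      TensorProduct.map (incl R ∘ₗ tw (sT 𝒜) p)
        (juxt (sign ℛ) (sT 𝒜) ∘ₗ TensorProduct.map (incl R ∘ₗ tw (sA 𝒜) p) f)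

/-- `i ∘ f^A`, for `f` of degree `p`. -/
def compCoderA (p : ℤ) (f : Bar k A →ₗ[k] Bar k A ⊗[k] R) (i : BiBar k A ⊗[k] A →ₗ[k] R) :
    BiBar k A ⊗[k] A →ₗ[k] R :=
  extR i ∘ₗ juxt (sign ℛ) (sA 𝒜) ∘ₗ TensorProduct.map (coderA 𝒜 ℛ p f) (incl R)

/-- `f^{A*} ∘ i`, for `f` of degree `p` and `i` of degree `q`. The coderivation `f^{A*}` has the
lowest components `f^{A*}(y', α, y'')(b) = ± α(pr_A f(y'' b y'))`, the action dual to that on `A`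
(`(f α)(b) = -(-1)^{|f| |α|} α(f b)`), so that
`(f^{A*} ∘ i)(x, a, y, b) = -(-1)^{p q} ∑ ± i(x'', a, y', pr_A f(y'' b x'))`. -/
def coderDualComp (p q : ℤ) (f : Bar k A →ₗ[k] Bar k A ⊗[k] R)
    (i : BiBar k A ⊗[k] A →ₗ[k] R) : BiBar k A ⊗[k] A →ₗ[k] R :=
  (-eps k (p * q)) • (extR i ∘ₗ juxt (sign ℛ) (sA 𝒜) ∘ₗ
    TensorProduct.map (incl R ∘ₗ tw (sP 𝒜) p)
      (TensorProduct.map (pr k A) LinearMap.id ∘ₗ f ∘ₗ word k A) ∘ₗ rot 𝒜)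

/-- `δ_f(i) = f^{A*} ∘ i - (-1)^{|f| |i|} i ∘ f^A`, for `|f| = p` and `|i| = q`. -/
def delta (p q : ℤ) (f : Bar k A →ₗ[k] Bar k A ⊗[k] R) (i : BiBar k A ⊗[k] A →ₗ[k] R) :
    BiBar k A ⊗[k] A →ₗ[k] R :=
  coderDualComp 𝒜 ℛ p q f i - eps k (p * q) • compCoderA 𝒜 ℛ p f i

/-- `i` has degree `p` as a comap `T^A A → T^{A*} A`: as `A*[1]` is the dual of `A[1]` shifted
by two, this means that `⟨ ⋯ ⟩` raises the degree by `p - 2`. -/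
def IsComap (p : ℤ) (i : BiBar k A ⊗[k] A →ₗ[k] R) : Prop :=
  ∀ d, ∀ z ∈ pairDeg 𝒜 d, i z ∈ ℛ (d + p - 2)

/-- `X = (D, I)` is an `A_∞` structure over `R` on `A ⊗ R` together with an `∞`-inner product:
`D` is a coderivation of degree `-1` with `D² = 0`, and `I` is a comap of degree `0`
with `δ_D(I) = D^{A*} ∘ I - I ∘ D^A = 0`. -/
structure IsAInftyInner (X : Cochain k A R) : Prop where
  coder : IsCoder 𝒜 ℛ (-1) X.1
  square : comp X.1 X.1 = 0
  comap : IsComap 𝒜 ℛ 0 X.2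
  compat : delta 𝒜 ℛ (-1) 0 X.1 X.2 = 0

/-- The map `T^A A ⊗ R → T^A A ⊗ R` with
`x ⊗ a ⊗ y ↦ ∑ ± L(x') ⊗ pr_A L(x'' a y') ⊗ L(y'')` induced by a coalgebra map `L`. -/
def mapA (L : Bar k A →ₗ[k] Bar k A ⊗[k] R) : BiBar k A →ₗ[k] BiBar k A ⊗[k] R :=
  juxt (sign ℛ) (TensorProduct.map (sA 𝒜) (sT 𝒜)) ∘ₗ
    TensorProduct.map L
      (juxt (sign ℛ) (sT 𝒜) ∘ₗ
        TensorProduct.map (TensorProduct.map (pr k A) LinearMap.id ∘ₗ L ∘ₗ word k A) L) ∘ₗ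
    split k A

/-- The composition of the comaps `A → A → A* → A*` induced by the coalgebra map `L`, by `i`
and by `L` again:
`(x, a, y, b) ↦ ∑ ± i(L(x₂), pr_A L(x₃ a y₁), L(y₂), pr_A L(y₃ b x₁))`. -/
def pullback (L : Bar k A →ₗ[k] Bar k A ⊗[k] R) (i : BiBar k A ⊗[k] A →ₗ[k] R) :
    BiBar k A ⊗[k] A →ₗ[k] R :=
  extR i ∘ₗ juxt (sign ℛ) (sA 𝒜) ∘ₗ
    TensorProduct.map (mapA 𝒜 ℛ L)
      (TensorProduct.map (pr k A) LinearMap.id ∘ₗ L ∘ₗ word k A) ∘ₗ rot 𝒜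

/-- Change of coefficients along a linear map `R → S`. -/
def push {S : Type*} [Ring S] [Algebra k S] (φ : R →ₗ[k] S) (X : Cochain k A R) :
    Cochain k A S :=
  (TensorProduct.map LinearMap.id φ ∘ₗ X.1, φ ∘ₗ X.2)

variable {𝒜 ℛ}

theorem IsCoder.zero (p : ℤ) : IsCoder 𝒜 ℛ p (0 : Bar k A →ₗ[k] Bar k A ⊗[k] R) where
  map_one := rfl
  degree d x _ := Submodule.zero_mem _
  coleibniz := by simp

theorem IsCoder.add {p : ℤ} {f g : Bar k A →ₗ[k] Bar k A ⊗[k] R} (hf : IsCoder 𝒜 ℛ p f)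
    (hg : IsCoder 𝒜 ℛ p g) : IsCoder 𝒜 ℛ p (f + g) where
  map_one := by simp [hf.map_one, hg.map_one]
  degree d x hx := Submodule.add_mem _ (hf.degree d x hx) (hg.degree d x hx)
  coleibniz := by
    rw [LinearMap.comp_add, hf.coleibniz, hg.coleibniz, ← LinearMap.comp_add,
      ← LinearMap.add_comp, TensorProduct.map_add_left, TensorProduct.map_add_right]
    congr 2
    abel

theorem IsCoder.smul {p : ℤ} {f : Bar k A →ₗ[k] Bar k A ⊗[k] R} (c : k)
    (hf : IsCoder 𝒜 ℛ p f) : IsCoder 𝒜 ℛ p (c • f) where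
  map_one := by simp [hf.map_one]
  degree d x hx := Submodule.smul_mem _ c (hf.degree d x hx)
  coleibniz := by
    rw [LinearMap.comp_smul, hf.coleibniz, TensorProduct.map_smul_left,
      TensorProduct.map_smul_right, ← smul_add, LinearMap.smul_comp, LinearMap.comp_smul]

theorem ext_add (F G : Bar k A →ₗ[k] Bar k A ⊗[k] R) : ext (F + G) = ext F + ext G := by
  simp [ext, TensorProduct.map_add_left, LinearMap.comp_add]

theorem ext_smul (c : k) (F : Bar k A →ₗ[k] Bar k A ⊗[k] R) : ext (c • F) = c • ext F := by
  simp [ext, TensorProduct.map_smul_left, LinearMap.comp_smul]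

theorem delta_add_right (p q : ℤ) (f : Bar k A →ₗ[k] Bar k A ⊗[k] R)
    (i j : BiBar k A ⊗[k] A →ₗ[k] R) :
    delta 𝒜 ℛ p q f (i + j) = delta 𝒜 ℛ p q f i + delta 𝒜 ℛ p q f j := by
  have e : extR (i + j) = extR i + extR j := by
    simp [extR, TensorProduct.map_add_left, LinearMap.comp_add]
  simp only [delta, coderDualComp, compCoderA, e, LinearMap.add_comp, smul_add]
  abel

theorem delta_smul_right (p q : ℤ) (c : k) (f : Bar k A →ₗ[k] Bar k A ⊗[k] R)
    (i : BiBar k A ⊗[k] A →ₗ[k] R) :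
    delta 𝒜 ℛ p q f (c • i) = c • delta 𝒜 ℛ p q f i := by
  have e : extR (c • i) = c • extR i := by
    simp [extR, TensorProduct.map_smul_left, LinearMap.comp_smul]
  simp only [delta, coderDualComp, compCoderA, e, LinearMap.smul_comp, smul_sub,
    smul_comm c]

theorem coderA_add (p : ℤ) (f g : Bar k A →ₗ[k] Bar k A ⊗[k] R) :
    coderA 𝒜 ℛ p (f + g) = coderA 𝒜 ℛ p f + coderA 𝒜 ℛ p g := by
  simp only [coderA, TensorProduct.map_add_left, TensorProduct.map_add_right,
    LinearMap.comp_add, LinearMap.add_comp]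
  abel

theorem coderA_smul (p : ℤ) (c : k) (f : Bar k A →ₗ[k] Bar k A ⊗[k] R) :
    coderA 𝒜 ℛ p (c • f) = c • coderA 𝒜 ℛ p f := by
  simp only [coderA, TensorProduct.map_smul_left, TensorProduct.map_smul_right,
    LinearMap.comp_smul, LinearMap.smul_comp, smul_add]

theorem delta_add_left (p q : ℤ) (f g : Bar k A →ₗ[k] Bar k A ⊗[k] R)
    (i : BiBar k A ⊗[k] A →ₗ[k] R) :
    delta 𝒜 ℛ p q (f + g) i = delta 𝒜 ℛ p q f i + delta 𝒜 ℛ p q g i := by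
  simp only [delta, coderDualComp, compCoderA, coderA_add, TensorProduct.map_add_left,
    TensorProduct.map_add_right, LinearMap.comp_add, LinearMap.add_comp, smul_add]
  abel

theorem delta_smul_left (p q : ℤ) (c : k) (f : Bar k A →ₗ[k] Bar k A ⊗[k] R)
    (i : BiBar k A ⊗[k] A →ₗ[k] R) :
    delta 𝒜 ℛ p q (c • f) i = c • delta 𝒜 ℛ p q f i := by
  simp only [delta, coderDualComp, compCoderA, coderA_smul, TensorProduct.map_smul_left,
    TensorProduct.map_smul_right, LinearMap.comp_smul, LinearMap.smul_comp, smul_sub, smul_comm c]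

end Structures

/-! ### The graded Lie algebra and its cohomology -/

section LieAlgebra

variable {k : Type u} [Field k] {A : Type v} [AddCommGroup A] [Module k A]
  (𝒜 : ℤ → Submodule k A) [DirectSum.Decomposition 𝒜]

/-- The bracket of `h` on `h^a × h^b`; elements `(f, i)` of `h^a` have `|f| = -a`, `|i| = 1 - a`:
`[(f, i), (g, j)] = (f g - (-1)^{|f| |g|} g f, δ_f(j) - (-1)^{|f| |g|} δ_g(i))`. -/
def bracket (a b : ℤ) (x y : Cochain k A k) : Cochain k A k :=
  (comp x.1 y.1 + (-eps k (a * b)) • comp y.1 x.1,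
    delta 𝒜 (triv k) (-a) (1 - b) x.1 y.2
      - eps k (a * b) • delta 𝒜 (triv k) (-b) (1 - a) y.1 x.2)

/-- The homogeneous part `h^a = Coder(TA)^{-a} ⊕ Comap(T^A A, T^{A*} A)^{1-a}`. -/
def lieDeg (a : ℤ) : Submodule k (Cochain k A k) where
  carrier := {x | IsCoder 𝒜 (triv k) (-a) x.1 ∧ IsComap 𝒜 (triv k) (1 - a) x.2}
  zero_mem' := ⟨IsCoder.zero _, fun _ _ _ => Submodule.zero_mem _⟩
  add_mem' hx hy := ⟨hx.1.add hy.1,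
    fun d z hz => Submodule.add_mem _ (hx.2 d z hz) (hy.2 d z hz)⟩
  smul_mem' c _ hx := ⟨hx.1.smul c, fun d z hz => Submodule.smul_mem _ c (hx.2 d z hz)⟩

/-- The differential `d = [X, ·]` on `h^b`, where `X = (D, I)` lies in `h^1`. -/
def differential (X : Cochain k A k) (b : ℤ) : Cochain k A k →ₗ[k] Cochain k A k where
  toFun y := bracket 𝒜 1 b X y
  map_add' y z := by
    ext1
    · simp only [bracket, comp, Prod.fst_add, ext_add, LinearMap.comp_add, LinearMap.add_comp,
        smul_add]
      abel
    · simp only [bracket, Prod.fst_add, Prod.snd_add, delta_add_left, delta_add_right, smul_add]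
      abel
  map_smul' c y := by
    ext1
    · simp only [bracket, comp, Prod.smul_fst, ext_smul, LinearMap.comp_smul,
        LinearMap.smul_comp, RingHom.id_apply, smul_add, smul_comm c]
    · simp only [bracket, Prod.smul_fst, Prod.smul_snd, delta_smul_left, delta_smul_right,
        smul_sub, smul_comm c, RingHom.id_apply]

/-- The cocycles `ker d` in `h^j`. -/
def cocycles (X : Cochain k A k) (j : ℤ) : Submodule k (Cochain k A k) :=
  lieDeg 𝒜 j ⊓ LinearMap.ker (differential 𝒜 X j)

/-- The coboundaries `d(h^{j-1})`. -/
def coboundaries (X : Cochain k A k) (j : ℤ) : Submodule k (Cochain k A k) :=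
  (lieDeg 𝒜 (j - 1)).map (differential 𝒜 X (j - 1))

/-- Negation on spaces of cochains, as multiplication with `-1` (needed to form quotients). -/
instance (S : Submodule k (Cochain k A k)) : AddCommGroup S :=
  Module.addCommMonoidToAddCommGroup k

/-- `H^j(h) = ker d / Im d` in degree `j`. -/
abbrev CohomologyDeg (X : Cochain k A k) (j : ℤ) : Type _ :=
  cocycles 𝒜 X j ⧸ (coboundaries 𝒜 X j).submoduleOf (cocycles 𝒜 X j)

/-- `H(h) = ⨁ H^j(h)`. -/
abbrev Cohomology (X : Cochain k A k) : Type _ := ⨁ j : ℤ, CohomologyDeg 𝒜 X j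

end LieAlgebra

/-! ### Graded Artin local algebras and pro-objects -/

section Artin

/-- A `ℤ`-graded (graded commutative) local Artin algebra over `k` with residue field `k`:
a finite-dimensional graded commutative algebra `R = k ⊕ m` with nilpotent maximal ideal
`m = ker aug`. -/
structure GradedArtin (k : Type u) [Field k] where
  carrier : Type u
  [ring : Ring carrier]
  [algebra : Algebra k carrier]
  grade : ℤ → Submodule k carrier
  [graded : GradedAlgebra grade]
  comm : ∀ i j, ∀ a ∈ grade i, ∀ b ∈ grade j, a * b = eps k (i * j) • (b * a)
  finite : Module.Finite k carrier
  /-- the projection to the residue field -/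
  aug : carrier →ₐ[k] k
  aug_grade : ∀ i, i ≠ 0 → ∀ a ∈ grade i, aug a = 0
  nilpotent : ∀ a, aug a = 0 → IsNilpotent a

attribute [instance] GradedArtin.ring GradedArtin.algebra GradedArtin.graded

variable {k : Type u} [Field k]

/-- Homomorphisms of graded Artin local algebras: degree preserving algebra maps.  They are
automatically local. -/
def GradedArtin.Hom (R S : GradedArtin k) : Type u :=
  {φ : R.carrier →ₐ[k] S.carrier // ∀ i, ∀ a ∈ R.grade i, φ a ∈ S.grade i}

/-- A projective limit (pro-object) of graded local Artin algebras: an inverse system over a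
nonempty directed index set. -/
structure ProArtin (k : Type u) [Field k] where
  index : Type w
  [preorder : Preorder index]
  [directed : IsDirectedOrder index]
  [nonempty : Nonempty index]
  obj : index → GradedArtin k
  trans : ∀ {a b : index}, a ≤ b → GradedArtin.Hom (obj b) (obj a)
  trans_id : ∀ a x, (trans (le_refl a)).1 x = x
  trans_comp : ∀ {a b c : index} (h : a ≤ b) (h' : b ≤ c) (x),
    (trans h).1 ((trans h').1 x) = (trans (h.trans h')).1 x

attribute [instance] ProArtin.preorder ProArtin.directed ProArtin.nonempty

/-- The derivations `ξ : R → k` at the base point (`ξ(ab) = ξ(a) b(0) + a(0) ξ(b)`) that are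
supported on the part of `R` of degree `j - 1`.  Such a `ξ` is the same as a
homomorphism `R → k[t] / t²`, `a ↦ a(0) + ξ(a) t`, to the dual numbers with `deg t = j - 1`. -/
def GradedArtin.derivations (R : GradedArtin k) (j : ℤ) : Submodule k (R.carrier →ₗ[k] k) where
  carrier := {ξ | (∀ a b, ξ (a * b) = ξ a * R.aug b + R.aug a * ξ b) ∧
    ∀ i, i ≠ j - 1 → ∀ a ∈ R.grade i, ξ a = 0}
  zero_mem' := by simp
  add_mem' := by
    rintro ξ η ⟨h1, h2⟩ ⟨h3, h4⟩
    refine ⟨fun a b => ?_, fun i hi a ha => ?_⟩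
    · simp only [LinearMap.add_apply, h1, h3]; ring
    · simp [h2 i hi a ha, h4 i hi a ha]
  smul_mem' := by
    rintro c ξ ⟨h1, h2⟩
    refine ⟨fun a b => ?_, fun i hi a ha => ?_⟩
    · simp only [LinearMap.smul_apply, h1, smul_eq_mul]; ring
    · simp [h2 i hi a ha]

/-- Homomorphisms of graded Artin local algebras commute with the projections to `k`. -/
theorem GradedArtin.Hom.aug_apply {R S : GradedArtin k} (φ : GradedArtin.Hom R S)
    (a : R.carrier) : S.aug (φ.1 a) = R.aug a := by
  have h : IsNilpotent (a - algebraMap k R.carrier (R.aug a)) := R.nilpotent _ (by simp)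
  have h' := ((h.map φ.1).map S.aug).eq_zero
  simpa [sub_eq_zero] using h'

/-- Derivations of `R` pulled back along a homomorphism `S → R`. -/
def GradedArtin.Hom.derivations {R S : GradedArtin k} (φ : GradedArtin.Hom S R) (j : ℤ) :
    R.derivations j →ₗ[k] S.derivations j where
  toFun ξ := ⟨ξ.1 ∘ₗ φ.1.toLinearMap, by
    obtain ⟨ξ, h1, h2⟩ := ξ
    refine ⟨fun a b => ?_, fun i hi a ha => ?_⟩
    · simp [h1, φ.aug_apply]
    · exact h2 i hi _ (φ.2 i a ha)⟩
  map_add' ξ η := rfl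
  map_smul' c ξ := rfl

open Classical in
/-- The part of the tangent space at the base point on which the coordinates are the functions of
degree `j - 1`: the continuous derivations `O → k` supported in degree `j - 1`, i.e. the direct
limit of the derivations of the members of the inverse system. -/
abbrev ProArtin.TangentDeg (O : ProArtin.{u, w} k) (j : ℤ) : Type _ :=
  Module.DirectLimit (fun a => (O.obj a).derivations j)
    (fun _ _ h => (O.trans h).derivations j)

open Classical in
/-- The tangent vector given by a derivation of a member of the inverse system. -/
def ProArtin.tangentOf (O : ProArtin.{u, w} k) (j : ℤ) (a : O.index) :
    (O.obj a).derivations j →ₗ[k] O.TangentDeg j :=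
  Module.DirectLimit.of k O.index (fun a => (O.obj a).derivations j)
    (fun _ _ h => (O.trans h).derivations j) a

/-- The graded tangent space at the base point. -/
abbrev ProArtin.TangentSpace (O : ProArtin.{u, w} k) : Type _ := ⨁ j : ℤ, O.TangentDeg j

end Artin

/-! ### Deformations and the local moduli space -/

section Moduli

variable {k : Type u} [Field k] {A : Type v} [AddCommGroup A] [Module k A]
  (𝒜 : ℤ → Submodule k A) [DirectSum.Decomposition 𝒜]

/-- `Y` is a deformation over `R` of the `A_∞` algebra with `∞`-inner product `X`: an `A_∞`
structure over `R` with `∞`-inner product on `A ⊗ R` that reduces to `X` modulo the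
maximal ideal. -/
def IsDeformation (X : Cochain k A k) (R : GradedArtin k) (Y : Cochain k A R.carrier) : Prop :=
  IsAInftyInner 𝒜 R.grade Y ∧ push R.aug.toLinearMap Y = X

/-- Two deformations `Y = (D', I')`, `Y' = (D'', I'')` over `R` are equivalent: there are an
automorphism `L` of the coalgebra `T(A ⊗ R)`, the identity modulo the maximal ideal `m`, with
`L D' = D'' L`, and a comap `ρ` of degree `1`, zero modulo `m`, with
`I' - L^* I'' = D'^{A*} ρ + ρ D'^A`. -/
def DefEquiv (R : GradedArtin k) (Y Y' : Cochain k A R.carrier) : Prop :=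
  ∃ (L : Bar k A →ₗ[k] Bar k A ⊗[k] R.carrier) (ρ : BiBar k A ⊗[k] A →ₗ[k] R.carrier),
    IsCoalgMap 𝒜 R.grade L ∧
    TensorProduct.map LinearMap.id R.aug.toLinearMap ∘ₗ L = incl k ∧
    IsComap 𝒜 R.grade 1 ρ ∧ R.aug.toLinearMap ∘ₗ ρ = 0 ∧
    comp L Y.1 = comp Y'.1 L ∧
    Y.2 - pullback 𝒜 R.grade L Y'.2 = delta 𝒜 R.grade (-1) 1 Y.1 ρ

/-- A local moduli space of `A_∞` structures with `∞`-inner products at the base point `X`: a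
pro-object `O` (the local functions at the base point) together with an equivalence of
functors `hom(O, ·) ≃ Def`, where `Def(S)` is the set of deformations of `X` over `S` up to
equivalence. The equivalence is given by its universal element, a compatible
system of deformation classes over the members of `O`; that
`hom(O, S) = colim hom(O_a, S) → Def(S)` is onto and one-to-one is spelled out. -/
structure LocalModuli (X : Cochain k A k) extends ProArtin.{u, w} k where
  univ : ∀ a, Cochain k A (obj a).carrier
  isDeformation : ∀ a, IsDeformation 𝒜 X (obj a) (univ a)
  compatible : ∀ {a b} (h : a ≤ b),
    DefEquiv 𝒜 (obj a) (push (trans h).1.toLinearMap (univ b)) (univ a)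
  surjective : ∀ (S : GradedArtin k) (Y : Cochain k A S.carrier), IsDeformation 𝒜 X S Y →
    ∃ (a : index) (φ : GradedArtin.Hom (obj a) S),
      DefEquiv 𝒜 S (push φ.1.toLinearMap (univ a)) Y
  injective : ∀ (S : GradedArtin k) (a : index) (φ ψ : GradedArtin.Hom (obj a) S),
    DefEquiv 𝒜 S (push φ.1.toLinearMap (univ a)) (push ψ.1.toLinearMap (univ a)) →
    ∃ (b : index) (h : a ≤ b), ∀ x, φ.1 ((trans h).1 x) = ψ.1 ((trans h).1 x)

/-- The derivative of a family `Y` over `R` in the direction of a derivation `ξ : R → k` supported in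
degree `j - 1`.  For `R = k[t] / t²`, `deg t = j - 1`, and `Y = (D + f t, I + (-1)^{j-1} i t)`
this is the element `(f, i)` of `h^j`; the signs come from moving `t` past the arguments and
from the shift of the second summand of `h`. -/
def derivative {R : GradedArtin k} (j : ℤ) (ξ : R.carrier →ₗ[k] k)
    (Y : Cochain k A R.carrier) : Cochain k A k :=
  (TensorProduct.map LinearMap.id ξ ∘ₗ Y.1 ∘ₗ tw (sT 𝒜) (j - 1),
    eps k (j - 1) •
      (ξ ∘ₗ Y.2 ∘ₗ tw (TensorProduct.map (sP 𝒜) (sA 𝒜)) (j - 1)))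

end Moduli
end
end InftyInner

open scoped TensorProduct DirectSum

namespace InftyInner

noncomputable section

/-! ### Signs -/

section SignLemmas

variable {k : Type u} [Field k]

/-! A tangent vector in `T_0^j` is a homomorphism from the pro-object to the dual numbers `k[t]/t²`
with `deg t = j - 1`, so the universal property identifies `T_0^j` with the set of deformations over
these dual numbers up to equivalence. It remains to see that this set is `H^j(h)`.

A family over the dual numbers reducing to `(D, I)` is a pair `(D + f t, I ± i t)`, called a `jet`
here. Because `t² = 0`, the equations `D'² = 0` and `δ_{D'}(I') = 0` are linear in `(f, i)`, and
together they say `d(f, i) = 0` (`isAInftyInner_jet_iff`). An equivalence is `λ = id + l t`, `ρ = ±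
r t`. Being a coalgebra map forces `l` to be a coderivation, the pull-back along `λ` changes `I` by
`-δ_l(I)` to first order, and the two conditions on `(λ, ρ)` become `(f, i) - (f', i') = d(l, r)`
(`defEquiv_jet_iff`). So cocycles correspond to deformations and coboundaries to trivial ones.

Pushing the universal family along `a ↦ a(0) + ξ(a) t` gives exactly the jet of its derivative along
`ξ` (`push_homOfDerivation`). The derivative is linear in `ξ`, so the bijection is linear, and its
compatibility with the transition maps lets it descend to the direct limit.

The labour lies in the Koszul signs. A coefficient map `χ : R → S` of degree `n` twists arguments by
`(-1)^{n|x|}` whenever a coefficient is moved to the right. `IsShift` records the algebra that is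
needed, and `IsShift.delta`, `IsShift.coleibniz` and `IsShift.isCoder` show that every construction
commutes with this twisted change of coefficients. Applied to `c ↦ c` and `c ↦ c t`, they yield the
product rules `comp_jetFst` and `delta_jet`. `IsShift.mapA_incl_add` and `IsShift.pullback_incl_add`
give the first order expansion of a pull-back. -/

theorem eps_add (m n : ℤ) : eps k (m + n) = eps k m * eps k n := by
  simp [eps, Int.negOnePow_add]

theorem eps_even {n : ℤ} (h : Even n) : eps k n = 1 := by simp [eps, Int.negOnePow_even n h]

theorem eps_odd {n : ℤ} (h : ¬ Even n) : eps k n = -1 := by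
  simp [eps, Int.negOnePow_odd n (Int.not_even_iff_odd.mp h)]

theorem eps_zero : eps k 0 = 1 := eps_even Even.zero

theorem eps_neg (n : ℤ) : eps k (-n) = eps k n := by simp [eps]

theorem eps_mul_self (n : ℤ) : eps k n * eps k n = 1 := by
  by_cases h : Even n <;> simp [eps_even, eps_odd, h]

section tw

variable {M N : Type*} [AddCommMonoid M] [Module k M] [AddCommMonoid N] [Module k N]

theorem tw_of_even {s : M →ₗ[k] M} {p : ℤ} (h : Even p) : tw s p = LinearMap.id := if_pos h

theorem tw_of_odd {s : M →ₗ[k] M} {p : ℤ} (h : ¬ Even p) : tw s p = s := if_neg h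

theorem tw_zero (s : M →ₗ[k] M) : tw s 0 = LinearMap.id := tw_of_even Even.zero

theorem tw_comp_tw {s : M →ₗ[k] M} (hs : s ∘ₗ s = LinearMap.id) (p q : ℤ) :
    tw s p ∘ₗ tw s q = tw s (p + q) := by
  by_cases hp : Even p <;> by_cases hq : Even q <;> simp [tw, hp, hq, Int.even_add, hs]

theorem tw_tw {s : M →ₗ[k] M} (hs : s ∘ₗ s = LinearMap.id) (p : ℤ) :
    tw s p ∘ₗ tw s p = LinearMap.id := by
  rw [tw_comp_tw hs]; exact tw_of_even ⟨p, rfl⟩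

theorem tw_of_even_sub {s : M →ₗ[k] M} {p q : ℤ} (h : Even (p - q)) : tw s p = tw s q := by
  rw [Int.even_sub] at h
  by_cases hq : Even q
  · rw [tw_of_even hq, tw_of_even (h.2 hq)]
  · rw [tw_of_odd hq, tw_of_odd (fun h' => hq (h.1 h'))]

theorem map_tw (s : M →ₗ[k] M) (t : N →ₗ[k] N) (p : ℤ) :
    TensorProduct.map (tw s p) (tw t p) = tw (TensorProduct.map s t) p := by
  by_cases hp : Even p <;> simp [tw, hp]

theorem comp_tw_of_comp {s : M →ₗ[k] M} {t : N →ₗ[k] N} {f : M →ₗ[k] N}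
    (h : f ∘ₗ s = t ∘ₗ f) (p : ℤ) : f ∘ₗ tw s p = tw t p ∘ₗ f := by
  by_cases hp : Even p <;> simp [tw, hp, h]

end tw

section sign

variable {M N : Type*} [AddCommGroup M] [Module k M] [AddCommGroup N] [Module k N]
  (𝒢 : ℤ → Submodule k M) [DirectSum.Decomposition 𝒢]
  (ℋ : ℤ → Submodule k N) [DirectSum.Decomposition ℋ]

theorem sign_of_mem {i : ℤ} {x : M} (hx : x ∈ 𝒢 i) : sign 𝒢 x = eps k i • x := by
  lift x to 𝒢 i using hx
  simp [sign, DirectSum.lof_eq_of]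

theorem linearMap_ext_of_decomposition {P : Type*} [AddCommMonoid P] [Module k P]
    {f g : M →ₗ[k] P} (h : ∀ i, ∀ x ∈ 𝒢 i, f x = g x) : f = g := by
  ext x
  induction x using DirectSum.Decomposition.inductionOn 𝒢 with
  | zero => simp
  | homogeneous x => exact h _ _ x.2
  | add x y hx hy => simp [hx, hy]

theorem sign_comp_sign : sign 𝒢 ∘ₗ sign 𝒢 = LinearMap.id := by
  refine linearMap_ext_of_decomposition 𝒢 fun i x hx => ?_
  simp [sign_of_mem 𝒢 hx, smul_smul, eps_mul_self]

/-- A map of degree `n` commutes with the sign involutions up to `(-1)^n`. This is the form in which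
the degree of a coefficient map enters the Koszul sign of `juxt`. -/
theorem sign_comp_of_shift {φ : M →ₗ[k] N} {n : ℤ}
    (h : ∀ i, ∀ x ∈ 𝒢 i, φ x ∈ ℋ (i + n)) :
    sign ℋ ∘ₗ φ = eps k n • (φ ∘ₗ sign 𝒢) := by
  refine linearMap_ext_of_decomposition 𝒢 fun i x hx => ?_
  simp [sign_of_mem 𝒢 hx, sign_of_mem ℋ (h i x hx), smul_smul, eps_add, mul_comm]

end sign

section juxt

variable {X Y X' Y' R S : Type*} [AddCommMonoid X] [Module k X] [AddCommMonoid Y] [Module k Y]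
  [AddCommMonoid X'] [Module k X'] [AddCommMonoid Y'] [Module k Y']
  [Ring R] [Algebra k R] [Ring S] [Algebra k S]

theorem koszul_tmul (sX : X →ₗ[k] X) (sY : Y →ₗ[k] Y) (x : X) (y : Y) :
    koszul sX sY (x ⊗ₜ y) = (2 : k)⁻¹ •
      (x ⊗ₜ y + sX x ⊗ₜ y + x ⊗ₜ sY y + (-1 : k) • (sX x ⊗ₜ sY y)) := by
  simp [koszul]

theorem juxt_tmul (sR : R →ₗ[k] R) (sY : Y →ₗ[k] Y) (x : X) (r : R) (y : Y) (s : R) :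
    juxt sR sY ((x ⊗ₜ r) ⊗ₜ (y ⊗ₜ s)) = (2 : k)⁻¹ •
      ((x ⊗ₜ y) ⊗ₜ (r * s) + (x ⊗ₜ sY y) ⊗ₜ (r * s) + (x ⊗ₜ y) ⊗ₜ (sR r * s)
        + (-1 : k) • ((x ⊗ₜ sY y) ⊗ₜ (sR r * s))) := by
  simp [juxt, koszul_tmul]

/-- Juxtaposition is natural: moving a coefficient map of degree `n` out of the first factor
twists the second factor. -/
theorem juxt_comp_map {sR : R →ₗ[k] R} {sS : S →ₗ[k] S} {sY : Y →ₗ[k] Y} {sY' : Y' →ₗ[k] Y'}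
    {χ₁ χ₂ χ : R →ₗ[k] S} {n : ℤ} (f : X →ₗ[k] X') (g : Y →ₗ[k] Y')
    (hg : g ∘ₗ sY = sY' ∘ₗ g)
    (hY : sY ∘ₗ sY = LinearMap.id) (hχ : ∀ a b, χ₁ a * χ₂ b = χ (a * b))
    (hs : sS ∘ₗ χ₁ = eps k n • (χ₁ ∘ₗ sR)) :
    juxt sS sY' ∘ₗ TensorProduct.map (TensorProduct.map f χ₁) (TensorProduct.map g χ₂) =
      TensorProduct.map (TensorProduct.map f g) χ ∘ₗ juxt sR sY ∘ₗ
        TensorProduct.map LinearMap.id (TensorProduct.map (tw sY n) LinearMap.id) := by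
  have hY' : ∀ y, sY (sY y) = y := fun y => LinearMap.congr_fun hY y
  have hg' : ∀ y, sY' (g y) = g (sY y) := fun y => (LinearMap.congr_fun hg y).symm
  have hs' : ∀ r, sS (χ₁ r) = eps k n • χ₁ (sR r) := fun r => LinearMap.congr_fun hs r
  ext x r y s
  -- For even `n` nothing changes. For odd `n` the sign flips the two terms containing `sR r`, and
  -- replacing `y` by `sY y` on the other side permutes the four terms in the same way.
  by_cases hn : Even n
  · simp [juxt_tmul, tw, hn, hg', hs', hχ, eps_even hn]
  · simp [juxt_tmul, tw, hn, hg', hs', hχ, hY', TensorProduct.tmul_smul]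
    rw [eps_odd hn]
    module

theorem juxt_comp_map_zero {sS : S →ₗ[k] S} {sY' : Y' →ₗ[k] Y'}
    {χ₁ χ₂ : R →ₗ[k] S} (f : X →ₗ[k] X') (g : Y →ₗ[k] Y')
    (hχ : ∀ a b, χ₁ a * χ₂ b = 0) (hs : ∀ a b, sS (χ₁ a) * χ₂ b = 0) :
    juxt sS sY' ∘ₗ TensorProduct.map (TensorProduct.map f χ₁) (TensorProduct.map g χ₂) = 0 := by
  ext x r y s
  simp [juxt_tmul, hχ, hs]

theorem map_comp_incl (f : X →ₗ[k] Y) {φ : R →ₗ[k] S} (hφ : φ 1 = 1) :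
    TensorProduct.map f φ ∘ₗ incl R = incl S ∘ₗ f := by
  ext x
  simp [incl, hφ]

/-- The coefficient `1` has even degree, so the two terms with `sY y` cancel and the other two add
up to `2⁻¹ + 2⁻¹`. Invertibility of `2` enters here. -/
theorem juxt_incl (h2 : (2 : k) ≠ 0) {sR : R →ₗ[k] R} (hs : sR 1 = 1) (sY : Y →ₗ[k] Y) :
    juxt sR sY ∘ₗ TensorProduct.map (incl R : X →ₗ[k] _) (incl R) = incl R := by
  ext x y
  simp [incl, juxt_tmul, hs]
  have h : (2 : k)⁻¹ + 2⁻¹ = 1 := by rw [← two_mul, mul_inv_cancel₀ h2]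
  calc _ = ((2 : k)⁻¹ + 2⁻¹) • ((x ⊗ₜ[k] y) ⊗ₜ[k] (1 : R)) := by module
    _ = _ := by rw [h, one_smul]

theorem extR_comp_map {χ₁ χ₂ χ : R →ₗ[k] S} (f : X →ₗ[k] Y) (i : Y →ₗ[k] R)
    (hχ : ∀ a b, χ₂ a * χ₁ b = χ (a * b)) :
    extR (χ₂ ∘ₗ i) ∘ₗ TensorProduct.map f χ₁ = χ ∘ₗ extR (i ∘ₗ f) := by
  ext x r
  simp [extR, hχ]

theorem extR_comp_incl (i : X →ₗ[k] R) : extR i ∘ₗ incl R = i := by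
  ext x; simp [extR, incl]

theorem ext_comp_map {χ₁ χ₂ χ : R →ₗ[k] S} (f : X →ₗ[k] Y) (g : X' →ₗ[k] Y')
    (F : Y →ₗ[k] X' ⊗[k] R)
    (hχ : ∀ a b, χ₂ a * χ₁ b = χ (a * b)) :
    ext (TensorProduct.map g χ₂ ∘ₗ F) ∘ₗ TensorProduct.map f χ₁ =
      TensorProduct.map g χ ∘ₗ ext (F ∘ₗ f) := by
  ext x r
  simp [ext]
  generalize F (f x) = z
  induction z with
  | zero => simp
  | tmul y s => simp [hχ]
  | add a b ha hb => simp [TensorProduct.add_tmul, ha, hb]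

theorem ext_comp_incl (F : X →ₗ[k] Y ⊗[k] R) : ext F ∘ₗ incl R = F := by
  ext x
  simp [ext, incl]
  generalize F x = z
  induction z with
  | zero => simp
  | tmul y s => simp
  | add a b ha hb => simp [TensorProduct.add_tmul, ha, hb]

theorem ext_incl : ext (incl R : X →ₗ[k] X ⊗[k] R) = LinearMap.id := by
  ext x r
  simp [ext, incl]

end juxt

end SignLemmas

/-! ### Naturality of the structure maps under the sign involutions -/

section Naturality

variable {k : Type u} [Field k] {A : Type v} [AddCommGroup A] [Module k A]

theorem bar_induction {P : Bar k A → Prop} (one : P 1)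
    (cons : ∀ a x, P x → P (TensorAlgebra.ι k a * x))
    (smul : ∀ (c : k) x, P x → P (c • x)) (add : ∀ x y, P x → P y → P (x + y)) (x : Bar k A) :
    P x := by
  -- The statement is strengthened to left multiplication by `x`, so that the product case of the
  -- general induction becomes composition and a word is built letter by letter from the left.
  suffices h : ∀ y, P y → P (x * y) by simpa using h 1 one
  induction x using TensorAlgebra.induction with
  | algebraMap r => intro y hy; rw [← Algebra.smul_def]; exact smul r y hy
  | ι a => exact cons a
  | mul x y hx hy => intro z hz; rw [mul_assoc]; exact hx _ (hy _ hz)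
  | add x y hx hy => intro z hz; rw [add_mul]; exact add _ _ (hx z hz) (hy z hz)

theorem bar_linearMap_ext {M : Type*} [AddCommMonoid M] [Module k M] {f g : Bar k A →ₗ[k] M}
    (one : f 1 = g 1)
    (cons : ∀ a x, f x = g x → f (TensorAlgebra.ι k a * x) = g (TensorAlgebra.ι k a * x)) :
    f = g :=
  LinearMap.ext <| bar_induction one cons (fun c x h => by simp [h])
    (fun x y hx hy => by simp [hx, hy])

variable (k A) in
/-- The counit of the tensor coalgebra. -/
def counit : Bar k A →ₗ[k] k := (TensorAlgebra.algebraMapInv (R := k) (M := A)).toLinearMap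

theorem counit_one : counit k A 1 = 1 := by simp [counit]

theorem counit_ι_mul (a : A) (x : Bar k A) : counit k A (TensorAlgebra.ι k a * x) = 0 := by
  simp [counit, TensorAlgebra.algebraMapInv]

/-- A word starting with `a` has length one exactly when its tail is empty, and the counit detects
the empty tail. In this way projections to single letters turn into counits. -/
theorem pr_ι_mul (a : A) (x : Bar k A) :
    pr k A (TensorAlgebra.ι k a * x) = counit k A x • a := by
  refine LinearMap.congr_fun (f := pr k A ∘ₗ LinearMap.mulLeft k (TensorAlgebra.ι k a))
    (g := (counit k A).smulRight a) (bar_linearMap_ext ?_ fun b x _ => ?_) x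
  · simp [pr_ι, counit_one]
  · simp [pr_ι_mul_ι_mul, counit_ι_mul]

theorem pr_mul_ι_mul (x : Bar k A) (a : A) (y : Bar k A) :
    pr k A (x * (TensorAlgebra.ι k a * y)) = (counit k A x * counit k A y) • a := by
  refine LinearMap.congr_fun (f := pr k A ∘ₗ LinearMap.mulRight k (TensorAlgebra.ι k a * y))
    (g := (counit k A).smulRight (counit k A y • a))
    (bar_linearMap_ext ?_ fun b x _ => ?_) x |>.trans (by simp [mul_smul])
  · simp [pr_ι_mul, counit_one]
  · simp only [LinearMap.comp_apply, LinearMap.mulRight_apply, mul_assoc, pr_ι_mul,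
      LinearMap.smulRight_apply, counit_ι_mul, zero_smul]
    simp [counit, TensorAlgebra.algebraMapInv]

theorem counit_right : TensorProduct.map LinearMap.id (counit k A) ∘ₗ deconc k A =
    (TensorProduct.rid k (Bar k A)).symm.toLinearMap := by
  have h : ∀ (a : A) (z : Bar k A ⊗[k] Bar k A),
      TensorProduct.map LinearMap.id (counit k A) ((TensorAlgebra.ι k a ⊗ₜ[k] 1) * z) =
        TensorProduct.map (LinearMap.mulLeft k (TensorAlgebra.ι k a)) LinearMap.id
          (TensorProduct.map LinearMap.id (counit k A) z) := by
    intro a z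
    induction z with
    | zero => simp
    | tmul x y => simp
    | add x y hx hy => simp only [mul_add, map_add, hx, hy]
  refine bar_linearMap_ext ?_ fun a x hx => ?_
  · simp [deconc_one, counit_one]
  · simp only [LinearMap.comp_apply] at hx
    simp only [LinearMap.comp_apply, deconc_ι_mul, map_add, h, hx]
    simp [counit_ι_mul]

theorem counit_left : TensorProduct.map (counit k A) LinearMap.id ∘ₗ deconc k A =
    (TensorProduct.lid k (Bar k A)).symm.toLinearMap := by
  have h : ∀ (a : A) (z : Bar k A ⊗[k] Bar k A),
      TensorProduct.map (counit k A) LinearMap.id ((TensorAlgebra.ι k a ⊗ₜ[k] 1) * z) = 0 := by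
    intro a z
    induction z with
    | zero => simp
    | tmul x y => simp [counit_ι_mul]
    | add x y hx hy => simp only [mul_add, map_add, hx, hy, add_zero]
  refine bar_linearMap_ext ?_ fun a x hx => ?_
  · simp [deconc_one, counit_one]
  · simp only [LinearMap.comp_apply, deconc_ι_mul, map_add, h]
    simp [counit_one]

/-- Among all cuts only the one leaving a single letter in the middle survives `pr`. By the counit
axioms both outer words are then returned whole. This makes `mapA` of the identity the identity. -/
theorem pr_word_split :
    TensorProduct.map LinearMap.id (TensorProduct.map (pr k A ∘ₗ word k A) LinearMap.id) ∘ₗ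
      split k A = LinearMap.id := by
  have h : (TensorProduct.map (LinearMap.id (M := Bar k A))
        (TensorProduct.map (pr k A ∘ₗ word k A) (LinearMap.id (M := Bar k A)))) ∘ₗ
      (TensorProduct.map LinearMap.id
      ((TensorProduct.assoc k (Bar k A) (A ⊗[k] Bar k A) (Bar k A)).symm.toLinearMap ∘ₗ
        TensorProduct.map LinearMap.id
          (TensorProduct.assoc k A (Bar k A) (Bar k A)).symm.toLinearMap)) ∘ₗ
      (TensorProduct.assoc k (Bar k A) (Bar k A)
        (A ⊗[k] (Bar k A ⊗[k] Bar k A))).toLinearMap =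
      TensorProduct.map ((TensorProduct.rid k (Bar k A)).toLinearMap ∘ₗ
          TensorProduct.map LinearMap.id (counit k A))
        (TensorProduct.map LinearMap.id ((TensorProduct.lid k (Bar k A)).toLinearMap ∘ₗ
          TensorProduct.map (counit k A) LinearMap.id)) := by
    ext x x' a y y'
    simp [word, pr_mul_ι_mul, mul_smul, ← TensorProduct.smul_tmul']
    exact smul_comm _ _ _
  calc _ = _ ∘ₗ TensorProduct.map (deconc k A) (TensorProduct.map LinearMap.id (deconc k A)) :=
        congrArg (· ∘ₗ TensorProduct.map (deconc k A)
          (TensorProduct.map LinearMap.id (deconc k A))) h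
    _ = _ := by
      rw [← TensorProduct.map_comp, ← TensorProduct.map_comp, LinearMap.comp_assoc,
        LinearMap.comp_assoc, counit_left, counit_right]
      ext; simp

/-- The complementary degenerate cut: the outer pieces are empty and the middle piece is everything.
-/
theorem counit_split :
    TensorProduct.map (counit k A) (TensorProduct.map LinearMap.id (counit k A)) ∘ₗ split k A =
      (TensorProduct.lid k _).symm.toLinearMap ∘ₗ (TensorProduct.rid k _).symm.toLinearMap := by
  have h : (TensorProduct.map (counit k A)
        (TensorProduct.map (LinearMap.id (M := BiBar k A)) (counit k A))) ∘ₗ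
      (TensorProduct.map LinearMap.id
      ((TensorProduct.assoc k (Bar k A) (A ⊗[k] Bar k A) (Bar k A)).symm.toLinearMap ∘ₗ
        TensorProduct.map LinearMap.id
          (TensorProduct.assoc k A (Bar k A) (Bar k A)).symm.toLinearMap)) ∘ₗ
      (TensorProduct.assoc k (Bar k A) (Bar k A)
        (A ⊗[k] (Bar k A ⊗[k] Bar k A))).toLinearMap =
      ((TensorProduct.lid k _).symm.toLinearMap ∘ₗ (TensorProduct.rid k _).symm.toLinearMap) ∘ₗ
      TensorProduct.map ((TensorProduct.lid k (Bar k A)).toLinearMap ∘ₗ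
          TensorProduct.map (counit k A) LinearMap.id)
        (TensorProduct.map LinearMap.id ((TensorProduct.rid k (Bar k A)).toLinearMap ∘ₗ
          TensorProduct.map LinearMap.id (counit k A))) := by
    ext x x' a y y'
    have e : ∀ (c d : k) (z : BiBar k A),
        c ⊗ₜ[k] (z ⊗ₜ[k] d) = (1 : k) ⊗ₜ[k] ((c • d • z) ⊗ₜ[k] (1 : k)) := fun c d z => by
      conv_lhs => rw [show c = c • (1 : k) by simp, show d = d • (1 : k) by simp]
      simp only [TensorProduct.tmul_smul, ← TensorProduct.smul_tmul']
      exact smul_comm _ _ _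
    simp [e]
    simp only [one_smul, ← TensorProduct.smul_tmul', TensorProduct.tmul_smul]
    exact smul_comm _ _ _
  calc _ = _ ∘ₗ TensorProduct.map (deconc k A) (TensorProduct.map LinearMap.id (deconc k A)) :=
        congrArg (· ∘ₗ TensorProduct.map (deconc k A)
          (TensorProduct.map LinearMap.id (deconc k A))) h
    _ = _ := by
      rw [LinearMap.comp_assoc, ← TensorProduct.map_comp, ← TensorProduct.map_comp,
        LinearMap.comp_assoc, LinearMap.comp_assoc _ _ (TensorProduct.rid k (Bar k A)).toLinearMap,
        LinearMap.comp_assoc, counit_left, counit_right]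
      ext; simp

variable (𝒜 : ℤ → Submodule k A) [DirectSum.Decomposition 𝒜]

theorem sA_sA : sA 𝒜 ∘ₗ sA 𝒜 = LinearMap.id := by
  ext x
  have := LinearMap.congr_fun (sign_comp_sign 𝒜) x
  simpa [sA] using this

theorem sT_one : sT 𝒜 1 = 1 := by simp [sT]

theorem sT_mul (x y : Bar k A) : sT 𝒜 (x * y) = sT 𝒜 x * sT 𝒜 y := by simp [sT]

theorem sT_ι (a : A) : sT 𝒜 (TensorAlgebra.ι k a) = TensorAlgebra.ι k (sA 𝒜 a) := by simp [sT]

theorem sT_sT : sT 𝒜 ∘ₗ sT 𝒜 = LinearMap.id :=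
  bar_linearMap_ext (by simp [sT_one]) fun a x hx => by
    have := LinearMap.congr_fun (sA_sA 𝒜) a
    simp only [LinearMap.comp_apply, LinearMap.id_apply] at hx this
    simp [sT_mul, sT_ι, hx, this]

theorem sP_sP : sP 𝒜 ∘ₗ sP 𝒜 = LinearMap.id := by
  simp [sP, ← TensorProduct.map_comp, sT_sT, sA_sA]

theorem map_sP_sA :
    TensorProduct.map (sP 𝒜) (sA 𝒜) ∘ₗ TensorProduct.map (sP 𝒜) (sA 𝒜) = LinearMap.id := by
  simp [← TensorProduct.map_comp, sP_sP, sA_sA]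

theorem tw_sP (m : ℤ) : tw (sP 𝒜) m =
    TensorProduct.map (tw (sT 𝒜) m) (TensorProduct.map (tw (sA 𝒜) m) (tw (sT 𝒜) m)) := by
  rw [map_tw, map_tw, sP]

theorem counit_sT : counit k A ∘ₗ sT 𝒜 = counit k A :=
  bar_linearMap_ext (by simp [sT_one]) fun a x _ => by
    simp [sT_mul, sT_ι, counit_ι_mul]

theorem deconc_sT : deconc k A ∘ₗ sT 𝒜 = TensorProduct.map (sT 𝒜) (sT 𝒜) ∘ₗ deconc k A := by
  have h : ∀ (a : A) (z : Bar k A ⊗[k] Bar k A),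
      TensorProduct.map (sT 𝒜) (sT 𝒜) ((TensorAlgebra.ι k a ⊗ₜ[k] 1) * z) =
        (TensorAlgebra.ι k (sA 𝒜 a) ⊗ₜ[k] 1) * TensorProduct.map (sT 𝒜) (sT 𝒜) z := by
    intro a z
    induction z with
    | zero => simp
    | tmul x y => simp [sT_mul, sT_ι]
    | add x y hx hy => simp only [mul_add, map_add, hx, hy]
  refine bar_linearMap_ext ?_ fun a x hx => ?_
  · simp [deconc_one, sT_one]
  · simp only [LinearMap.comp_apply] at hx
    simp only [LinearMap.comp_apply, deconc_ι_mul, sT_mul, sT_ι, map_add, h, hx]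
    simp [sT_mul, sT_ι, sT_one]

theorem pr_sT : pr k A ∘ₗ sT 𝒜 = sA 𝒜 ∘ₗ pr k A :=
  bar_linearMap_ext (by simp [sT_one, pr_one]) fun a x _ => by
    have := LinearMap.congr_fun (counit_sT 𝒜) x
    simp only [LinearMap.comp_apply] at this
    simp [sT_mul, sT_ι, pr_ι_mul, this]

theorem word_sP : word k A ∘ₗ sP 𝒜 = sT 𝒜 ∘ₗ word k A := by
  ext x a y
  simp [word, sP, sT_mul, sT_ι]

theorem split_sP : split k A ∘ₗ sP 𝒜 =
    TensorProduct.map (sT 𝒜) (TensorProduct.map (sP 𝒜) (sT 𝒜)) ∘ₗ split k A := by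
  have h : ((TensorProduct.map LinearMap.id
      ((TensorProduct.assoc k (Bar k A) (A ⊗[k] Bar k A) (Bar k A)).symm.toLinearMap ∘ₗ
        TensorProduct.map LinearMap.id
          (TensorProduct.assoc k A (Bar k A) (Bar k A)).symm.toLinearMap)) ∘ₗ
      (TensorProduct.assoc k (Bar k A) (Bar k A)
        (A ⊗[k] (Bar k A ⊗[k] Bar k A))).toLinearMap) ∘ₗ
      TensorProduct.map (TensorProduct.map (sT 𝒜) (sT 𝒜))
        (TensorProduct.map (sA 𝒜) (TensorProduct.map (sT 𝒜) (sT 𝒜))) =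
      TensorProduct.map (sT 𝒜) (TensorProduct.map (sP 𝒜) (sT 𝒜)) ∘ₗ
      ((TensorProduct.map LinearMap.id
      ((TensorProduct.assoc k (Bar k A) (A ⊗[k] Bar k A) (Bar k A)).symm.toLinearMap ∘ₗ
        TensorProduct.map LinearMap.id
          (TensorProduct.assoc k A (Bar k A) (Bar k A)).symm.toLinearMap)) ∘ₗ
      (TensorProduct.assoc k (Bar k A) (Bar k A)
        (A ⊗[k] (Bar k A ⊗[k] Bar k A))).toLinearMap) := by
    ext x x' a y y'
    simp [sP]
  have h' := congrArg (· ∘ₗ TensorProduct.map (deconc k A)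
    (TensorProduct.map LinearMap.id (deconc k A))) h
  simp only [LinearMap.comp_assoc] at h'
  simp only [split, LinearMap.comp_assoc]
  rw [← h', ← TensorProduct.map_comp, ← TensorProduct.map_comp, ← deconc_sT, sP,
    ← TensorProduct.map_comp, ← TensorProduct.map_comp, LinearMap.comp_id, LinearMap.id_comp]

theorem koszul_comp_map {X Y X' Y' : Type*} [AddCommMonoid X] [Module k X] [AddCommMonoid Y]
    [Module k Y] [AddCommMonoid X'] [Module k X'] [AddCommMonoid Y'] [Module k Y']
    {s : X →ₗ[k] X} {t : Y →ₗ[k] Y} {s' : X' →ₗ[k] X'}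
    {t' : Y' →ₗ[k] Y'} {f : X →ₗ[k] X'} {g : Y →ₗ[k] Y'} (hf : f ∘ₗ s = s' ∘ₗ f)
    (hg : g ∘ₗ t = t' ∘ₗ g) :
    koszul s' t' ∘ₗ TensorProduct.map f g = TensorProduct.map f g ∘ₗ koszul s t := by
  simp only [koszul, LinearMap.add_comp, LinearMap.smul_comp, LinearMap.comp_add,
    LinearMap.comp_smul, ← TensorProduct.map_comp, hf, hg, LinearMap.id_comp, LinearMap.comp_id]

variable (k A) in
/-- The reordering of tensor factors in `rot`, without the sign. -/
def rotPerm : Bar k A ⊗[k] ((BiBar k A ⊗[k] Bar k A) ⊗[k] A) →ₗ[k] BiBar k A ⊗[k] BiBar k A :=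
  (TensorProduct.map LinearMap.id (TensorProduct.assoc k (Bar k A) A (Bar k A)).toLinearMap) ∘ₗ
  (TensorProduct.assoc k (BiBar k A) (Bar k A ⊗[k] A) (Bar k A)).toLinearMap ∘ₗ
  (TensorProduct.map (TensorProduct.assoc k (BiBar k A) (Bar k A) A).toLinearMap LinearMap.id) ∘ₗ
  (TensorProduct.comm k (Bar k A) ((BiBar k A ⊗[k] Bar k A) ⊗[k] A)).toLinearMap

theorem rotPerm_tmul (x : Bar k A) (z : BiBar k A) (y : Bar k A) (b : A) :
    rotPerm k A (x ⊗ₜ ((z ⊗ₜ y) ⊗ₜ b)) = z ⊗ₜ (y ⊗ₜ (b ⊗ₜ x)) := by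
  simp [rotPerm]

theorem rot_eq : rot 𝒜 = rotPerm k A ∘ₗ
    koszul (sT 𝒜) (TensorProduct.map (TensorProduct.map (sP 𝒜) (sT 𝒜)) (sA 𝒜)) ∘ₗ
    (TensorProduct.assoc k (Bar k A) (BiBar k A ⊗[k] Bar k A) A).toLinearMap ∘ₗ
    TensorProduct.map (split k A) LinearMap.id := rfl

/-- A rotation preserves total degree, so it commutes with the global sign involution; the Koszul
sign inside it depends only on degrees. -/
theorem rot_map_sP_sA : rot 𝒜 ∘ₗ TensorProduct.map (sP 𝒜) (sA 𝒜) =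
    TensorProduct.map (sP 𝒜) (sP 𝒜) ∘ₗ rot 𝒜 := by
  have h1 : rotPerm k A ∘ₗ TensorProduct.map (sT 𝒜)
      (TensorProduct.map (TensorProduct.map (sP 𝒜) (sT 𝒜)) (sA 𝒜)) =
      TensorProduct.map (sP 𝒜) (sP 𝒜) ∘ₗ rotPerm k A := by
    refine TensorProduct.ext' fun x z => ?_
    induction z with
    | zero => simp only [TensorProduct.tmul_zero, map_zero]
    | add z z' h h' => simp only [TensorProduct.tmul_add, map_add, h, h']
    | tmul z b =>
      induction z with
      | zero => simp only [TensorProduct.zero_tmul, TensorProduct.tmul_zero, map_zero]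
      | add z z' h h' =>
        simp only [TensorProduct.add_tmul, TensorProduct.tmul_add, map_add, h, h']
      | tmul z y =>
        simp only [LinearMap.comp_apply, TensorProduct.map_tmul, rotPerm_tmul]
        simp [sP]
  have h2 : (TensorProduct.assoc k (Bar k A) (BiBar k A ⊗[k] Bar k A) A).toLinearMap ∘ₗ
      TensorProduct.map (TensorProduct.map (sT 𝒜) (TensorProduct.map (sP 𝒜) (sT 𝒜))) (sA 𝒜) =
      TensorProduct.map (sT 𝒜) (TensorProduct.map (TensorProduct.map (sP 𝒜) (sT 𝒜)) (sA 𝒜)) ∘ₗ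
      (TensorProduct.assoc k (Bar k A) (BiBar k A ⊗[k] Bar k A) A).toLinearMap :=
    TensorProduct.ext_threefold fun x y z => by simp
  rw [rot_eq, LinearMap.comp_assoc, LinearMap.comp_assoc, LinearMap.comp_assoc,
    ← TensorProduct.map_comp, split_sP, LinearMap.id_comp, ← LinearMap.comp_id (sA 𝒜),
    TensorProduct.map_comp, ← LinearMap.comp_assoc _ _ (TensorProduct.assoc _ _ _ _).toLinearMap,
    LinearMap.comp_id, h2, LinearMap.comp_assoc, ← LinearMap.comp_assoc _ _ (koszul _ _),
    koszul_comp_map rfl rfl, LinearMap.comp_assoc, ← LinearMap.comp_assoc _ _ (rotPerm k A), h1,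
    LinearMap.comp_assoc]

/-- If the rotated word `y'' b x'` is to have length one, then `x'` and `y''` are empty. Nothing has
jumped over anything, so the term carries no sign and the original tensor is recovered. -/
theorem pr_word_rot (h2 : (2 : k) ≠ 0) :
    TensorProduct.map LinearMap.id (pr k A ∘ₗ word k A) ∘ₗ rot 𝒜 = LinearMap.id := by
  have h1 : TensorProduct.map LinearMap.id (pr k A ∘ₗ word k A) ∘ₗ rotPerm k A =
      (TensorProduct.lid k (BiBar k A ⊗[k] A)).toLinearMap ∘ₗ TensorProduct.map (counit k A)
        (TensorProduct.map ((TensorProduct.rid k _).toLinearMap ∘ₗ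
          TensorProduct.map LinearMap.id (counit k A)) LinearMap.id) := by
    refine TensorProduct.ext' fun x z => ?_
    induction z with
    | zero => simp only [TensorProduct.tmul_zero, map_zero]
    | add z z' h h' => simp only [TensorProduct.tmul_add, map_add, h, h']
    | tmul z b =>
      induction z with
      | zero => simp only [TensorProduct.zero_tmul, TensorProduct.tmul_zero, map_zero]
      | add z z' h h' =>
        simp only [TensorProduct.add_tmul, TensorProduct.tmul_add, map_add, h, h']
      | tmul z y =>
        simp only [LinearMap.comp_apply, TensorProduct.map_tmul, rotPerm_tmul]
        simp [word, pr_mul_ι_mul, ← TensorProduct.smul_tmul', smul_smul, mul_comm]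
  -- The counit is invariant under `sT`, so the piece it retains is even and the Koszul sign is
  -- trivial on it.
  have h3 : TensorProduct.map (counit k A) LinearMap.id ∘ₗ
      koszul (sT 𝒜) (TensorProduct.map (TensorProduct.map (sP 𝒜) (sT 𝒜)) (sA 𝒜)) =
      TensorProduct.map (counit k A) LinearMap.id := by
    refine TensorProduct.ext' fun x z => ?_
    have := LinearMap.congr_fun (counit_sT 𝒜) x
    have h : (2 : k)⁻¹ + 2⁻¹ = 1 := by rw [← two_mul, mul_inv_cancel₀ h2]
    simp only [LinearMap.comp_apply] at this
    simp only [LinearMap.comp_apply, koszul_tmul, map_smul, map_add, TensorProduct.map_tmul, this,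
      LinearMap.id_apply]
    generalize counit k A x ⊗ₜ[k] z = p
    generalize counit k A x ⊗ₜ[k] (_ : (BiBar k A ⊗[k] Bar k A) ⊗[k] A) = q
    calc _ = ((2 : k)⁻¹ + 2⁻¹) • p := by module
      _ = _ := by rw [h, one_smul]
  have h4 : TensorProduct.map LinearMap.id (pr k A ∘ₗ word k A) ∘ₗ rotPerm k A ∘ₗ
      koszul (sT 𝒜) (TensorProduct.map (TensorProduct.map (sP 𝒜) (sT 𝒜)) (sA 𝒜)) =
      TensorProduct.map LinearMap.id (pr k A ∘ₗ word k A) ∘ₗ rotPerm k A := by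
    rw [← LinearMap.comp_assoc, h1,
      show TensorProduct.map (counit k A)
        (TensorProduct.map ((TensorProduct.rid k (BiBar k A)).toLinearMap ∘ₗ
          TensorProduct.map LinearMap.id (counit k A)) (LinearMap.id (M := A))) =
        TensorProduct.map LinearMap.id
          (TensorProduct.map ((TensorProduct.rid k (BiBar k A)).toLinearMap ∘ₗ
          TensorProduct.map LinearMap.id (counit k A)) (LinearMap.id (M := A))) ∘ₗ
        TensorProduct.map (counit k A) LinearMap.id from by
          rw [← TensorProduct.map_comp]; rfl, LinearMap.comp_assoc, LinearMap.comp_assoc, h3]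
  have h5 : TensorProduct.map LinearMap.id (pr k A ∘ₗ word k A) ∘ₗ rotPerm k A ∘ₗ
      (TensorProduct.assoc k (Bar k A) (BiBar k A ⊗[k] Bar k A) A).toLinearMap =
      TensorProduct.map ((TensorProduct.rid k _).toLinearMap ∘ₗ
        (TensorProduct.lid k _).toLinearMap ∘ₗ
        TensorProduct.map (counit k A) (TensorProduct.map LinearMap.id (counit k A)))
        (LinearMap.id (M := A)) := by
    rw [← LinearMap.comp_assoc, h1]
    refine TensorProduct.ext_threefold fun x y b => ?_
    simp [← TensorProduct.smul_tmul']
  rw [rot_eq, ← LinearMap.comp_assoc _ _ (rotPerm k A), ← LinearMap.comp_assoc, h4,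
    LinearMap.comp_assoc, ← LinearMap.comp_assoc _ _ (rotPerm k A), ← LinearMap.comp_assoc, h5,
    ← TensorProduct.map_comp, LinearMap.comp_assoc, LinearMap.comp_assoc, counit_split]
  refine TensorProduct.ext' fun z b => ?_
  simp

end Naturality

/-! ### Change of coefficients along maps of nonzero degree -/

section Shift

variable {k : Type u} [Field k] {A : Type v} [AddCommGroup A] [Module k A]
  {R S : Type*} [Ring R] [Algebra k R] [Ring S] [Algebra k S]

/-- `φ : R → S` is a homomorphism of graded algebras and `χ : R → S` is a map of
`R`-bimodules of degree `n`. -/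
structure IsShift (ℛ : ℤ → Submodule k R) (𝒮 : ℤ → Submodule k S) (φ χ : R →ₗ[k] S) (n : ℤ) :
    Prop where
  one : φ 1 = 1
  mul : ∀ a b, φ a * φ b = φ (a * b)
  mul_left : ∀ a b, φ a * χ b = χ (a * b)
  mul_right : ∀ a b, χ a * φ b = χ (a * b)
  base_mem : ∀ i, ∀ r ∈ ℛ i, φ r ∈ 𝒮 i
  mem : ∀ i, ∀ r ∈ ℛ i, χ r ∈ 𝒮 (i + n)

theorem IsShift.base {ℛ : ℤ → Submodule k R} {𝒮 : ℤ → Submodule k S} {φ χ : R →ₗ[k] S} {n : ℤ}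
    (h : IsShift ℛ 𝒮 φ χ n) : IsShift ℛ 𝒮 φ φ 0 :=
  ⟨h.one, h.mul, h.mul, h.mul, h.base_mem, by simpa using h.base_mem⟩

theorem IsShift.id (ℛ : ℤ → Submodule k R) : IsShift ℛ ℛ LinearMap.id LinearMap.id 0 := by
  constructor <;> simp

section

variable {X X' Y Y' : Type*} [AddCommMonoid X] [Module k X] [AddCommMonoid Y] [Module k Y]
  [AddCommMonoid X'] [Module k X'] [AddCommMonoid Y'] [Module k Y']
  {ℛ : ℤ → Submodule k R} [DirectSum.Decomposition ℛ]
  {𝒮 : ℤ → Submodule k S} [DirectSum.Decomposition 𝒮]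
  {φ χ χ₂ χ₃ : R →ₗ[k] S} {n : ℤ}

/-- Pulling the degree `n` coefficient of the first factor past the second twists the second by `n`.
The free parameter `m` carries a sign twist already present on the outputs, so that such rules can
be nested. -/
theorem IsShift.juxt (h : IsShift ℛ 𝒮 φ χ n) (hχ : ∀ a b, χ a * χ₂ b = χ₃ (a * b))
    {s : X' →ₗ[k] X'} {t : Y' →ₗ[k] Y'} (ht : t ∘ₗ t = LinearMap.id) (m : ℤ)
    (F : X →ₗ[k] X' ⊗[k] R) (G : Y →ₗ[k] Y' ⊗[k] R) :
    juxt (sign 𝒮) t ∘ₗ TensorProduct.map (TensorProduct.map (tw s m) χ ∘ₗ F)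
        (TensorProduct.map (tw t m) χ₂ ∘ₗ G) =
      TensorProduct.map (tw (TensorProduct.map s t) m) χ₃ ∘ₗ InftyInner.juxt (sign ℛ) t ∘ₗ
        TensorProduct.map F (TensorProduct.map (tw t n) LinearMap.id ∘ₗ G) := by
  rw [TensorProduct.map_comp, ← LinearMap.comp_assoc,
    juxt_comp_map (n := n) (sR := sign ℛ) (sY := t) (χ := χ₃) _ _ _ ht hχ
      (sign_comp_of_shift ℛ 𝒮 h.mem), map_tw, LinearMap.comp_assoc, LinearMap.comp_assoc,
    ← TensorProduct.map_comp, LinearMap.id_comp]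
  exact (comp_tw_of_comp rfl m).symm

/-- The right factor is an argument with coefficient `1`. The twist by `n` it receives merges with
the twist by `m` into one global twist by `n + m` on the input. -/
theorem IsShift.juxt_incl_right (h : IsShift ℛ 𝒮 φ χ n)
    {s : X →ₗ[k] X} {s' : X' →ₗ[k] X'} {t : Y →ₗ[k] Y} (ht : t ∘ₗ t = LinearMap.id) (m : ℤ)
    (F : X →ₗ[k] X' ⊗[k] R) :
    InftyInner.juxt (sign 𝒮) t ∘ₗ
        TensorProduct.map (TensorProduct.map (tw s' m) χ ∘ₗ F ∘ₗ tw s (n + m)) (incl S) =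
      TensorProduct.map (tw (TensorProduct.map s' t) m) χ ∘ₗ
        (InftyInner.juxt (sign ℛ) t ∘ₗ TensorProduct.map F (incl R)) ∘ₗ
          tw (TensorProduct.map s t) (n + m) := by
  have e : incl S = TensorProduct.map (tw t m) φ ∘ₗ incl R ∘ₗ tw t m := by
    rw [← LinearMap.comp_assoc, map_comp_incl _ h.one, LinearMap.comp_assoc, tw_tw ht,
      LinearMap.comp_id]
  rw [e, h.juxt h.mul_right ht, ← LinearMap.comp_assoc _ (incl R), map_comp_incl _ rfl,
    LinearMap.comp_assoc _ _ (incl R), tw_comp_tw ht, TensorProduct.map_comp, map_tw,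
    LinearMap.comp_assoc]

/-- Here the coefficient crosses nothing. The twist by `p`, which is the sign of a degree `p` map
passing the left argument, splits by parity as `m + (p - n) + (n + m)`: stripped of its coefficient,
the map has degree `p - n`. -/
theorem IsShift.juxt_incl_left (h : IsShift ℛ 𝒮 φ χ n)
    {s : X →ₗ[k] X} {t : Y →ₗ[k] Y} {t' : Y' →ₗ[k] Y'} (hs : s ∘ₗ s = LinearMap.id)
    (ht' : t' ∘ₗ t' = LinearMap.id) (m p : ℤ) (G : Y →ₗ[k] Y' ⊗[k] R) :
    InftyInner.juxt (sign 𝒮) t' ∘ₗ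
        TensorProduct.map (incl S ∘ₗ tw s p)
          (TensorProduct.map (tw t' m) χ ∘ₗ G ∘ₗ tw t (n + m)) =
      TensorProduct.map (tw (TensorProduct.map s t') m) χ ∘ₗ
        (InftyInner.juxt (sign ℛ) t' ∘ₗ TensorProduct.map (incl R ∘ₗ tw s (p - n)) G) ∘ₗ
          tw (TensorProduct.map s t) (n + m) := by
  have e : incl S ∘ₗ tw s p =
      TensorProduct.map (tw s m) φ ∘ₗ (incl R ∘ₗ tw s (p - n)) ∘ₗ tw s (n + m) := by
    rw [← LinearMap.comp_assoc, ← LinearMap.comp_assoc, map_comp_incl _ h.one,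
      LinearMap.comp_assoc, LinearMap.comp_assoc, tw_comp_tw hs, tw_comp_tw hs]
    congr 1
    exact tw_of_even_sub ⟨-m, by ring⟩
  rw [e, h.base.juxt h.mul_left ht', tw_zero, TensorProduct.map_id, LinearMap.id_comp,
    TensorProduct.map_comp, map_tw, LinearMap.comp_assoc]

end

variable {ℛ : ℤ → Submodule k R} [DirectSum.Decomposition ℛ]
  {𝒮 : ℤ → Submodule k S} [DirectSum.Decomposition 𝒮]
  {φ χ χ₂ χ₃ : R →ₗ[k] S} {n : ℤ}
  (𝒜 : ℤ → Submodule k A) [DirectSum.Decomposition 𝒜]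

theorem pr_shift_word (m q : ℤ) (f : Bar k A →ₗ[k] Bar k A ⊗[k] R) :
    TensorProduct.map (pr k A) LinearMap.id ∘ₗ
        (TensorProduct.map (tw (sT 𝒜) m) χ ∘ₗ f ∘ₗ tw (sT 𝒜) q) ∘ₗ word k A =
      TensorProduct.map (tw (sA 𝒜) m) χ ∘ₗ
        (TensorProduct.map (pr k A) LinearMap.id ∘ₗ f ∘ₗ word k A) ∘ₗ tw (sP 𝒜) q := by
  rw [LinearMap.comp_assoc, LinearMap.comp_assoc, ← comp_tw_of_comp (word_sP 𝒜),
    ← LinearMap.comp_assoc, ← TensorProduct.map_comp, comp_tw_of_comp (pr_sT 𝒜),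
    LinearMap.id_comp, LinearMap.comp_assoc, LinearMap.comp_assoc, ← LinearMap.comp_assoc _ _
      (TensorProduct.map (tw (sA 𝒜) m) χ), ← TensorProduct.map_comp, LinearMap.comp_id]

theorem map_sA_sT :
    TensorProduct.map (sA 𝒜) (sT 𝒜) ∘ₗ TensorProduct.map (sA 𝒜) (sT 𝒜) = LinearMap.id := by
  rw [← TensorProduct.map_comp, sA_sA, sT_sT, TensorProduct.map_id]

/-- Each of the three summands of `f^A` is a nest of juxtapositions in which one factor carries the
coefficient, so the two preceding rules apply from the inside out. -/
theorem IsShift.coderA (h : IsShift ℛ 𝒮 φ χ n) (m p : ℤ) (f : Bar k A →ₗ[k] Bar k A ⊗[k] R) :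
    coderA 𝒜 𝒮 p (TensorProduct.map (tw (sT 𝒜) m) χ ∘ₗ f ∘ₗ tw (sT 𝒜) (n + m)) =
      TensorProduct.map (tw (sP 𝒜) m) χ ∘ₗ InftyInner.coderA 𝒜 ℛ (p - n) f ∘ₗ
        tw (sP 𝒜) (n + m) := by
  have hAT := map_sA_sT 𝒜
  simp only [InftyInner.coderA, LinearMap.add_comp, LinearMap.comp_add]
  congr 1
  · congr 1
    · exact h.juxt_incl_right hAT m f
    · rw [pr_shift_word, h.juxt_incl_right (sT_sT 𝒜)]
      rw [← LinearMap.comp_assoc _ _ (InftyInner.juxt _ _), h.juxt_incl_left (sT_sT 𝒜) hAT,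
        LinearMap.comp_assoc, LinearMap.comp_assoc,
        ← comp_tw_of_comp (split_sP 𝒜), LinearMap.comp_assoc, LinearMap.comp_assoc]
      rfl
  · rw [h.juxt_incl_left (sA_sA 𝒜) (sT_sT 𝒜), h.juxt_incl_left (sT_sT 𝒜) hAT]
    rfl

theorem IsShift.compCoderA (h : IsShift ℛ 𝒮 φ χ n) (hχ : ∀ a b, χ₂ a * χ b = χ₃ (a * b))
    (m p : ℤ) (f : Bar k A →ₗ[k] Bar k A ⊗[k] R) (i : BiBar k A ⊗[k] A →ₗ[k] R) :
    compCoderA 𝒜 𝒮 p (TensorProduct.map (tw (sT 𝒜) m) χ ∘ₗ f ∘ₗ tw (sT 𝒜) (n + m))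
        (χ₂ ∘ₗ i ∘ₗ tw (TensorProduct.map (sP 𝒜) (sA 𝒜)) m) =
      χ₃ ∘ₗ InftyInner.compCoderA 𝒜 ℛ (p - n) f i ∘ₗ
        tw (TensorProduct.map (sP 𝒜) (sA 𝒜)) (n + m) := by
  rw [InftyInner.compCoderA, h.coderA 𝒜, h.juxt_incl_right (sA_sA 𝒜), ← LinearMap.comp_assoc,
    extR_comp_map _ _ hχ, LinearMap.comp_assoc _ _ i, tw_tw (map_sP_sA 𝒜), LinearMap.comp_id]
  rfl

theorem IsShift.coderDualComp (h : IsShift ℛ 𝒮 φ χ n) (hχ : ∀ a b, χ₂ a * χ b = χ₃ (a * b))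
    (m p q : ℤ) (f : Bar k A →ₗ[k] Bar k A ⊗[k] R) (i : BiBar k A ⊗[k] A →ₗ[k] R) :
    coderDualComp 𝒜 𝒮 p q (TensorProduct.map (tw (sT 𝒜) m) χ ∘ₗ f ∘ₗ tw (sT 𝒜) (n + m))
        (χ₂ ∘ₗ i ∘ₗ tw (TensorProduct.map (sP 𝒜) (sA 𝒜)) m) =
      eps k (n * q) • (χ₃ ∘ₗ InftyInner.coderDualComp 𝒜 ℛ (p - n) q f i ∘ₗ
        tw (TensorProduct.map (sP 𝒜) (sA 𝒜)) (n + m)) := by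
  have e : eps k (p * q) = eps k (n * q) * eps k ((p - n) * q) := by
    rw [← eps_add]; congr 1; ring
  rw [InftyInner.coderDualComp, pr_shift_word,
    ← LinearMap.comp_assoc (rot 𝒜) _ (InftyInner.juxt _ _),
    h.juxt_incl_left (sP_sP 𝒜) (sA_sA 𝒜), ← LinearMap.comp_assoc, ← LinearMap.comp_assoc,
    extR_comp_map _ _ hχ, LinearMap.comp_assoc _ _ i, tw_tw (map_sP_sA 𝒜), LinearMap.comp_id,
    InftyInner.coderDualComp]
  simp only [LinearMap.comp_assoc, LinearMap.smul_comp, LinearMap.comp_smul]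
  rw [comp_tw_of_comp (rot_map_sP_sA 𝒜), smul_smul, e, neg_mul_eq_mul_neg]

/-- The coefficient of `i` is multiplied by that of `f`, and `hχ` prescribes the product. The
choices of `χ₂` and `χ` cover the constant, linear and quadratic terms in `t`. The prefactor is left
over from `p q = n q + (p - n) q`. -/
theorem IsShift.delta (h : IsShift ℛ 𝒮 φ χ n) (hχ : ∀ a b, χ₂ a * χ b = χ₃ (a * b))
    (m p q : ℤ) (f : Bar k A →ₗ[k] Bar k A ⊗[k] R) (i : BiBar k A ⊗[k] A →ₗ[k] R) :
    delta 𝒜 𝒮 p q (TensorProduct.map (tw (sT 𝒜) m) χ ∘ₗ f ∘ₗ tw (sT 𝒜) (n + m))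
        (χ₂ ∘ₗ i ∘ₗ tw (TensorProduct.map (sP 𝒜) (sA 𝒜)) m) =
      eps k (n * q) • (χ₃ ∘ₗ InftyInner.delta 𝒜 ℛ (p - n) q f i ∘ₗ
        tw (TensorProduct.map (sP 𝒜) (sA 𝒜)) (n + m)) := by
  have e : eps k (p * q) = eps k (n * q) * eps k ((p - n) * q) := by
    rw [← eps_add]; congr 1; ring
  rw [InftyInner.delta, h.coderDualComp 𝒜 hχ, h.compCoderA 𝒜 hχ, InftyInner.delta, e]
  simp only [LinearMap.sub_comp, LinearMap.comp_sub, LinearMap.smul_comp, LinearMap.comp_smul,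
    smul_sub, mul_smul]

end Shift

/-! ### Degrees -/

section Degrees

variable {k : Type u} [Field k]

theorem tdeg_map {X Y X' Y' : Type*} [AddCommMonoid X] [Module k X] [AddCommMonoid Y]
    [Module k Y] [AddCommMonoid X'] [Module k X'] [AddCommMonoid Y'] [Module k Y']
    {𝒢 : ℤ → Submodule k X} {ℋ : ℤ → Submodule k Y}
    {𝒢' : ℤ → Submodule k X'} {ℋ' : ℤ → Submodule k Y'} {f : X →ₗ[k] X'} {g : Y →ₗ[k] Y'}
    {b : ℤ} (hf : ∀ i, ∀ x ∈ 𝒢 i, f x ∈ 𝒢' i) (hg : ∀ i, ∀ y ∈ ℋ i, g y ∈ ℋ' (i + b))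
    {d : ℤ} {z : X ⊗[k] Y} (hz : z ∈ tdeg 𝒢 ℋ d) :
    TensorProduct.map f g z ∈ tdeg 𝒢' ℋ' (d + b) := by
  suffices h : tdeg 𝒢 ℋ d ≤ (tdeg 𝒢' ℋ' (d + b)).comap (TensorProduct.map f g) from h hz
  refine iSup_le fun q => ?_
  rintro _ ⟨w, rfl⟩
  induction w with
  | zero => simp
  | add x y hx hy => rw [map_add]; exact Submodule.add_mem _ hx hy
  | tmul x y =>
    refine Submodule.mem_iSup_of_mem (q + b) ?_
    have hx : f x ∈ 𝒢' (d + b - (q + b)) := by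
      rw [add_sub_add_right_eq_sub]; exact hf _ _ x.2
    exact ⟨⟨f x, hx⟩ ⊗ₜ ⟨g y, hg _ _ y.2⟩, by simp⟩

theorem tdeg_map_of_mem {X Y : Type*} [AddCommMonoid X] [Module k X] [AddCommMonoid Y]
    [Module k Y] {𝒢 : ℤ → Submodule k X} {ℋ : ℤ → Submodule k Y} {f : X →ₗ[k] X} {g : Y →ₗ[k] Y}
    (hf : ∀ i, ∀ x ∈ 𝒢 i, f x ∈ 𝒢 i) (hg : ∀ i, ∀ y ∈ ℋ i, g y ∈ ℋ i)
    {d : ℤ} {z : X ⊗[k] Y} (hz : z ∈ tdeg 𝒢 ℋ d) : TensorProduct.map f g z ∈ tdeg 𝒢 ℋ d := by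
  have := tdeg_map (b := 0) hf (fun i y hy => by rw [add_zero]; exact hg i y hy) hz
  rwa [add_zero] at this

theorem tdeg_incl {X R : Type*} [AddCommMonoid X] [Module k X] [Ring R] [Algebra k R]
    {𝒢 : ℤ → Submodule k X} {ℛ : ℤ → Submodule k R} (h1 : 1 ∈ ℛ 0) {d : ℤ} {x : X}
    (hx : x ∈ 𝒢 d) : incl R x ∈ tdeg 𝒢 ℛ d := by
  refine Submodule.mem_iSup_of_mem 0 ?_
  have hx : x ∈ 𝒢 (d - 0) := by rwa [sub_zero]
  exact ⟨⟨x, hx⟩ ⊗ₜ ⟨1, h1⟩, by simp [incl]⟩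

variable {A : Type v} [AddCommGroup A] [Module k A] (𝒜 : ℤ → Submodule k A)

/-- Words in homogeneous letters span `TA`, which suffices for comparing linear maps; independence
of the graded pieces plays no role. -/
theorem barDeg_linearMap_ext [DirectSum.Decomposition 𝒜] {M : Type*} [AddCommMonoid M]
    [Module k M] {f g : Bar k A →ₗ[k] M}
    (h : ∀ d, ∀ x ∈ barDeg 𝒜 d, f x = g x) : f = g := by
  let W : Submodule k (Bar k A) := Submodule.span k {x | ∃ l : List (ℤ × A),
    (∀ p ∈ l, p.2 ∈ susp 𝒜 p.1) ∧ (l.map fun p => TensorAlgebra.ι k p.2).prod = x}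
  have hW : ∀ x, x ∈ W := by
    refine bar_induction (Submodule.subset_span ⟨[], by simp, by simp⟩) (fun a x hx => ?_)
      (fun c x => Submodule.smul_mem _ c) fun x y => Submodule.add_mem _
    induction a using DirectSum.Decomposition.inductionOn 𝒜 with
    | zero => simp
    | add a b ha hb => rw [map_add, add_mul]; exact Submodule.add_mem _ ha hb
    | @homogeneous i a =>
      induction hx using Submodule.span_induction with
      | zero => simp
      | add x y _ _ hx hy => rw [mul_add]; exact Submodule.add_mem _ hx hy
      | smul c x _ hx => rw [mul_smul_comm]; exact Submodule.smul_mem _ c hx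
      | mem x hx =>
        obtain ⟨l, hl, rfl⟩ := hx
        refine Submodule.subset_span ⟨(i + 1, (a : A)) :: l, ?_, by simp⟩
        rintro p hp
        rcases List.mem_cons.1 hp with rfl | hp
        · simp [susp]
        · exact hl p hp
  refine LinearMap.ext fun x => ?_
  refine LinearMap.eqOn_span (s := {x | ∃ l : List (ℤ × A),
    (∀ p ∈ l, p.2 ∈ susp 𝒜 p.1) ∧ (l.map fun p => TensorAlgebra.ι k p.2).prod = x}) ?_ (hW x)
  rintro _ ⟨l, hl, rfl⟩
  exact h _ _ (Submodule.subset_span ⟨l, hl, rfl, rfl⟩)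

theorem isComap_zero {R : Type*} [Ring R] [Algebra k R] {ℛ : ℤ → Submodule k R} (p : ℤ) :
    IsComap 𝒜 ℛ p 0 := fun d z _ => by
  rw [LinearMap.zero_apply]; exact Submodule.zero_mem _

variable [DirectSum.Decomposition 𝒜]

theorem sA_of_mem {i : ℤ} {a : A} (ha : a ∈ susp 𝒜 i) : sA 𝒜 a = eps k i • a := by
  -- The suspension shifts degrees by one, which accounts for the minus sign in `sA`.
  have h : eps k i = -eps k (i - 1) := by
    rw [show i = (i - 1) + 1 by ring, eps_add, eps_odd (n := 1) (by simp)]; simp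
  rw [sA, LinearMap.neg_apply, sign_of_mem 𝒜 ha, h, neg_smul]

theorem sT_of_mem {d : ℤ} {x : Bar k A} (hx : x ∈ barDeg 𝒜 d) : sT 𝒜 x = eps k d • x := by
  induction hx using Submodule.span_induction with
  | zero => simp
  | add x y _ _ hx hy => rw [map_add, hx, hy, smul_add]
  | smul c x _ hx => rw [map_smul, hx, smul_comm]
  | mem x hx =>
    obtain ⟨l, hl, rfl, rfl⟩ := hx
    induction l with
    | nil => simp [sT_one, eps_zero]
    | cons p l ih =>
      have h1 := sA_of_mem 𝒜 (hl p List.mem_cons_self)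
      have h2 := ih fun q hq => hl q (List.mem_cons_of_mem _ hq)
      simp only [List.map_cons, List.prod_cons, List.sum_cons, sT_mul, sT_ι, h1, h2, eps_add,
        map_smul, smul_mul_assoc, mul_smul_comm, smul_smul]
      rw [mul_comm]

theorem tw_of_eps {M : Type*} [AddCommMonoid M] [Module k M] {s : M →ₗ[k] M} {x : M} {d : ℤ}
    (h : s x = eps k d • x) (n : ℤ) : tw s n x = eps k (n * d) • x := by
  by_cases hn : Even n
  · rw [tw_of_even hn, eps_even (hn.mul_right d)]; simp
  · rw [tw_of_odd hn, h]
    congr 1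
    by_cases hd : Even d
    · rw [eps_even hd, eps_even (hd.mul_left n)]
    · rw [eps_odd hd, eps_odd (by simp [Int.even_mul, hn, hd])]

theorem tw_sA_mem (n : ℤ) (i : ℤ) (a : A) (ha : a ∈ susp 𝒜 i) : tw (sA 𝒜) n a ∈ susp 𝒜 i := by
  rw [tw_of_eps (sA_of_mem 𝒜 ha)]
  exact Submodule.smul_mem _ _ ha

theorem tw_sT_mem (n : ℤ) (d : ℤ) (x : Bar k A) (hx : x ∈ barDeg 𝒜 d) :
    tw (sT 𝒜) n x ∈ barDeg 𝒜 d := by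
  rw [tw_of_eps (sT_of_mem 𝒜 hx)]
  exact Submodule.smul_mem _ _ hx

theorem tw_pair_mem (n : ℤ) (d : ℤ) (z : BiBar k A ⊗[k] A) (hz : z ∈ pairDeg 𝒜 d) :
    tw (TensorProduct.map (sP 𝒜) (sA 𝒜)) n z ∈ pairDeg 𝒜 d := by
  rw [← map_tw, tw_sP]
  exact tdeg_map_of_mem (fun i x hx => tdeg_map_of_mem (tw_sT_mem 𝒜 n)
    (fun i x hx => tdeg_map_of_mem (tw_sA_mem 𝒜 n) (tw_sT_mem 𝒜 n) hx) hx) (tw_sA_mem 𝒜 n) hz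

/-- Coefficients in `k` sit in degree `0`, so the total degree is the degree of the word and the
twist acts by a scalar. -/
theorem map_tw_of_mem_tdeg_triv (n : ℤ) {d : ℤ} {z : Bar k A ⊗[k] k}
    (hz : z ∈ tdeg (barDeg 𝒜) (triv k) d) :
    TensorProduct.map (tw (sT 𝒜) n) LinearMap.id z = eps k (n * d) • z := by
  suffices h : tdeg (barDeg 𝒜) (triv k) d ≤ LinearMap.ker
      (TensorProduct.map (tw (sT 𝒜) n) LinearMap.id + (-eps k (n * d)) • LinearMap.id) by
    have h := h hz
    simp only [LinearMap.mem_ker, LinearMap.add_apply, LinearMap.smul_apply,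
      LinearMap.id_apply] at h
    calc _ = (TensorProduct.map (tw (sT 𝒜) n) LinearMap.id z + -eps k (n * d) • z)
        + eps k (n * d) • z := by module
      _ = _ := by rw [h, zero_add]
  refine iSup_le fun q => ?_
  rintro _ ⟨w, rfl⟩
  induction w with
  | zero => simp
  | add x y hx hy => rw [map_add]; exact Submodule.add_mem _ hx hy
  | tmul x c =>
    obtain ⟨c, hc⟩ := c
    by_cases hq : q = 0
    · subst hq
      obtain ⟨x, hx⟩ := x
      rw [sub_zero] at hx
      simp only [LinearMap.mem_ker, LinearMap.add_apply, LinearMap.smul_apply,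
        TensorProduct.map_tmul, Submodule.subtype_apply, LinearMap.id_apply,
        tw_of_eps (sT_of_mem 𝒜 hx), ← TensorProduct.smul_tmul', neg_smul]
      module
    · have : c = 0 := by simpa [triv, hq] using hc
      subst this
      simp

variable {𝒜} {R S : Type*} [Ring R] [Algebra k R] [Ring S] [Algebra k S]
  {ℛ : ℤ → Submodule k R} {𝒮 : ℤ → Submodule k S}

theorem IsShift.isComap {φ χ : R →ₗ[k] S} {n : ℤ}
    (h : IsShift ℛ 𝒮 φ χ n) {p : ℤ} {i : BiBar k A ⊗[k] A →ₗ[k] R}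
    (hi : IsComap 𝒜 ℛ (p - n) i) :
    IsComap 𝒜 𝒮 p (χ ∘ₗ i ∘ₗ tw (TensorProduct.map (sP 𝒜) (sA 𝒜)) n) := by
  intro d z hz
  rw [show d + p - 2 = d + (p - n) - 2 + n by ring]
  exact h.mem _ _ (hi d _ (tw_pair_mem 𝒜 n d z hz))

theorem isComap_of_shift {n : ℤ} {π : S →ₗ[k] R} (hdeg : ∀ i, ∀ s ∈ 𝒮 i, π s ∈ ℛ (i - n)) {p : ℤ}
    {i : BiBar k A ⊗[k] A →ₗ[k] S} (hi : IsComap 𝒜 𝒮 p i) :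
    IsComap 𝒜 ℛ (p - n) (π ∘ₗ i ∘ₗ tw (TensorProduct.map (sP 𝒜) (sA 𝒜)) n) := by
  intro d z hz
  rw [show d + (p - n) - 2 = d + p - 2 - n by ring]
  exact hdeg _ _ (hi d _ (tw_pair_mem 𝒜 n d z hz))

end Degrees

/-! ### Coderivations and pull-backs under change of coefficients -/

section Coder

variable {k : Type u} [Field k] {A : Type v} [AddCommGroup A] [Module k A]
  {R S : Type*} [Ring R] [Algebra k R] [Ring S] [Algebra k S]
  {ℛ : ℤ → Submodule k R} [DirectSum.Decomposition ℛ]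
  {𝒮 : ℤ → Submodule k S} [DirectSum.Decomposition 𝒮]
  {φ χ χ₂ χ₃ : R →ₗ[k] S} {n : ℤ}
  {𝒜 : ℤ → Submodule k A} [DirectSum.Decomposition 𝒜]

/-- Only homogeneity matters: output and input degrees differ by `p`, so the two twists combine to
`(-1)^{np}`. -/
theorem IsCoder.sign_conj {p : ℤ} {f : Bar k A →ₗ[k] Bar k A ⊗[k] k}
    (hf : IsCoder 𝒜 (triv k) p f) (n : ℤ) :
    TensorProduct.map (tw (sT 𝒜) n) LinearMap.id ∘ₗ f ∘ₗ tw (sT 𝒜) n = eps k (n * p) • f := by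
  refine barDeg_linearMap_ext 𝒜 fun d x hx => ?_
  simp only [LinearMap.comp_apply, tw_of_eps (sT_of_mem 𝒜 hx), map_smul,
    map_tw_of_mem_tdeg_triv 𝒜 n (hf.degree d x hx), smul_smul, LinearMap.smul_apply]
  congr 1
  rw [mul_add, eps_add, ← mul_assoc, eps_mul_self, one_mul]

theorem comp_map (hχ : ∀ a b, χ₂ a * χ b = χ₃ (a * b)) {X Y Z : Type*} [AddCommMonoid X]
    [Module k X] [AddCommMonoid Y] [Module k Y] [AddCommMonoid Z] [Module k Z]
    (F : Y →ₗ[k] Z ⊗[k] R) (G : X →ₗ[k] Y ⊗[k] R) :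
    comp (TensorProduct.map LinearMap.id χ₂ ∘ₗ F) (TensorProduct.map LinearMap.id χ ∘ₗ G) =
      TensorProduct.map LinearMap.id χ₃ ∘ₗ comp F G := by
  rw [comp, ← LinearMap.comp_assoc, ext_comp_map _ _ _ hχ]
  rfl

/-- The right side of the co-Leibniz rule for the extended map is the extension of the right side
for `f`. As the left side behaves alike (`IsShift.map_deconc`), the rule can be transported in both
directions. -/
theorem IsShift.coleibniz (h : IsShift ℛ 𝒮 φ χ n) (p : ℤ)
    (f : Bar k A →ₗ[k] Bar k A ⊗[k] R) :
    InftyInner.juxt (sign 𝒮) (sT 𝒜) ∘ₗ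
      (TensorProduct.map (TensorProduct.map LinearMap.id χ ∘ₗ f ∘ₗ tw (sT 𝒜) n) (incl S) +
        TensorProduct.map (incl S ∘ₗ tw (sT 𝒜) p)
          (TensorProduct.map LinearMap.id χ ∘ₗ f ∘ₗ tw (sT 𝒜) n)) ∘ₗ deconc k A =
    TensorProduct.map LinearMap.id χ ∘ₗ (InftyInner.juxt (sign ℛ) (sT 𝒜) ∘ₗ
      (TensorProduct.map f (incl R) + TensorProduct.map (incl R ∘ₗ tw (sT 𝒜) (p - n)) f) ∘ₗ
        deconc k A) ∘ₗ tw (sT 𝒜) n := by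
  have h1 := h.juxt_incl_right (s := sT 𝒜) (s' := sT 𝒜) (sT_sT 𝒜) 0 f
  have h2 := h.juxt_incl_left (sT_sT 𝒜) (t := sT 𝒜) (sT_sT 𝒜) 0 p f
  rw [tw_zero, tw_zero, add_zero] at h1 h2
  simp only [LinearMap.comp_add, LinearMap.add_comp, ← LinearMap.comp_assoc] at h1 h2 ⊢
  rw [h1, h2]
  simp only [LinearMap.comp_assoc]
  rw [comp_tw_of_comp (deconc_sT 𝒜)]

theorem IsShift.map_deconc (f : Bar k A →ₗ[k] Bar k A ⊗[k] R) :
    TensorProduct.map (deconc k A) LinearMap.id ∘ₗ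
      (TensorProduct.map LinearMap.id χ ∘ₗ f ∘ₗ tw (sT 𝒜) n) =
    TensorProduct.map LinearMap.id χ ∘ₗ (TensorProduct.map (deconc k A) LinearMap.id ∘ₗ f) ∘ₗ
      tw (sT 𝒜) n := by
  rw [← LinearMap.comp_assoc, ← TensorProduct.map_comp, LinearMap.comp_assoc _ f,
    ← LinearMap.comp_assoc _ _ (TensorProduct.map LinearMap.id χ), ← TensorProduct.map_comp]
  rfl

theorem IsShift.isCoder (h : IsShift ℛ 𝒮 φ χ n) {p : ℤ} {f : Bar k A →ₗ[k] Bar k A ⊗[k] R}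
    (hf : IsCoder 𝒜 ℛ (p - n) f) :
    IsCoder 𝒜 𝒮 p (TensorProduct.map LinearMap.id χ ∘ₗ f ∘ₗ tw (sT 𝒜) n) where
  map_one := by
    have : tw (sT 𝒜) n 1 = 1 := by
      by_cases hn : Even n
      · rw [tw_of_even hn]; rfl
      · rw [tw_of_odd hn, sT_one]
    simp [this, hf.map_one]
  degree d x hx := by
    have := hf.degree d _ (tw_sT_mem 𝒜 n d x hx)
    rw [show d + p = d + (p - n) + n by ring]
    exact tdeg_map (fun _ _ h => h) h.mem this
  coleibniz := by rw [h.coleibniz, IsShift.map_deconc, hf.coleibniz]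

/-- A linear retraction `π` of `χ` strips the coefficient off again: applying `π` and repeating the
sign twist recovers `f`. This reads off a condition on the coefficient of `t` from a condition over
the dual numbers. -/
theorem IsShift.isCoder_of_isCoder (h : IsShift ℛ 𝒮 φ χ n) {π : S →ₗ[k] R}
    (hπ : π ∘ₗ χ = LinearMap.id) (hdeg : ∀ i, ∀ s ∈ 𝒮 i, π s ∈ ℛ (i - n)) {p : ℤ}
    {f : Bar k A →ₗ[k] Bar k A ⊗[k] R}
    (hf : IsCoder 𝒜 𝒮 p (TensorProduct.map LinearMap.id χ ∘ₗ f ∘ₗ tw (sT 𝒜) n)) :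
    IsCoder 𝒜 ℛ (p - n) f := by
  have cancel : ∀ {X Y : Type _} [AddCommMonoid X] [Module k X] [AddCommMonoid Y] [Module k Y]
      (s : X →ₗ[k] X) (_ : s ∘ₗ s = LinearMap.id) (F : X →ₗ[k] Y ⊗[k] R),
      TensorProduct.map LinearMap.id π ∘ₗ (TensorProduct.map LinearMap.id χ ∘ₗ F ∘ₗ tw s n) ∘ₗ
        tw s n = F := by
    intro X Y _ _ _ _ s hs F
    rw [LinearMap.comp_assoc, LinearMap.comp_assoc, tw_tw hs, ← LinearMap.comp_assoc,
      ← TensorProduct.map_comp, hπ, LinearMap.id_comp, TensorProduct.map_id, LinearMap.comp_id,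
      LinearMap.id_comp]
  have hs := cancel (sT 𝒜) (sT_sT 𝒜) f
  constructor
  · have : tw (sT 𝒜) n 1 = 1 := by
      by_cases hn : Even n
      · rw [tw_of_even hn]; rfl
      · rw [tw_of_odd hn, sT_one]
    have h1 := LinearMap.congr_fun hs 1
    rw [← h1, LinearMap.comp_apply, LinearMap.comp_apply, this, hf.map_one, map_zero]
  · intro d x hx
    have := hf.degree d _ (tw_sT_mem 𝒜 n d x hx)
    rw [← LinearMap.congr_fun hs x, add_sub, sub_eq_add_neg]
    exact tdeg_map (fun _ _ h => h) (by simpa only [sub_eq_add_neg] using hdeg) this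
  · have := hf.coleibniz
    rw [h.coleibniz, IsShift.map_deconc] at this
    rw [← cancel (sT 𝒜) (sT_sT 𝒜) (TensorProduct.map (deconc k A) LinearMap.id ∘ₗ f), this,
      cancel (sT 𝒜) (sT_sT 𝒜)]

theorem IsShift.juxt_base (h : IsShift ℛ 𝒮 φ χ n) {X X' Y Y' : Type*} [AddCommMonoid X]
    [Module k X] [AddCommMonoid Y] [Module k Y]
    [AddCommMonoid X'] [Module k X'] [AddCommMonoid Y'] [Module k Y']
    {t : Y' →ₗ[k] Y'} (ht : t ∘ₗ t = LinearMap.id)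
    (F : X →ₗ[k] X' ⊗[k] R) (G : Y →ₗ[k] Y' ⊗[k] R) :
    InftyInner.juxt (sign 𝒮) t ∘ₗ TensorProduct.map (TensorProduct.map LinearMap.id φ ∘ₗ F)
        (TensorProduct.map LinearMap.id φ ∘ₗ G) =
      TensorProduct.map LinearMap.id φ ∘ₗ InftyInner.juxt (sign ℛ) t ∘ₗ TensorProduct.map F G := by
  have := h.base.juxt h.mul (s := LinearMap.id) ht 0 F G
  simpa only [tw_zero, TensorProduct.map_id, LinearMap.id_comp] using this

theorem IsShift.pr_word (f : Bar k A →ₗ[k] Bar k A ⊗[k] R) :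
    TensorProduct.map (pr k A) LinearMap.id ∘ₗ
        (TensorProduct.map LinearMap.id φ ∘ₗ f) ∘ₗ word k A =
      TensorProduct.map LinearMap.id φ ∘ₗ
        TensorProduct.map (pr k A) LinearMap.id ∘ₗ f ∘ₗ word k A := by
  rw [LinearMap.comp_assoc, ← LinearMap.comp_assoc, ← TensorProduct.map_comp,
    ← LinearMap.comp_assoc _ _ (TensorProduct.map LinearMap.id φ), ← TensorProduct.map_comp]
  rfl

theorem IsShift.mapA (h : IsShift ℛ 𝒮 φ χ n) (L : Bar k A →ₗ[k] Bar k A ⊗[k] R) :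
    mapA 𝒜 𝒮 (TensorProduct.map LinearMap.id φ ∘ₗ L) =
      TensorProduct.map LinearMap.id φ ∘ₗ InftyInner.mapA 𝒜 ℛ L := by
  rw [InftyInner.mapA, IsShift.pr_word, h.juxt_base (sT_sT 𝒜),
    ← LinearMap.comp_assoc _ _ (InftyInner.juxt _ _), h.juxt_base (map_sA_sT 𝒜)]
  rfl

theorem IsShift.pullback (h : IsShift ℛ 𝒮 φ χ n) (L : Bar k A →ₗ[k] Bar k A ⊗[k] R)
    (i : BiBar k A ⊗[k] A →ₗ[k] R) :
    pullback 𝒜 𝒮 (TensorProduct.map LinearMap.id φ ∘ₗ L) (φ ∘ₗ i) =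
      φ ∘ₗ InftyInner.pullback 𝒜 ℛ L i := by
  rw [InftyInner.pullback, IsShift.pr_word, h.mapA,
    ← LinearMap.comp_assoc _ _ (InftyInner.juxt _ _), h.juxt_base (sA_sA 𝒜),
    LinearMap.comp_assoc, ← LinearMap.comp_assoc, extR_comp_map _ _ h.mul]
  rfl

end Coder

/-! ### First order expansion of coalgebra maps and pull-backs -/

section Linearization

variable {k : Type u} [Field k] {A : Type v} [AddCommGroup A] [Module k A]
  {R S : Type*} [Ring R] [Algebra k R] [Ring S] [Algebra k S]
  {ℛ : ℤ → Submodule k R} [DirectSum.Decomposition ℛ]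
  {𝒮 : ℤ → Submodule k S} [DirectSum.Decomposition 𝒮]
  {φ τ : R →ₗ[k] S} {n : ℤ}
  {𝒜 : ℤ → Submodule k A} [DirectSum.Decomposition 𝒜]

theorem sign_one_of_mem (h1 : (1 : S) ∈ 𝒮 0) : sign 𝒮 1 = 1 := by
  rw [sign_of_mem 𝒮 h1, eps_zero, one_smul]

/-- Two infinitesimal coefficients multiply to zero, also after a sign is inserted. This kills all
second order terms. -/
theorem IsShift.juxt_zero (h : IsShift ℛ 𝒮 φ τ n) (hτ : ∀ a b, τ a * τ b = 0)
    {X X' X'' Y Y' Y'' : Type*} [AddCommMonoid X] [Module k X] [AddCommMonoid Y] [Module k Y]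
    [AddCommMonoid X'] [Module k X'] [AddCommMonoid Y'] [Module k Y']
    [AddCommMonoid X''] [Module k X''] [AddCommMonoid Y''] [Module k Y'']
    (t : Y'' →ₗ[k] Y'') (f : X' →ₗ[k] X'') (g : Y' →ₗ[k] Y'')
    (F : X →ₗ[k] X' ⊗[k] R) (G : Y →ₗ[k] Y' ⊗[k] R) :
    InftyInner.juxt (sign 𝒮) t ∘ₗ TensorProduct.map (TensorProduct.map f τ ∘ₗ F)
        (TensorProduct.map g τ ∘ₗ G) = 0 := by
  rw [TensorProduct.map_comp, ← LinearMap.comp_assoc, juxt_comp_map_zero _ _ hτ,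
    LinearMap.zero_comp]
  intro a b
  have := LinearMap.congr_fun (sign_comp_of_shift ℛ 𝒮 h.mem) a
  simp only [LinearMap.comp_apply, LinearMap.smul_apply] at this
  rw [this, smul_mul_assoc, hτ, smul_zero]

theorem IsShift.coderA_zero (h : IsShift ℛ 𝒮 φ τ n) (p : ℤ)
    (l : Bar k A →ₗ[k] Bar k A ⊗[k] R) :
    InftyInner.coderA 𝒜 𝒮 p (TensorProduct.map LinearMap.id τ ∘ₗ l ∘ₗ tw (sT 𝒜) n) =
      TensorProduct.map LinearMap.id τ ∘ₗ InftyInner.coderA 𝒜 ℛ (p - n) l ∘ₗ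
        tw (sP 𝒜) n := by
  simpa only [tw_zero, add_zero] using h.coderA 𝒜 0 p l

/-- With `L = id + M` the product of the three factors of `mapA` is expanded. Terms with at least
two factors `M` vanish, the constant term is the identity by `pr_word_split`, and the three linear
terms are the three summands of `M^A`. -/
theorem IsShift.mapA_incl_add (h2 : (2 : k) ≠ 0) (h1 : (1 : S) ∈ 𝒮 0) (h : IsShift ℛ 𝒮 φ τ n)
    (hτ : ∀ a b, τ a * τ b = 0) (l : Bar k A →ₗ[k] Bar k A ⊗[k] R) :
    InftyInner.mapA 𝒜 𝒮 (incl S + TensorProduct.map LinearMap.id τ ∘ₗ l ∘ₗ tw (sT 𝒜) n) =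
      incl S + InftyInner.coderA 𝒜 𝒮 0
        (TensorProduct.map LinearMap.id τ ∘ₗ l ∘ₗ tw (sT 𝒜) n) := by
  set M := TensorProduct.map LinearMap.id τ ∘ₗ l ∘ₗ tw (sT 𝒜) n with hM
  set P := pr k A ∘ₗ word k A with hP
  set Q := TensorProduct.map (pr k A) LinearMap.id ∘ₗ M ∘ₗ word k A with hQ
  have hS := sign_one_of_mem (𝒮 := 𝒮) h1
  have eP : TensorProduct.map (pr k A) LinearMap.id ∘ₗ incl S ∘ₗ word k A = incl S ∘ₗ P := by
    rw [← LinearMap.comp_assoc, map_comp_incl _ rfl, LinearMap.comp_assoc]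
  have eQ : Q = TensorProduct.map LinearMap.id τ ∘ₗ
      (TensorProduct.map (pr k A) LinearMap.id ∘ₗ l ∘ₗ word k A) ∘ₗ tw (sP 𝒜) n := by
    have := pr_shift_word (χ := τ) 𝒜 0 n l
    rwa [tw_zero, tw_zero] at this
  have eM : M = TensorProduct.map LinearMap.id τ ∘ₗ l ∘ₗ tw (sT 𝒜) n := rfl
  -- juxtapositions with one infinitesimal factor are infinitesimal
  have hQ1 : ∃ G, InftyInner.juxt (sign 𝒮) (sT 𝒜) ∘ₗ TensorProduct.map Q (incl S) =
      TensorProduct.map LinearMap.id τ ∘ₗ G := by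
    have := h.juxt_incl_right (s := sP 𝒜) (s' := sA 𝒜) (sT_sT 𝒜) 0
      (TensorProduct.map (pr k A) LinearMap.id ∘ₗ l ∘ₗ word k A)
    rw [tw_zero, tw_zero, add_zero, ← eQ] at this
    exact ⟨_, this⟩
  have hM1 : ∃ G, InftyInner.juxt (sign 𝒮) (sT 𝒜) ∘ₗ
      TensorProduct.map (incl S : A →ₗ[k] A ⊗[k] S) M = TensorProduct.map LinearMap.id τ ∘ₗ G := by
    have := h.juxt_incl_left (sA_sA 𝒜) (t := sT 𝒜) (sT_sT 𝒜) 0 0 l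
    rw [tw_zero, tw_zero, tw_zero, add_zero, LinearMap.comp_id, ← eM] at this
    exact ⟨_, this⟩
  have i1 : InftyInner.juxt (sign 𝒮) (sT 𝒜) ∘ₗ TensorProduct.map (incl S ∘ₗ P + Q) (incl S + M) =
      (incl S + InftyInner.juxt (sign 𝒮) (sT 𝒜) ∘ₗ TensorProduct.map (incl S) M) ∘ₗ
        TensorProduct.map P LinearMap.id +
      InftyInner.juxt (sign 𝒮) (sT 𝒜) ∘ₗ TensorProduct.map Q (incl S) := by
    have z : InftyInner.juxt (sign 𝒮) (sT 𝒜) ∘ₗ TensorProduct.map Q M = 0 := by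
      rw [eQ, eM]; exact h.juxt_zero hτ _ _ _ _ _
    rw [TensorProduct.map_add_left, TensorProduct.map_add_right, TensorProduct.map_add_right,
      LinearMap.comp_add, LinearMap.comp_add, LinearMap.comp_add, z, add_zero,
      LinearMap.add_comp, ← juxt_incl h2 hS (sT 𝒜), LinearMap.comp_assoc, LinearMap.comp_assoc,
      ← TensorProduct.map_comp, ← TensorProduct.map_comp, LinearMap.comp_id, LinearMap.comp_id]
  obtain ⟨G, hG⟩ := hQ1
  obtain ⟨H, hH⟩ := hM1
  have z1 : InftyInner.juxt (sign 𝒮) (TensorProduct.map (sA 𝒜) (sT 𝒜)) ∘ₗ TensorProduct.map M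
      (InftyInner.juxt (sign 𝒮) (sT 𝒜) ∘ₗ TensorProduct.map Q (incl S)) = 0 := by
    rw [hG, eM]; exact h.juxt_zero hτ _ _ _ _ _
  have z2 : InftyInner.juxt (sign 𝒮) (TensorProduct.map (sA 𝒜) (sT 𝒜)) ∘ₗ TensorProduct.map M
      (InftyInner.juxt (sign 𝒮) (sT 𝒜) ∘ₗ
        TensorProduct.map (incl S : A →ₗ[k] A ⊗[k] S) M) = 0 := by
    rw [hH, eM]; exact h.juxt_zero hτ _ _ _ _ _
  -- Whenever the middle factor is the identity, the sum over cuts collapses to the single cut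
  -- around the module letter.
  have i2 : ∀ (F : Bar k A →ₗ[k] Bar k A ⊗[k] S)
      (G : A ⊗[k] Bar k A →ₗ[k] (A ⊗[k] Bar k A) ⊗[k] S),
      (InftyInner.juxt (sign 𝒮) (TensorProduct.map (sA 𝒜) (sT 𝒜)) ∘ₗ
        TensorProduct.map F (G ∘ₗ TensorProduct.map P LinearMap.id)) ∘ₗ split k A =
      InftyInner.juxt (sign 𝒮) (TensorProduct.map (sA 𝒜) (sT 𝒜)) ∘ₗ TensorProduct.map F G := by
    intro F G
    rw [← LinearMap.comp_id F, TensorProduct.map_comp, LinearMap.comp_assoc, LinearMap.comp_assoc,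
      pr_word_split, LinearMap.comp_id, LinearMap.comp_id]
  rw [InftyInner.mapA, LinearMap.add_comp, LinearMap.comp_add, eP, i1,
    ← LinearMap.comp_assoc, TensorProduct.map_add_right, LinearMap.comp_add, LinearMap.add_comp,
    i2]
  simp only [TensorProduct.map_add_left, TensorProduct.map_add_right, LinearMap.comp_add,
    z1, z2, juxt_incl h2 hS, InftyInner.coderA, tw_zero, LinearMap.comp_id,
    LinearMap.comp_assoc, add_zero]
  abel

/-- The derivative of the pull-back has two terms, from varying the left and the right copy of `L`.
They add up to `-δ_M(i)` because the dual action in `coderDualComp` carries a minus sign. -/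
theorem IsShift.pullback_incl_add (h2 : (2 : k) ≠ 0) (h1 : (1 : S) ∈ 𝒮 0)
    (h : IsShift ℛ 𝒮 φ τ n) (hτ : ∀ a b, τ a * τ b = 0)
    (l : Bar k A →ₗ[k] Bar k A ⊗[k] R) (i : BiBar k A ⊗[k] A →ₗ[k] S) :
    InftyInner.pullback 𝒜 𝒮
        (incl S + TensorProduct.map LinearMap.id τ ∘ₗ l ∘ₗ tw (sT 𝒜) n) i =
      i - InftyInner.delta 𝒜 𝒮 0 0
        (TensorProduct.map LinearMap.id τ ∘ₗ l ∘ₗ tw (sT 𝒜) n) i := by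
  rw [InftyInner.pullback, h.mapA_incl_add h2 h1 hτ, InftyInner.delta, InftyInner.coderDualComp,
    InftyInner.compCoderA]
  have eC := h.coderA_zero (𝒜 := 𝒜) 0 l
  set M := TensorProduct.map LinearMap.id τ ∘ₗ l ∘ₗ tw (sT 𝒜) n with hM
  set P := pr k A ∘ₗ word k A with hP
  set Q := TensorProduct.map (pr k A) LinearMap.id ∘ₗ M ∘ₗ word k A with hQ
  set C := InftyInner.coderA 𝒜 𝒮 0 M with hC
  have hS := sign_one_of_mem (𝒮 := 𝒮) h1
  have eP : TensorProduct.map (pr k A) LinearMap.id ∘ₗ incl S ∘ₗ word k A = incl S ∘ₗ P := by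
    rw [← LinearMap.comp_assoc, map_comp_incl _ rfl, LinearMap.comp_assoc]
  have eQ : Q = TensorProduct.map LinearMap.id τ ∘ₗ
      (TensorProduct.map (pr k A) LinearMap.id ∘ₗ l ∘ₗ word k A) ∘ₗ tw (sP 𝒜) n := by
    have := pr_shift_word (χ := τ) 𝒜 0 n l
    rwa [tw_zero, tw_zero] at this
  have z : InftyInner.juxt (sign 𝒮) (sA 𝒜) ∘ₗ TensorProduct.map C Q = 0 := by
    rw [eC, eQ]; exact h.juxt_zero hτ _ _ _ _ _
  have i2 : ∀ (F : BiBar k A →ₗ[k] BiBar k A ⊗[k] S),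
      InftyInner.juxt (sign 𝒮) (sA 𝒜) ∘ₗ TensorProduct.map F (incl S ∘ₗ P) ∘ₗ rot 𝒜 =
      InftyInner.juxt (sign 𝒮) (sA 𝒜) ∘ₗ TensorProduct.map F (incl S) := by
    intro F
    rw [← LinearMap.comp_id F, TensorProduct.map_comp, LinearMap.comp_assoc,
      pr_word_rot 𝒜 h2, LinearMap.comp_id, LinearMap.comp_id]
  have z' : InftyInner.juxt (sign 𝒮) (sA 𝒜) ∘ₗ TensorProduct.map C Q ∘ₗ rot 𝒜 = 0 := by
    rw [← LinearMap.comp_assoc, z, LinearMap.zero_comp]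
  simp only [LinearMap.add_comp, LinearMap.comp_add, TensorProduct.map_add_left,
    TensorProduct.map_add_right, eP, i2, ← hQ, z', juxt_incl h2 hS, extR_comp_incl, mul_zero, eps_zero,
    tw_zero, LinearMap.comp_id, add_zero]
  ext z
  simp
  abel

end Linearization

/-! ### The graded dual numbers -/

section Dual

variable (k : Type u) [Field k]

/-- The grading of the dual numbers `k[t] / t²` with `deg t = n`. -/
def dualGrade (n : ℤ) (i : ℤ) : Submodule k (DualNumber k) where
  carrier := {x | (i ≠ 0 → x.fst = 0) ∧ (i ≠ n → x.snd = 0)}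
  zero_mem' := by simp
  add_mem' := by
    rintro x y ⟨h1, h2⟩ ⟨h3, h4⟩
    exact ⟨fun h => by simp [h1 h, h3 h], fun h => by simp [h2 h, h4 h]⟩
  smul_mem' := by
    rintro c x ⟨h1, h2⟩
    exact ⟨fun h => by simp [h1 h], fun h => by simp [h2 h]⟩

variable {k} in
theorem mem_dualGrade {n i : ℤ} {x : DualNumber k} :
    x ∈ dualGrade k n i ↔ (i ≠ 0 → x.fst = 0) ∧ (i ≠ n → x.snd = 0) := Iff.rfl

/-- The constants in the dual numbers. -/
def dualInl : k →ₗ[k] DualNumber k := (TrivSqZeroExt.inlAlgHom k k k).toLinearMap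

/-- The map `c ↦ c t` to the dual numbers. -/
def dualInr : k →ₗ[k] DualNumber k := TrivSqZeroExt.inrHom k k

/-- The coefficient of `t` in a dual number. -/
def dualSnd : DualNumber k →ₗ[k] k := TrivSqZeroExt.sndHom k k

/-- The value of a dual number at `t = 0`. -/
def dualFst : DualNumber k →ₐ[k] k := TrivSqZeroExt.fstHom k k k

variable {k}

@[simp] theorem dualInl_apply (c : k) : dualInl k c = TrivSqZeroExt.inl c := rfl
@[simp] theorem dualInr_apply (c : k) : dualInr k c = TrivSqZeroExt.inr c := rfl
@[simp] theorem dualSnd_apply (x : DualNumber k) : dualSnd k x = x.snd := rfl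
@[simp] theorem dualFst_apply (x : DualNumber k) : dualFst k x = x.fst := rfl

theorem dualInl_mem (n : ℤ) (c : k) : dualInl k c ∈ dualGrade k n 0 := by
  simp [mem_dualGrade]

theorem dualInr_mem (n : ℤ) (c : k) : dualInr k c ∈ dualGrade k n n := by
  simp [mem_dualGrade]

variable (k)

/-- The decomposition of a dual number into homogeneous parts. -/
def dualDecompose (n : ℤ) : DualNumber k →ₗ[k] ⨁ i, dualGrade k n i :=
  DirectSum.lof k ℤ (fun i => dualGrade k n i) 0 ∘ₗ
      LinearMap.codRestrict (dualGrade k n 0) (dualInl k ∘ₗ (dualFst k).toLinearMap)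
        (fun _ => dualInl_mem n _) +
    DirectSum.lof k ℤ (fun i => dualGrade k n i) n ∘ₗ
      LinearMap.codRestrict (dualGrade k n n) (dualInr k ∘ₗ dualSnd k)
        (fun _ => dualInr_mem n _)

instance dualDecomposition (n : ℤ) : DirectSum.Decomposition (dualGrade k n) :=
  DirectSum.Decomposition.ofLinearMap (dualGrade k n) (dualDecompose k n)
    (by
      refine LinearMap.ext fun x => ?_
      ext <;> simp [dualDecompose])
    (by
      refine DirectSum.linearMap_ext k fun i => LinearMap.ext fun x => ?_
      obtain ⟨x, hx⟩ := x
      -- The index `n` may be `0`, so the components are not matched by a case split on `0` versus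
      -- `n`. Instead each component of a homogeneous element either lies in the given degree or
      -- vanishes.
      have key : ∀ (a : ℤ) (y : DualNumber k) (hy : y ∈ dualGrade k n a)
          (hy' : y ∈ dualGrade k n i), (a ≠ i → y = 0) →
          DirectSum.lof k ℤ (fun i => dualGrade k n i) a ⟨y, hy⟩ =
            DirectSum.lof k ℤ (fun i => dualGrade k n i) i ⟨y, hy'⟩ := by
        intro a y hy hy' h
        by_cases hai : a = i
        · subst hai; rfl
        · have h0 := h hai
          subst h0
          have e1 : (⟨0, hy⟩ : dualGrade k n a) = 0 := rfl
          have e2 : (⟨0, hy'⟩ : dualGrade k n i) = 0 := rfl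
          rw [e1, e2, map_zero, map_zero]
      have hx1 : dualInl k x.fst ∈ dualGrade k n i := by
        by_cases hi : i = 0
        · subst hi; exact dualInl_mem n _
        · rw [hx.1 hi, map_zero]; exact zero_mem _
      have hx2 : dualInr k x.snd ∈ dualGrade k n i := by
        by_cases hi : i = n
        · subst hi; exact dualInr_mem i _
        · rw [hx.2 hi, map_zero]; exact zero_mem _
      simp only [LinearMap.comp_apply, LinearMap.id_apply, DirectSum.coeLinearMap_lof,
        dualDecompose, LinearMap.add_apply]
      have s1 := key 0 (dualInl k x.fst) (dualInl_mem n _) hx1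
        (fun h => by rw [hx.1 (Ne.symm h), map_zero])
      have s2 := key n (dualInr k x.snd) (dualInr_mem n _) hx2
        (fun h => by rw [hx.2 (Ne.symm h), map_zero])
      refine (congrArg₂ (· + ·) s1 s2).trans ?_
      rw [← map_add]
      congr 1
      exact Subtype.ext (TrivSqZeroExt.inl_fst_add_inr_snd_eq x))

instance dualGradedAlgebra (n : ℤ) : GradedAlgebra (dualGrade k n) where
  one_mem := by simp [mem_dualGrade]
  mul_mem i j x y hx hy := by
    refine ⟨fun h => ?_, fun h => ?_⟩
    · by_cases hi : i = 0
      · have : j ≠ 0 := fun hj => h (by simp [hi, hj])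
        simp [hy.1 this]
      · simp [hx.1 hi]
    · have h1 : x.fst * y.snd = 0 := by
        by_cases hi : i = 0
        · have : j ≠ n := fun hj => h (by simp [hi, hj])
          simp [hy.2 this]
        · simp [hx.1 hi]
      have h2 : y.fst * x.snd = 0 := by
        by_cases hj : j = 0
        · have : i ≠ n := fun hi => h (by simp [hi, hj])
          simp [hx.2 this]
        · simp [hy.1 hj]
      simpa [h1] using (mul_eq_zero.1 h2).symm

/-- The dual numbers `k[t] / t²` with `deg t = n` as a graded local Artin algebra. -/
def dualArtin (n : ℤ) : GradedArtin k where
  carrier := DualNumber k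
  grade := dualGrade k n
  comm i j x hx y hy := by
    by_cases hij : Even (i * j)
    · rw [eps_even hij, one_smul, mul_comm]
    · have hi : i ≠ 0 := fun h => hij (by simp [h])
      have hj : j ≠ 0 := fun h => hij (by simp [h])
      have : x * y = 0 := by
        ext <;> simp [hx.1 hi, hy.1 hj]
      rw [mul_comm y x, this, smul_zero]
  finite := Module.Finite.equiv (M := k × k) (LinearEquiv.refl k (k × k))
  aug := dualFst k
  aug_grade i hi x hx := hx.1 hi
  nilpotent x hx := ⟨2, by
    have hx : x.fst = 0 := hx
    ext <;> simp [pow_two, hx]⟩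

variable {k}

theorem isShift_dual (n : ℤ) :
    IsShift (triv k) (dualGrade k n) (dualInl k) (dualInr k) n where
  one := by simp
  mul a b := by simp
  mul_left a b := by ext <;> simp [mul_comm]
  mul_right a b := by ext <;> simp
  base_mem i r hr := by
    by_cases hi : i = 0
    · subst hi; exact dualInl_mem n r
    · have : r = 0 := by simpa [triv, hi] using hr
      rw [this, map_zero]; exact zero_mem _
  mem i r hr := by
    by_cases hi : i = 0
    · subst hi; rw [zero_add]; exact dualInr_mem n r
    · have : r = 0 := by simpa [triv, hi] using hr
      rw [this, map_zero]; exact zero_mem _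

theorem dualInr_mul (a b : k) : dualInr k a * dualInr k b = 0 := by simp

theorem dualSnd_mem (n i : ℤ) (x : DualNumber k) (hx : x ∈ dualGrade k n i) :
    dualSnd k x ∈ triv k (i - n) := by
  by_cases h : i = n
  · simp [triv, h]
  · simp [hx.2 h]

theorem dualSnd_comp_dualInr : dualSnd k ∘ₗ dualInr k = LinearMap.id := by ext; simp
theorem dualSnd_comp_dualInl : dualSnd k ∘ₗ dualInl k = 0 := by ext; simp
theorem dualFst_comp_dualInr : (dualFst k).toLinearMap ∘ₗ dualInr k = 0 := by ext; simp
theorem dualFst_comp_dualInl : (dualFst k).toLinearMap ∘ₗ dualInl k = LinearMap.id := by ext; simp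

theorem dual_split :
    dualInl k ∘ₗ (dualFst k).toLinearMap + dualInr k ∘ₗ dualSnd k = LinearMap.id :=
  LinearMap.ext fun x => TrivSqZeroExt.inl_fst_add_inr_snd_eq x

end Dual

/-! ### Structures over the dual numbers -/

section Jet

variable {k : Type u} [Field k] {A : Type v} [AddCommGroup A] [Module k A]
  (𝒜 : ℤ → Submodule k A) [DirectSum.Decomposition 𝒜]

/-- The coalgebra part `D + f t`, with the sign of moving `t` to the right. -/
def jetFst (n : ℤ) {X Y : Type*} [AddCommMonoid X] [Module k X] [AddCommMonoid Y] [Module k Y]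
    (s : X →ₗ[k] X) (D f : X →ₗ[k] Y ⊗[k] k) : X →ₗ[k] Y ⊗[k] DualNumber k :=
  TensorProduct.map LinearMap.id (dualInl k) ∘ₗ D +
    TensorProduct.map LinearMap.id (dualInr k) ∘ₗ f ∘ₗ tw s n

/-- The comap part `I + i t`, with the sign of moving `t` to the right and of the shift. -/
def jetSnd (n : ℤ) (I i : BiBar k A ⊗[k] A →ₗ[k] k) : BiBar k A ⊗[k] A →ₗ[k] DualNumber k :=
  dualInl k ∘ₗ I + eps k n • (dualInr k ∘ₗ i ∘ₗ tw (TensorProduct.map (sP 𝒜) (sA 𝒜)) n)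

/-- The family over the dual numbers with value `X` at the origin and derivative `y`. -/
def jet (n : ℤ) (X y : Cochain k A k) : Cochain k A (DualNumber k) :=
  (jetFst n (sT 𝒜) X.1 y.1, jetSnd 𝒜 n X.2 y.2)

section

variable {X Y : Type*} [AddCommMonoid X] [Module k X] [AddCommMonoid Y] [Module k Y]
  {s : X →ₗ[k] X} (n : ℤ)

theorem map_dualFst_jetFst (D f : X →ₗ[k] Y ⊗[k] k) :
    TensorProduct.map LinearMap.id (dualFst k).toLinearMap ∘ₗ jetFst n s D f = D := by
  rw [jetFst, LinearMap.comp_add, ← LinearMap.comp_assoc, ← LinearMap.comp_assoc,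
    ← TensorProduct.map_comp, ← TensorProduct.map_comp, dualFst_comp_dualInr,
    dualFst_comp_dualInl]
  simp

theorem map_dualSnd_jetFst (D f : X →ₗ[k] Y ⊗[k] k) :
    TensorProduct.map LinearMap.id (dualSnd k) ∘ₗ jetFst n s D f = f ∘ₗ tw s n := by
  rw [jetFst, LinearMap.comp_add, ← LinearMap.comp_assoc, ← LinearMap.comp_assoc,
    ← TensorProduct.map_comp, ← TensorProduct.map_comp, dualSnd_comp_dualInr,
    dualSnd_comp_dualInl]
  simp

theorem jetFst_eq (hs : s ∘ₗ s = LinearMap.id) (F : X →ₗ[k] Y ⊗[k] DualNumber k) :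
    jetFst n s (TensorProduct.map LinearMap.id (dualFst k).toLinearMap ∘ₗ F)
      (TensorProduct.map LinearMap.id (dualSnd k) ∘ₗ F ∘ₗ tw s n) = F := by
  rw [jetFst, LinearMap.comp_assoc, LinearMap.comp_assoc, tw_tw hs, LinearMap.comp_id,
    ← LinearMap.comp_assoc, ← LinearMap.comp_assoc,
    ← TensorProduct.map_comp, ← TensorProduct.map_comp, ← LinearMap.add_comp,
    LinearMap.comp_id, ← TensorProduct.map_add_right, dual_split, TensorProduct.map_id,
    LinearMap.id_comp]

theorem jetFst_injective (hs : s ∘ₗ s = LinearMap.id) {D f D' f' : X →ₗ[k] Y ⊗[k] k}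
    (h : jetFst n s D f = jetFst n s D' f') : D = D' ∧ f = f' := by
  refine ⟨?_, ?_⟩
  · rw [← map_dualFst_jetFst n (s := s) D f, h, map_dualFst_jetFst]
  · have := map_dualSnd_jetFst n (s := s) D f
    rw [h, map_dualSnd_jetFst] at this
    have := congrArg (· ∘ₗ tw s n) this
    simpa only [LinearMap.comp_assoc, tw_tw hs, LinearMap.comp_id] using this.symm

end

variable {𝒜}

theorem dualFst_jetSnd (n : ℤ) (I i : BiBar k A ⊗[k] A →ₗ[k] k) :
    (dualFst k).toLinearMap ∘ₗ jetSnd 𝒜 n I i = I := by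
  rw [jetSnd, LinearMap.comp_add, LinearMap.comp_smul, ← LinearMap.comp_assoc,
    ← LinearMap.comp_assoc, dualFst_comp_dualInr, dualFst_comp_dualInl]
  simp

theorem dualSnd_jetSnd (n : ℤ) (I i : BiBar k A ⊗[k] A →ₗ[k] k) :
    dualSnd k ∘ₗ jetSnd 𝒜 n I i =
      eps k n • (i ∘ₗ tw (TensorProduct.map (sP 𝒜) (sA 𝒜)) n) := by
  rw [jetSnd, LinearMap.comp_add, LinearMap.comp_smul, ← LinearMap.comp_assoc,
    ← LinearMap.comp_assoc, dualSnd_comp_dualInr, dualSnd_comp_dualInl]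
  simp

theorem jetSnd_eq (n : ℤ) (F : BiBar k A ⊗[k] A →ₗ[k] DualNumber k) :
    jetSnd 𝒜 n ((dualFst k).toLinearMap ∘ₗ F)
      (eps k n • (dualSnd k ∘ₗ F ∘ₗ tw (TensorProduct.map (sP 𝒜) (sA 𝒜)) n)) = F := by
  rw [jetSnd, LinearMap.smul_comp, LinearMap.comp_smul, smul_smul, eps_mul_self, one_smul,
    LinearMap.comp_assoc, LinearMap.comp_assoc, tw_tw (map_sP_sA 𝒜), LinearMap.comp_id,
    ← LinearMap.comp_assoc, ← LinearMap.comp_assoc, ← LinearMap.add_comp, dual_split,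
    LinearMap.id_comp]

theorem jetSnd_injective (n : ℤ) {I i I' i' : BiBar k A ⊗[k] A →ₗ[k] k}
    (h : jetSnd 𝒜 n I i = jetSnd 𝒜 n I' i') : I = I' ∧ i = i' := by
  refine ⟨?_, ?_⟩
  · rw [← dualFst_jetSnd (𝒜 := 𝒜) n I i, h, dualFst_jetSnd]
  · have := dualSnd_jetSnd (𝒜 := 𝒜) n I i
    rw [h, dualSnd_jetSnd] at this
    have := congrArg (fun f => eps k n • (f ∘ₗ tw (TensorProduct.map (sP 𝒜) (sA 𝒜)) n)) this
    simpa only [LinearMap.smul_comp, LinearMap.comp_assoc, tw_tw (map_sP_sA 𝒜),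
      LinearMap.comp_id, smul_smul, eps_mul_self, one_smul] using this.symm

theorem isCoder_jetFst_iff (n p : ℤ) {D f : Bar k A →ₗ[k] Bar k A ⊗[k] k}
    (hD : IsCoder 𝒜 (triv k) p D) :
    IsCoder 𝒜 (dualGrade k n) p (jetFst n (sT 𝒜) D f) ↔ IsCoder 𝒜 (triv k) (p - n) f := by
  have h := isShift_dual (k := k) n
  have hU : IsCoder 𝒜 (dualGrade k n) p (TensorProduct.map LinearMap.id (dualInl k) ∘ₗ D) := by
    have := h.base.isCoder (𝒜 := 𝒜) (p := p) (f := D) (by simpa using hD)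
    simpa only [tw_zero, LinearMap.comp_id] using this
  refine ⟨fun hf => ?_, fun hf => hU.add (h.isCoder hf)⟩
  refine h.isCoder_of_isCoder dualSnd_comp_dualInr (dualSnd_mem n) ?_
  -- Subtracting the constant part leaves the pure `t` part, from which `f` is recovered by taking
  -- the coefficient of `t`.
  have := hf.add (hU.smul (-1))
  rw [jetFst] at this
  convert this using 1
  module

theorem isComap_jetSnd_iff (n p : ℤ) {I i : BiBar k A ⊗[k] A →ₗ[k] k}
    (hI : IsComap 𝒜 (triv k) p I) :
    IsComap 𝒜 (dualGrade k n) p (jetSnd 𝒜 n I i) ↔ IsComap 𝒜 (triv k) (p - n) i := by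
  have h := isShift_dual (k := k) n
  refine ⟨fun hi d z hz => ?_, fun hi d z hz => ?_⟩
  · have := isComap_of_shift (ℛ := triv k) (dualSnd_mem n) hi d z hz
    rw [← LinearMap.comp_assoc, dualSnd_jetSnd, LinearMap.smul_comp, LinearMap.comp_assoc,
      tw_tw (map_sP_sA 𝒜), LinearMap.comp_id] at this
    have := Submodule.smul_mem _ (eps k n) this
    rwa [LinearMap.smul_apply, smul_smul, eps_mul_self, one_smul] at this
  · exact Submodule.add_mem _ (h.base_mem _ _ (hI d z hz))
      (Submodule.smul_mem _ _ (h.isComap hi d z hz))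

theorem comp_add_left {R : Type*} [Ring R] [Algebra k R] {X Y Z : Type*} [AddCommMonoid X]
    [Module k X] [AddCommMonoid Y] [Module k Y] [AddCommMonoid Z] [Module k Z]
    (F G : Y →ₗ[k] Z ⊗[k] R) (H : X →ₗ[k] Y ⊗[k] R) :
    comp (F + G) H = comp F H + comp G H := by
  simp [comp, ext, TensorProduct.map_add_left, LinearMap.comp_add, LinearMap.add_comp]

theorem comp_add_right {R : Type*} [Ring R] [Algebra k R] {X Y Z : Type*} [AddCommMonoid X]
    [Module k X] [AddCommMonoid Y] [Module k Y] [AddCommMonoid Z] [Module k Z]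
    (F : Y →ₗ[k] Z ⊗[k] R) (G H : X →ₗ[k] Y ⊗[k] R) :
    comp F (G + H) = comp F G + comp F H := by
  simp [comp, LinearMap.comp_add]

theorem IsCoder.map_tw_comp {p : ℤ} {D : Bar k A →ₗ[k] Bar k A ⊗[k] k}
    (hD : IsCoder 𝒜 (triv k) p D) (n : ℤ) :
    TensorProduct.map (tw (sT 𝒜) n) LinearMap.id ∘ₗ D = eps k (n * p) • (D ∘ₗ tw (sT 𝒜) n) := by
  rw [← LinearMap.smul_comp, ← hD.sign_conj n, LinearMap.comp_assoc, LinearMap.comp_assoc,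
    tw_tw (sT_sT 𝒜), LinearMap.comp_id]

/-- Moving the sign of `t` past a homogeneous map. -/
theorem comp_tw_comp {c : k} {n : ℤ} {D : Bar k A →ₗ[k] Bar k A ⊗[k] k}
    (hD : TensorProduct.map (tw (sT 𝒜) n) LinearMap.id ∘ₗ D = c • (D ∘ₗ tw (sT 𝒜) n))
    (f : Bar k A →ₗ[k] Bar k A ⊗[k] k) :
    comp (f ∘ₗ tw (sT 𝒜) n) D = c • (comp f D ∘ₗ tw (sT 𝒜) n) := by
  have h1 : ext (f ∘ₗ tw (sT 𝒜) n) =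
      ext f ∘ₗ TensorProduct.map (tw (sT 𝒜) n) (LinearMap.id (M := k)) := by
    ext x
    simp [ext]
  rw [comp, h1, LinearMap.comp_assoc, hD, LinearMap.comp_smul]
  rfl

/-- The product rule. The scalar `c` is the sign for moving `t` past `D`; it is kept free so that
`D` may be a coderivation of the base structure or the identity (`c = 1`). -/
theorem comp_jetFst {c : k} {n : ℤ} {D : Bar k A →ₗ[k] Bar k A ⊗[k] k}
    (hD : TensorProduct.map (tw (sT 𝒜) n) LinearMap.id ∘ₗ D = c • (D ∘ₗ tw (sT 𝒜) n))
    (E f g : Bar k A →ₗ[k] Bar k A ⊗[k] k) :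
    comp (jetFst n (sT 𝒜) E f) (jetFst n (sT 𝒜) D g) =
      jetFst n (sT 𝒜) (comp E D) (comp E g + c • comp f D) := by
  have h := isShift_dual (k := k) n
  have e1 : ∀ F : Bar k A →ₗ[k] Bar k A ⊗[k] k,
    TensorProduct.map LinearMap.id (0 : k →ₗ[k] DualNumber k) ∘ₗ F = 0 := by intro F; simp
  simp only [jetFst, comp_add_left, comp_add_right]
  rw [comp_map h.mul, comp_map h.mul_left, comp_map h.mul_right,
    comp_map (χ₃ := 0) (fun a b => by rw [dualInr_mul]; rfl), e1, comp_tw_comp hD,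
    LinearMap.add_comp, LinearMap.comp_add, LinearMap.smul_comp, add_zero]
  have e2 : comp E (g ∘ₗ tw (sT 𝒜) n) = comp E g ∘ₗ tw (sT 𝒜) n := rfl
  rw [e2]
  abel

/-- Both summands of `δ` carry the same factor `(-1)^{pq}`, so the degree of `i` enters only as a
global sign and can be normalised to `0`. -/
theorem delta_eq_eps_smul (p q : ℤ) {R : Type*} [Ring R] [Algebra k R] (ℛ : ℤ → Submodule k R)
    [DirectSum.Decomposition ℛ] (f : Bar k A →ₗ[k] Bar k A ⊗[k] R)
    (i : BiBar k A ⊗[k] A →ₗ[k] R) :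
    delta 𝒜 ℛ p q f i = eps k (p * q) • delta 𝒜 ℛ p 0 f i := by
  simp only [delta, coderDualComp, mul_zero, eps_zero, smul_sub, smul_smul, one_smul, mul_one,
    mul_neg]

theorem delta_comp_tw {p : ℤ} (n : ℤ) {D : Bar k A →ₗ[k] Bar k A ⊗[k] k}
    (hD : IsCoder 𝒜 (triv k) p D) (q : ℤ) (i : BiBar k A ⊗[k] A →ₗ[k] k) :
    delta 𝒜 (triv k) p q D (i ∘ₗ tw (TensorProduct.map (sP 𝒜) (sA 𝒜)) n) =
      eps k (n * p) • (delta 𝒜 (triv k) p q D i ∘ₗ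
        tw (TensorProduct.map (sP 𝒜) (sA 𝒜)) n) := by
  have := (IsShift.id (triv k)).delta 𝒜 (χ₂ := LinearMap.id) (χ₃ := LinearMap.id)
    (fun _ _ => rfl) n p q D i
  simp only [zero_add, sub_zero, hD.sign_conj, delta_smul_left, zero_mul, eps_zero, one_smul,
    LinearMap.id_comp] at this
  rw [← this, smul_smul, eps_mul_self, one_smul]

/-- The graded product rule for `δ`: its first order part varies `i` and `f` separately, and the
mixed term in `t²` vanishes. -/
theorem delta_jet {p : ℤ} (n q : ℤ) {D : Bar k A →ₗ[k] Bar k A ⊗[k] k}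
    (hD : IsCoder 𝒜 (triv k) p D) (f : Bar k A →ₗ[k] Bar k A ⊗[k] k)
    (I i : BiBar k A ⊗[k] A →ₗ[k] k) :
    delta 𝒜 (dualGrade k n) p q (jetFst n (sT 𝒜) D f) (jetSnd 𝒜 n I i) =
      jetSnd 𝒜 n (delta 𝒜 (triv k) p q D I)
        (eps k (n * p) • delta 𝒜 (triv k) p q D i +
          (eps k (n * q) * eps k n) • delta 𝒜 (triv k) (p - n) q f I) := by
  have h := isShift_dual (k := k) n
  have d1 := h.base.delta 𝒜 h.mul 0 p q D I
  have d2 := h.base.delta 𝒜 (χ₂ := dualInr k) h.mul_right 0 p q D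
    (i ∘ₗ tw (TensorProduct.map (sP 𝒜) (sA 𝒜)) n)
  have d3 := h.delta 𝒜 h.mul_left 0 p q f I
  have d4 := h.delta 𝒜 (χ₂ := dualInr k) (χ₃ := 0) (fun a b => by rw [dualInr_mul]; rfl)
    0 p q f (i ∘ₗ tw (TensorProduct.map (sP 𝒜) (sA 𝒜)) n)
  simp only [tw_zero, LinearMap.comp_id, add_zero, sub_zero, zero_mul, eps_zero, one_smul,
    LinearMap.zero_comp, smul_zero] at d1 d2 d3 d4
  rw [delta_comp_tw n hD] at d2
  simp only [jetFst, jetSnd, delta_add_left, delta_add_right, delta_smul_right, d1, d2, d3, d4,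
    LinearMap.add_comp, LinearMap.comp_add, LinearMap.smul_comp, LinearMap.comp_smul, smul_add,
    smul_smul]
  -- This cancels the shift sign `(-1)^n` built into `jetSnd`.
  have e : eps k n * (eps k (n * q) * eps k n) = eps k (n * q) := by
    rw [mul_left_comm, eps_mul_self, mul_one]
  rw [e]
  simp only [smul_zero, add_zero]
  abel

end Jet

/-! ### Infinitesimal deformations and infinitesimal equivalences -/

section Infinitesimal

variable {k : Type u} [Field k] {A : Type v} [AddCommGroup A] [Module k A]
  {𝒜 : ℤ → Submodule k A} [DirectSum.Decomposition 𝒜] {X : Cochain k A k}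

theorem eps_sub_one (j : ℤ) : eps k (j - 1) = -eps k j := by
  rw [sub_eq_add_neg, eps_add, eps_odd (n := -1) (by simp)]; simp

theorem jetFst_zero (n : ℤ) : jetFst n (sT 𝒜) (0 : Bar k A →ₗ[k] Bar k A ⊗[k] k) 0 = 0 := by
  simp [jetFst]

theorem jetSnd_zero (n : ℤ) : jetSnd 𝒜 n 0 0 = 0 := by simp [jetSnd]

theorem delta_zero_left (p q : ℤ) {R : Type*} [Ring R] [Algebra k R] (ℛ : ℤ → Submodule k R)
    [DirectSum.Decomposition ℛ] (i : BiBar k A ⊗[k] A →ₗ[k] R) :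
    delta 𝒜 ℛ p q 0 i = 0 := by
  have := delta_smul_left (𝒜 := 𝒜) (ℛ := ℛ) p q 0 0 i
  simpa only [zero_smul] using this

theorem delta_zero_right (p q : ℤ) {R : Type*} [Ring R] [Algebra k R] (ℛ : ℤ → Submodule k R)
    [DirectSum.Decomposition ℛ] (f : Bar k A →ₗ[k] Bar k A ⊗[k] R) :
    delta 𝒜 ℛ p q f 0 = 0 := by
  have := delta_smul_right (𝒜 := 𝒜) (ℛ := ℛ) p q 0 f 0
  simpa only [zero_smul] using this

theorem differential_fst (b : ℤ) (y : Cochain k A k) :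
    (differential 𝒜 X b y).1 = comp X.1 y.1 + eps k (b - 1) • comp y.1 X.1 := by
  simp only [differential, bracket, LinearMap.coe_mk, AddHom.coe_mk, one_mul, eps_sub_one]

theorem differential_snd (b : ℤ) (y : Cochain k A k) :
    (differential 𝒜 X b y).2 = eps k (b - 1) • (delta 𝒜 (triv k) (-1) 0 X.1 y.2 +
      delta 𝒜 (triv k) (-b) 0 y.1 X.2) := by
  simp only [differential, bracket, LinearMap.coe_mk, AddHom.coe_mk, one_mul, sub_self]
  rw [delta_eq_eps_smul (-1) (1 - b), show -1 * (1 - b) = b - 1 by ring, eps_sub_one]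
  module

/-- Applying the counit to both factors of the co-Leibniz rule gives `ε f = ε f + ε f`, one term
from each counit axiom, hence `ε f = 0`. -/
theorem IsCoder.counit (h2 : (2 : k) ≠ 0) {R : Type*} [Ring R] [Algebra k R]
    {ℛ : ℤ → Submodule k R} [DirectSum.Decomposition ℛ] {p : ℤ}
    {f : Bar k A →ₗ[k] Bar k A ⊗[k] R} (hf : IsCoder 𝒜 ℛ p f) :
    TensorProduct.map (InftyInner.counit k A) LinearMap.id ∘ₗ f = 0 := by
  set ε := InftyInner.counit k A with hε
  let e : Bar k A ⊗[k] R →ₗ[k] R := (TensorProduct.lid k R).toLinearMap ∘ₗ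
    TensorProduct.map ε LinearMap.id
  let c : Bar k A ⊗[k] Bar k A →ₗ[k] Bar k A :=
    (TensorProduct.lid k (Bar k A)).toLinearMap ∘ₗ TensorProduct.map ε LinearMap.id
  have hs : ∀ x, ε (sT 𝒜 x) = ε x := fun x => LinearMap.congr_fun (counit_sT 𝒜) x
  have ht : ε ∘ₗ tw (sT 𝒜) p = ε := by
    have := comp_tw_of_comp (f := ε) (s := sT 𝒜) (t := LinearMap.id) (counit_sT 𝒜) p
    rw [this]
    simp [tw]
  have h : (2 : k)⁻¹ + 2⁻¹ = 1 := by rw [← two_mul, mul_inv_cancel₀ h2]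
  have hj : (e ∘ₗ TensorProduct.map c LinearMap.id) ∘ₗ juxt (sign ℛ) (sT 𝒜) =
      LinearMap.mul' k R ∘ₗ TensorProduct.map e e := by
    refine TensorProduct.ext_fourfold' fun x r y s => ?_
    simp only [LinearMap.comp_apply, juxt_tmul, map_smul, map_add, TensorProduct.map_tmul, c, e,
      LinearEquiv.coe_coe, TensorProduct.lid_tmul, LinearMap.id_apply, hs, smul_eq_mul,
      LinearMap.mul'_apply, smul_mul_smul_comm]
    calc _ = ((2 : k)⁻¹ + 2⁻¹) • ((ε x * ε y) • (r * s)) := by module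
      _ = _ := by rw [h, one_smul]
  have hc : c ∘ₗ deconc k A = LinearMap.id := by
    rw [LinearMap.comp_assoc, counit_left]; ext; simp
  have hi : ∀ x, e (incl R x) = ε x • (1 : R) := fun x => by simp [e, incl]
  have h3 := congrArg ((e ∘ₗ TensorProduct.map c LinearMap.id) ∘ₗ ·) hf.coleibniz
  have k1 : LinearMap.mul' k R ∘ₗ TensorProduct.map e e ∘ₗ TensorProduct.map f (incl R) =
      e ∘ₗ f ∘ₗ (TensorProduct.rid k _).toLinearMap ∘ₗ TensorProduct.map LinearMap.id ε :=
    TensorProduct.ext' fun x y => by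
      simp [hi]
  have k2 : LinearMap.mul' k R ∘ₗ TensorProduct.map e e ∘ₗ
      TensorProduct.map (incl R ∘ₗ tw (sT 𝒜) p) f = e ∘ₗ f ∘ₗ c :=
    TensorProduct.ext' fun x y => by
      have := LinearMap.congr_fun ht x
      simp only [LinearMap.comp_apply] at this
      simp [hi, c, this]
  have he : ∀ z, TensorProduct.map ε LinearMap.id z = 1 ⊗ₜ[k] e z := fun z =>
    ((TensorProduct.lid k R).symm_apply_apply _).symm
  clear_value e c
  rw [← LinearMap.comp_assoc _ (juxt _ _), hj, LinearMap.comp_assoc,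
    ← LinearMap.comp_assoc _ _ (TensorProduct.map c LinearMap.id), ← TensorProduct.map_comp, hc,
    LinearMap.comp_id, TensorProduct.map_id, LinearMap.id_comp, LinearMap.add_comp,
    LinearMap.comp_add] at h3
  simp only [LinearMap.comp_assoc] at h3
  have k1' : LinearMap.mul' k R ∘ₗ TensorProduct.map e e ∘ₗ TensorProduct.map f (incl R) ∘ₗ
      deconc k A = e ∘ₗ f := by
    have := congrArg (· ∘ₗ deconc k A) k1
    simp only [LinearMap.comp_assoc] at this
    rw [this, hε, counit_right]
    ext; simp
  have k2' : LinearMap.mul' k R ∘ₗ TensorProduct.map e e ∘ₗ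
      TensorProduct.map (incl R ∘ₗ tw (sT 𝒜) p) f ∘ₗ deconc k A = e ∘ₗ f := by
    have := congrArg (· ∘ₗ deconc k A) k2
    simp only [LinearMap.comp_assoc] at this
    rw [this]
    simp only [hc, LinearMap.comp_id]
  rw [k1', k2'] at h3
  have h4 : e ∘ₗ f = 0 := by simpa using h3
  refine LinearMap.ext fun x => ?_
  have h5 : e (f x) = 0 := LinearMap.congr_fun h4 x
  rw [LinearMap.comp_apply, he, h5, TensorProduct.tmul_zero, LinearMap.zero_apply]

/-- The constant terms vanish because `X` is a structure. The `t` coefficients of `D'²` and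
`δ_{D'}(I')` are the two components of `d y`. The degree conditions match since `-1 - (j - 1) = -j`
and `0 - (j - 1) = 1 - j`. -/
theorem isAInftyInner_jet_iff (hX : IsAInftyInner 𝒜 (triv k) X) (j : ℤ) (y : Cochain k A k) :
    IsAInftyInner 𝒜 (dualGrade k (j - 1)) (jet 𝒜 (j - 1) X y) ↔ y ∈ cocycles 𝒜 X j := by
  have hs : comp (jet 𝒜 (j - 1) X y).1 (jet 𝒜 (j - 1) X y).1 =
      jetFst (j - 1) (sT 𝒜) 0 (differential 𝒜 X j y).1 := by
    rw [jet, comp_jetFst (hX.coder.map_tw_comp _), hX.square, differential_fst,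
      mul_neg_one, eps_neg]
  have hd : delta 𝒜 (dualGrade k (j - 1)) (-1) 0 (jet 𝒜 (j - 1) X y).1 (jet 𝒜 (j - 1) X y).2 =
      jetSnd 𝒜 (j - 1) 0 (differential 𝒜 X j y).2 := by
    rw [jet, delta_jet _ _ hX.coder, hX.compat, differential_snd, mul_neg_one, eps_neg,
      mul_zero, eps_zero, one_mul, smul_add, show -1 - (j - 1) = -j by ring]
  have hc := isCoder_jetFst_iff (j - 1) (-1) (f := y.1) hX.coder
  have hi := isComap_jetSnd_iff (j - 1) 0 (i := y.2) hX.comap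
  rw [show -1 - (j - 1) = -j by ring] at hc
  rw [show 0 - (j - 1) = 1 - j by ring] at hi
  constructor
  · intro h
    refine ⟨⟨hc.1 h.coder, hi.1 h.comap⟩, ?_⟩
    change differential 𝒜 X j y = 0
    refine Prod.ext ?_ ?_
    · have := hs.symm.trans h.square
      rw [← jetFst_zero (𝒜 := 𝒜) (j - 1)] at this
      exact (jetFst_injective (j - 1) (sT_sT 𝒜) this).2
    · have := hd.symm.trans h.compat
      rw [← jetSnd_zero (𝒜 := 𝒜) (j - 1)] at this
      exact (jetSnd_injective (j - 1) this).2
  · rintro ⟨⟨h1, h2⟩, h3⟩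
    have h3 : differential 𝒜 X j y = 0 := h3
    exact ⟨hc.2 h1, by rw [hs, h3]; exact jetFst_zero _, hi.2 h2,
      by rw [hd, h3]; exact jetSnd_zero _⟩

theorem incl_eq_map_dualInl {Y : Type*} [AddCommMonoid Y] [Module k Y] :
    TensorProduct.map LinearMap.id (dualInl k) ∘ₗ incl k =
      (incl (DualNumber k) : Y →ₗ[k] Y ⊗[k] DualNumber k) := by
  rw [map_comp_incl _ (by simp), LinearMap.comp_id]

/-- The tangent space to coalgebra automorphisms at the identity consists of coderivations: the
linear part of `Δ L = (L ⊗ L) Δ` is the co-Leibniz rule. -/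
theorem isCoalgMap_jetFst_iff (h2 : (2 : k) ≠ 0) (n : ℤ) {l : Bar k A →ₗ[k] Bar k A ⊗[k] k} :
    IsCoalgMap 𝒜 (dualGrade k n) (jetFst n (sT 𝒜) (incl k) l) ↔
      IsCoder 𝒜 (triv k) (0 - n) l := by
  have h := isShift_dual (k := k) n
  have h1 : (1 : DualNumber k) ∈ dualGrade k n 0 := SetLike.GradedOne.one_mem
  have hS := sign_one_of_mem h1
  set M := TensorProduct.map LinearMap.id (dualInr k) ∘ₗ l ∘ₗ tw (sT 𝒜) n with hM
  have hL : jetFst n (sT 𝒜) (incl k) l = incl (DualNumber k) + M := by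
    rw [jetFst, incl_eq_map_dualInl]
  have hdeg : ∀ d, ∀ x ∈ barDeg 𝒜 d,
      incl (DualNumber k) x ∈ tdeg (barDeg 𝒜) (dualGrade k n) d := fun d x hx => tdeg_incl h1 hx
  have z : juxt (sign (dualGrade k n)) (sT 𝒜) ∘ₗ TensorProduct.map M M = 0 :=
    h.juxt_zero dualInr_mul _ _ _ _ _
  have e1 : juxt (sign (dualGrade k n)) (sT 𝒜) ∘ₗ
      TensorProduct.map (incl (DualNumber k) + M) (incl (DualNumber k) + M) ∘ₗ deconc k A =
      incl (DualNumber k) ∘ₗ deconc k A + juxt (sign (dualGrade k n)) (sT 𝒜) ∘ₗ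
      (TensorProduct.map M (incl (DualNumber k)) +
        TensorProduct.map (incl (DualNumber k) ∘ₗ tw (sT 𝒜) 0) M) ∘ₗ deconc k A := by
    simp only [← LinearMap.comp_assoc, ← LinearMap.add_comp]
    congr 1
    rw [TensorProduct.map_add_left, TensorProduct.map_add_right, TensorProduct.map_add_right,
      LinearMap.comp_add, LinearMap.comp_add, LinearMap.comp_add, z, juxt_incl h2 hS, tw_zero,
      LinearMap.comp_id, LinearMap.comp_add]
    abel
  have e2 : TensorProduct.map (deconc k A) LinearMap.id ∘ₗ (incl (DualNumber k) + M) =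
      incl (DualNumber k) ∘ₗ deconc k A +
        TensorProduct.map (deconc k A) LinearMap.id ∘ₗ M := by
    rw [LinearMap.comp_add, map_comp_incl _ rfl]
  have hneg : ∀ {V : Type _} [AddCommMonoid V] [Module k V] {a b c : V}, a + b = a + c → b = c := by
    intro V _ _ a b c h
    calc b = (-1 : k) • a + (a + b) := by module
      _ = c := by rw [h]; module
  rw [hL]
  constructor
  · intro hc
    refine h.isCoder_of_isCoder dualSnd_comp_dualInr (dualSnd_mem n) ⟨?_, ?_, ?_⟩
    · have := hc.map_one
      refine hneg (a := (incl (DualNumber k) (1 : Bar k A))) ?_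
      rw [add_zero]
      exact this
    · intro d x hx
      have := Submodule.add_mem _ (Submodule.smul_mem _ (-1 : k) (hdeg d x hx)) (hc.degree d x hx)
      rw [add_zero]
      convert this using 1
      rw [LinearMap.add_apply]
      change M x = _
      module
    · have := hc.comul
      rw [e1, e2] at this
      exact hneg this
  · intro hl
    have hc : IsCoder 𝒜 (dualGrade k n) 0 M := h.isCoder hl
    refine ⟨?_, ?_, ?_, ?_⟩
    · rw [LinearMap.add_apply, hc.map_one, add_zero]; rfl
    · intro d x hx
      have := hc.degree d x hx
      rw [add_zero] at this
      exact Submodule.add_mem _ (hdeg d x hx) this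
    · have sw : TensorProduct.map (counit k A) LinearMap.id ∘ₗ
          TensorProduct.map LinearMap.id (dualInr k) =
          TensorProduct.map LinearMap.id (dualInr k) ∘ₗ
            TensorProduct.map (counit k A) LinearMap.id := by
        rw [← TensorProduct.map_comp, ← TensorProduct.map_comp]; rfl
      -- Compatibility with the counit is part of being a coalgebra map but not of being a
      -- coderivation; it follows from `IsCoder.counit`.
      have hz' : TensorProduct.map (counit k A) LinearMap.id ∘ₗ M = 0 := by
        rw [hM, ← LinearMap.comp_assoc, sw, LinearMap.comp_assoc, ← LinearMap.comp_assoc _ l,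
          hl.counit h2, LinearMap.zero_comp, LinearMap.comp_zero]
      change TensorProduct.map (counit k A) LinearMap.id ∘ₗ _ = incl _ ∘ₗ counit k A
      rw [LinearMap.comp_add, hz', add_zero, map_comp_incl _ rfl]
    · rw [e1, e2, hc.coleibniz]

theorem jetSnd_sub (n : ℤ) (I I' i i' : BiBar k A ⊗[k] A →ₗ[k] k) :
    jetSnd 𝒜 n I i - jetSnd 𝒜 n I' i' = jetSnd 𝒜 n (I - I') (i - i') := by
  simp only [jetSnd, LinearMap.comp_sub, LinearMap.sub_comp, smul_sub]
  abel

theorem pullback_jet (h2 : (2 : k) ≠ 0) (n : ℤ) (l : Bar k A →ₗ[k] Bar k A ⊗[k] k)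
    (I i : BiBar k A ⊗[k] A →ₗ[k] k) :
    pullback 𝒜 (dualGrade k n) (jetFst n (sT 𝒜) (incl k) l) (jetSnd 𝒜 n I i) =
      jetSnd 𝒜 n I (i - eps k n • delta 𝒜 (triv k) (-n) 0 l I) := by
  have h := isShift_dual (k := k) n
  -- The zero coderivation is taken as constant part, so that the product rule gives `δ` of the
  -- purely infinitesimal map `l t`.
  have e := delta_jet (𝒜 := 𝒜) n 0 (IsCoder.zero (𝒜 := 𝒜) (ℛ := triv k) 0) l I i
  rw [jetFst, incl_eq_map_dualInl,
    h.pullback_incl_add h2 SetLike.GradedOne.one_mem dualInr_mul]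
  rw [jetFst, LinearMap.comp_zero, zero_add] at e
  rw [e, jetSnd_sub, delta_zero_left, delta_zero_left, mul_zero, eps_zero, zero_sub, one_mul,
    smul_zero, zero_add, sub_zero]

-- An equivalence that is trivial modulo `t` is a pair `(l, r)` in `h^{j-1}`. The intertwining
-- relation and the condition on the inner products compare equal constant terms, and their `t`
-- coefficients are the two components of `y = y' + d(l, r)`.
set_option maxRecDepth 4000 in
theorem defEquiv_jet_iff (h2 : (2 : k) ≠ 0) (hX : IsAInftyInner 𝒜 (triv k) X) (j : ℤ)
    (y y' : Cochain k A k) :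
    DefEquiv 𝒜 (dualArtin k (j - 1)) (jet 𝒜 (j - 1) X y) (jet 𝒜 (j - 1) X y') ↔
      ∃ w ∈ lieDeg 𝒜 (j - 1), y = y' + differential 𝒜 X (j - 1) w := by
  set n := j - 1 with hn
  have e1 : ∀ l : Bar k A →ₗ[k] Bar k A ⊗[k] k,
      comp (jetFst n (sT 𝒜) (incl k) l) (jet 𝒜 n X y).1 =
      jetFst n (sT 𝒜) X.1 (y.1 + eps k n • comp l X.1) := fun l => by
    rw [jet, comp_jetFst (hX.coder.map_tw_comp _), mul_neg_one, eps_neg, comp, comp, ext_incl]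
    rfl
  have e2 : ∀ l : Bar k A →ₗ[k] Bar k A ⊗[k] k,
      comp (jet 𝒜 n X y').1 (jetFst n (sT 𝒜) (incl k) l) =
      jetFst n (sT 𝒜) X.1 (comp X.1 l + y'.1) := fun l => by
    rw [jet, comp_jetFst (c := 1) (by rw [one_smul]; exact map_comp_incl _ rfl), one_smul,
      show comp y'.1 (incl k) = y'.1 from ext_comp_incl _,
      show comp X.1 (incl k) = X.1 from ext_comp_incl _]
  have e3 : ∀ l : Bar k A →ₗ[k] Bar k A ⊗[k] k,
      (jet 𝒜 n X y).2 - pullback 𝒜 (dualGrade k n) (jetFst n (sT 𝒜) (incl k) l)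
        (jet 𝒜 n X y').2 =
      jetSnd 𝒜 n 0 (y.2 - (y'.2 - eps k n • delta 𝒜 (triv k) (-n) 0 l X.2)) := fun l => by
    rw [jet, jet, pullback_jet h2, jetSnd_sub, sub_self]
  -- Besides `(-1)^n` from moving `t` past `D`, a minus sign arises because both `D` and `ρ` have
  -- odd degree.
  have e4 : ∀ r : BiBar k A ⊗[k] A →ₗ[k] k,
      delta 𝒜 (dualGrade k n) (-1) 1 (jet 𝒜 n X y).1 (jetSnd 𝒜 n 0 r) =
      jetSnd 𝒜 n 0 (-(eps k n • delta 𝒜 (triv k) (-1) 0 X.1 r)) := fun r => by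
    rw [jet, delta_jet _ _ hX.coder, delta_zero_right, delta_zero_right, smul_zero, add_zero,
      delta_eq_eps_smul (-1) 1, mul_neg_one, mul_one, eps_neg, eps_odd (n := -1) (by simp)]
    congr 1
    module
  have d1 : ∀ w : Cochain k A k, (differential 𝒜 X n w).1 =
      comp X.1 w.1 + (-eps k n) • comp w.1 X.1 := fun w => by rw [differential_fst, eps_sub_one]
  have d2 : ∀ w : Cochain k A k, (differential 𝒜 X n w).2 =
      -(eps k n • delta 𝒜 (triv k) (-1) 0 X.1 w.2) -
        eps k n • delta 𝒜 (triv k) (-n) 0 w.1 X.2 := fun w => by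
    rw [differential_snd, eps_sub_one, smul_add, neg_smul, neg_smul, sub_eq_add_neg]
  constructor
  · rintro ⟨L, ρ, hL, hL0, hρ, hρ0, h1, h3⟩
    -- Any map over the dual numbers is the jet of its value and its derivative, and the value of
    -- `L` at `t = 0` is the identity.
    obtain ⟨l, rfl⟩ : ∃ l, L = jetFst n (sT 𝒜) (incl k) l := ⟨_, by
      conv_lhs => rw [← jetFst_eq n (sT_sT 𝒜) L]
      rw [show TensorProduct.map LinearMap.id (dualFst k).toLinearMap ∘ₗ L = incl k from hL0]⟩
    obtain ⟨r, rfl⟩ : ∃ r, ρ = jetSnd 𝒜 n 0 r := ⟨_, by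
      conv_lhs => rw [← jetSnd_eq (𝒜 := 𝒜) n ρ]
      rw [show (dualFst k).toLinearMap ∘ₗ ρ = 0 from hρ0]⟩
    refine ⟨(l, r), ⟨?_, ?_⟩, ?_⟩
    · exact zero_sub n ▸ (isCoalgMap_jetFst_iff h2 n).1 hL
    · exact (isComap_jetSnd_iff n 1 (isComap_zero 𝒜 1)).1 hρ
    · refine Prod.ext ?_ ?_
      · have := (jetFst_injective n (sT_sT 𝒜) ((e1 l).symm.trans (h1.trans (e2 l)))).2
        rw [Prod.fst_add, d1]
        calc y.1 = (y.1 + eps k n • comp l X.1) + (-eps k n) • comp l X.1 := by module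
          _ = _ := by rw [this]; module
      · have := (jetSnd_injective n ((e3 l).symm.trans (h3.trans (e4 r)))).2
        rw [Prod.snd_add, d2, ← this]
        abel
  · rintro ⟨⟨l, r⟩, ⟨hl, hr⟩, rfl⟩
    refine ⟨jetFst n (sT 𝒜) (incl k) l, jetSnd 𝒜 n 0 r, ?_, map_dualFst_jetFst _ _ _, ?_,
      dualFst_jetSnd _ _ _, ?_, ?_⟩
    · exact (isCoalgMap_jetFst_iff h2 n).2 (by rw [zero_sub]; exact hl)
    · exact (isComap_jetSnd_iff n 1 (isComap_zero 𝒜 1)).2 hr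
    · refine (e1 l).trans (Eq.trans ?_ (e2 l).symm)
      rw [Prod.fst_add, d1]
      congr 1
      module
    · refine (e3 l).trans (Eq.trans ?_ (e4 r).symm)
      rw [Prod.snd_add, d2]
      congr 1
      abel

end Infinitesimal

/-! ### Functoriality of deformations -/

section Push

variable {k : Type u} [Field k] {A : Type v} [AddCommGroup A] [Module k A]
  {𝒜 : ℤ → Submodule k A} [DirectSum.Decomposition 𝒜]

section

variable {R S : Type*} [Ring R] [Algebra k R] [Ring S] [Algebra k S]
  {ℛ : ℤ → Submodule k R} [DirectSum.Decomposition ℛ]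
  {𝒮 : ℤ → Submodule k S} [DirectSum.Decomposition 𝒮] {φ : R →ₗ[k] S}

theorem IsShift.delta_push (h : IsShift ℛ 𝒮 φ φ 0) (p q : ℤ)
    (f : Bar k A →ₗ[k] Bar k A ⊗[k] R) (i : BiBar k A ⊗[k] A →ₗ[k] R) :
    InftyInner.delta 𝒜 𝒮 p q (TensorProduct.map LinearMap.id φ ∘ₗ f) (φ ∘ₗ i) =
      φ ∘ₗ InftyInner.delta 𝒜 ℛ p q f i := by
  have := h.delta 𝒜 h.mul 0 p q f i
  simpa only [tw_zero, LinearMap.comp_id, add_zero, sub_zero, zero_mul, eps_zero,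
    one_smul] using this

theorem IsAInftyInner.push {Y : Cochain k A R} (hY : IsAInftyInner 𝒜 ℛ Y)
    (h : IsShift ℛ 𝒮 φ φ 0) : IsAInftyInner 𝒜 𝒮 (InftyInner.push φ Y) where
  coder := by
    have := h.isCoder (𝒜 := 𝒜) (p := -1) (f := Y.1) (by rw [sub_zero]; exact hY.coder)
    rwa [tw_zero, LinearMap.comp_id] at this
  square := by
    rw [InftyInner.push, comp_map h.mul, hY.square, LinearMap.comp_zero]
  comap := by
    have := h.isComap (𝒜 := 𝒜) (p := 0) (i := Y.2) (by rw [sub_zero]; exact hY.comap)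
    rwa [tw_zero, LinearMap.comp_id] at this
  compat := by
    rw [InftyInner.push, h.delta_push, hY.compat, LinearMap.comp_zero]

theorem IsCoalgMap.push {L : Bar k A →ₗ[k] Bar k A ⊗[k] R} (hL : IsCoalgMap 𝒜 ℛ L)
    (h : IsShift ℛ 𝒮 φ φ 0) : IsCoalgMap 𝒜 𝒮 (TensorProduct.map LinearMap.id φ ∘ₗ L) where
  map_one := by simp [hL.map_one, h.one]
  degree d x hx := by
    have := tdeg_map (f := LinearMap.id) (fun _ _ h => h) h.mem (hL.degree d x hx)
    rwa [add_zero] at this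
  counit := by
    have sw : ∀ ε : Bar k A →ₗ[k] k, TensorProduct.map ε LinearMap.id ∘ₗ
        TensorProduct.map LinearMap.id φ =
        TensorProduct.map LinearMap.id φ ∘ₗ TensorProduct.map ε LinearMap.id := fun ε => by
      rw [← TensorProduct.map_comp, ← TensorProduct.map_comp]; rfl
    rw [← LinearMap.comp_assoc, sw, LinearMap.comp_assoc, hL.counit, ← LinearMap.comp_assoc,
      map_comp_incl _ h.one, LinearMap.comp_id]
  comul := by
    have e := IsShift.map_deconc (𝒜 := 𝒜) (χ := φ) (n := 0) L
    rw [tw_zero, LinearMap.comp_id, LinearMap.comp_id] at e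
    rw [e, hL.comul, ← LinearMap.comp_assoc _ _ (juxt (sign 𝒮) (sT 𝒜)),
      h.juxt_base (sT_sT 𝒜)]
    rfl

end

theorem GradedArtin.Hom.isShift {R S : GradedArtin k} (φ : GradedArtin.Hom R S) :
    IsShift R.grade S.grade φ.1.toLinearMap φ.1.toLinearMap 0 where
  one := by simp
  mul a b := by simp
  mul_left a b := by simp
  mul_right a b := by simp
  base_mem := φ.2
  mem i r hr := by rw [add_zero]; exact φ.2 i r hr

theorem GradedArtin.Hom.aug_comp {R S : GradedArtin k} (φ : GradedArtin.Hom R S) :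
    S.aug.toLinearMap ∘ₗ φ.1.toLinearMap = R.aug.toLinearMap :=
  LinearMap.ext fun a => φ.aug_apply a

theorem push_push {R S T : Type*} [Ring R] [Algebra k R] [Ring S] [Algebra k S] [Ring T]
    [Algebra k T] (φ : R →ₗ[k] S) (ψ : S →ₗ[k] T) (Y : Cochain k A R) :
    push ψ (push φ Y) = push (ψ ∘ₗ φ) Y := by
  simp only [push, ← LinearMap.comp_assoc, ← TensorProduct.map_comp, LinearMap.comp_id]

theorem IsDeformation.push {X : Cochain k A k} {R S : GradedArtin k} {Y : Cochain k A R.carrier}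
    (hY : IsDeformation 𝒜 X R Y) (φ : GradedArtin.Hom R S) :
    IsDeformation 𝒜 X S (InftyInner.push φ.1.toLinearMap Y) :=
  ⟨hY.1.push φ.isShift, by rw [push_push, φ.aug_comp, hY.2]⟩

theorem DefEquiv.push {R S : GradedArtin k} {Y Y' : Cochain k A R.carrier}
    (h : DefEquiv 𝒜 R Y Y') (φ : GradedArtin.Hom R S) :
    DefEquiv 𝒜 S (InftyInner.push φ.1.toLinearMap Y) (InftyInner.push φ.1.toLinearMap Y') := by
  obtain ⟨L, ρ, hL, hL0, hρ, hρ0, h1, h2⟩ := h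
  have hφ := φ.isShift
  refine ⟨TensorProduct.map LinearMap.id φ.1.toLinearMap ∘ₗ L, φ.1.toLinearMap ∘ₗ ρ,
    hL.push hφ, ?_, ?_, ?_, ?_, ?_⟩
  · rw [← LinearMap.comp_assoc, ← TensorProduct.map_comp, φ.aug_comp, LinearMap.comp_id, hL0]
  · have := hφ.isComap (𝒜 := 𝒜) (p := 1) (i := ρ) (by rw [sub_zero]; exact hρ)
    rwa [tw_zero, LinearMap.comp_id] at this
  · rw [← LinearMap.comp_assoc, φ.aug_comp, hρ0]
  · rw [InftyInner.push, InftyInner.push, comp_map hφ.mul, comp_map hφ.mul, h1]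
  · rw [InftyInner.push, InftyInner.push, hφ.pullback, hφ.delta_push, ← h2, LinearMap.comp_sub]

/-! ### Derivations and maps to the dual numbers -/

/-- The algebra map `a ↦ a(0) + ξ(a) t` to the dual numbers given by a derivation. -/
def GradedArtin.algHomOfDerivation {R : GradedArtin k} {j : ℤ} (ξ : R.derivations j) :
    R.carrier →ₐ[k] DualNumber k :=
  AlgHom.ofLinearMap (dualInl k ∘ₗ R.aug.toLinearMap + dualInr k ∘ₗ ξ.1)
    (by
      -- The Leibniz rule at `1 · 1` reads `ξ(1) = ξ(1) + ξ(1)`.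
      have h : ξ.1 1 = 0 := by
        have := ξ.2.1 1 1
        simpa using this
      simp [h])
    (fun a b => by
      have := ξ.2.1 a b
      ext
      · simp
      · simp [this, mul_comm, add_comm])

/-- The homomorphism `a ↦ a(0) + ξ(a) t` to the dual numbers given by a derivation. -/
def GradedArtin.homOfDerivation {R : GradedArtin k} {j : ℤ} (ξ : R.derivations j) :
    GradedArtin.Hom R (dualArtin k (j - 1)) :=
  ⟨GradedArtin.algHomOfDerivation ξ, fun i a ha =>
    ⟨fun hi => by
      change (dualInl k (R.aug a) + dualInr k (ξ.1 a)).fst = 0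
      simp [R.aug_grade i hi a ha],
    fun hi => by
      change (dualInl k (R.aug a) + dualInr k (ξ.1 a)).snd = 0
      simp [ξ.2.2 i hi a ha]⟩⟩

theorem GradedArtin.homOfDerivation_apply {R : GradedArtin k} {j : ℤ} (ξ : R.derivations j)
    (a : R.carrier) : (GradedArtin.homOfDerivation ξ).1 a =
      (dualInl k (R.aug a) + dualInr k (ξ.1 a) : DualNumber k) := rfl

/-- The derivation given by a homomorphism to the dual numbers. -/
def GradedArtin.derivationOfHom {R : GradedArtin k} {j : ℤ}
    (φ : GradedArtin.Hom R (dualArtin k (j - 1))) : R.derivations j :=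
  ⟨dualSnd k ∘ₗ φ.1.toLinearMap, fun a b => by
    let ψ : R.carrier →ₐ[k] DualNumber k := φ.1
    have h : ∀ a, (ψ a).fst = R.aug a := fun a => φ.aug_apply a
    change (ψ (a * b)).snd = (ψ a).snd * R.aug b + R.aug a * (ψ b).snd
    rw [map_mul, ← h, ← h, TrivSqZeroExt.snd_mul]
    simp [mul_comm, add_comm], fun i hi a ha => (φ.2 i a ha).2 hi⟩

theorem GradedArtin.homOfDerivation_derivationOfHom {R : GradedArtin k} {j : ℤ}
    (φ : GradedArtin.Hom R (dualArtin k (j - 1))) :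
    GradedArtin.homOfDerivation (GradedArtin.derivationOfHom φ) = φ := by
  refine Subtype.ext (AlgHom.ext fun a => ?_)
  have h : TrivSqZeroExt.fst (φ.1 a : DualNumber k) = R.aug a := φ.aug_apply a
  rw [GradedArtin.homOfDerivation_apply, ← h]
  exact TrivSqZeroExt.inl_fst_add_inr_snd_eq _

/-- First order Taylor expansion of the family along `ξ`. The signs in `derivative` undo those in
`jet`. -/
theorem push_homOfDerivation {R : GradedArtin k} {j : ℤ} (ξ : R.derivations j)
    (Y : Cochain k A R.carrier) :
    push (GradedArtin.homOfDerivation ξ).1.toLinearMap Y =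
      jet 𝒜 (j - 1) (push R.aug.toLinearMap Y) (derivative 𝒜 j ξ.1 Y) := by
  let φ : R.carrier →ₗ[k] DualNumber k := dualInl k ∘ₗ R.aug.toLinearMap + dualInr k ∘ₗ ξ.1
  have h1 : (dualFst k).toLinearMap ∘ₗ φ = R.aug.toLinearMap := by
    rw [LinearMap.comp_add, ← LinearMap.comp_assoc, ← LinearMap.comp_assoc,
      dualFst_comp_dualInl, dualFst_comp_dualInr, LinearMap.id_comp, LinearMap.zero_comp, add_zero]
  have h2 : dualSnd k ∘ₗ φ = ξ.1 := by
    rw [LinearMap.comp_add, ← LinearMap.comp_assoc, ← LinearMap.comp_assoc,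
      dualSnd_comp_dualInl, dualSnd_comp_dualInr, LinearMap.id_comp, LinearMap.zero_comp, zero_add]
  have e1 := jetFst_eq (j - 1) (sT_sT 𝒜) (TensorProduct.map LinearMap.id φ ∘ₗ Y.1)
  have e2 := jetSnd_eq (𝒜 := 𝒜) (j - 1) (φ ∘ₗ Y.2)
  rw [← LinearMap.comp_assoc, ← TensorProduct.map_comp, h1, LinearMap.comp_assoc,
    ← LinearMap.comp_assoc _ _ (TensorProduct.map LinearMap.id (dualSnd k)),
    ← TensorProduct.map_comp, h2, LinearMap.comp_id] at e1
  rw [← LinearMap.comp_assoc, h1, LinearMap.comp_assoc, ← LinearMap.comp_assoc _ φ, h2] at e2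
  exact Prod.ext e1.symm e2.symm

/-- The chain rule, needed for compatibility with the transition maps. -/
theorem derivative_push {R S : GradedArtin k} (φ : GradedArtin.Hom R S) {j : ℤ}
    (ξ : S.derivations j) (Y : Cochain k A R.carrier) :
    derivative 𝒜 j ξ.1 (push φ.1.toLinearMap Y) =
      derivative 𝒜 j (GradedArtin.Hom.derivations φ j ξ).1 Y := by
  refine Prod.ext ?_ rfl
  change _ = TensorProduct.map LinearMap.id (ξ.1 ∘ₗ φ.1.toLinearMap) ∘ₗ _
  rw [← LinearMap.comp_id (LinearMap.id (M := Bar k A)), TensorProduct.map_comp]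
  rfl

theorem derivative_add {R : GradedArtin k} (j : ℤ) (ξ η : R.carrier →ₗ[k] k)
    (Y : Cochain k A R.carrier) :
    derivative 𝒜 j (ξ + η) Y = derivative 𝒜 j ξ Y + derivative 𝒜 j η Y := by
  simp only [derivative, TensorProduct.map_add_right, LinearMap.add_comp, smul_add,
    Prod.mk_add_mk]

theorem derivative_smul {R : GradedArtin k} (j : ℤ) (c : k) (ξ : R.carrier →ₗ[k] k)
    (Y : Cochain k A R.carrier) :
    derivative 𝒜 j (c • ξ) Y = c • derivative 𝒜 j ξ Y := by
  simp only [derivative, TensorProduct.map_smul_right, LinearMap.smul_comp, Prod.smul_mk,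
    smul_comm c]

end Push

/-! ### The tangent space of a local moduli space -/

section Tangent

variable {k : Type u} [Field k] {A : Type v} [AddCommGroup A] [Module k A]
  {𝒜 : ℤ → Submodule k A} [DirectSum.Decomposition 𝒜] {X : Cochain k A k}

theorem IsDeformation.push_homOfDerivation {R : GradedArtin k} {Y : Cochain k A R.carrier}
    (hY : IsDeformation 𝒜 X R Y) {j : ℤ} (ξ : R.derivations j) :
    InftyInner.push (GradedArtin.homOfDerivation ξ).1.toLinearMap Y =
      jet 𝒜 (j - 1) X (derivative 𝒜 j ξ.1 Y) := by
  rw [InftyInner.push_homOfDerivation (𝒜 := 𝒜), hY.2]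

theorem IsDeformation.derivative_mem (hX : IsAInftyInner 𝒜 (triv k) X) {R : GradedArtin k}
    {Y : Cochain k A R.carrier} (hY : IsDeformation 𝒜 X R Y) {j : ℤ} (ξ : R.derivations j) :
    derivative 𝒜 j ξ.1 Y ∈ cocycles 𝒜 X j := by
  have := (hY.push (GradedArtin.homOfDerivation ξ)).1
  rw [hY.push_homOfDerivation] at this
  exact (isAInftyInner_jet_iff hX j _).1 this

theorem cohomologyDeg_mk_eq {j : ℤ} {x y : Cochain k A k} (hx : x ∈ cocycles 𝒜 X j)
    (hy : y ∈ cocycles 𝒜 X j)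
    (h : ∃ w ∈ lieDeg 𝒜 (j - 1), x = y + differential 𝒜 X (j - 1) w) :
    (Submodule.Quotient.mk ⟨x, hx⟩ : CohomologyDeg 𝒜 X j) = Submodule.Quotient.mk ⟨y, hy⟩ := by
  obtain ⟨w, hw, h⟩ := h
  have e : differential 𝒜 X (j - 1) w = x + (-1 : k) • y := by
    rw [h]; module
  -- The coboundary is a difference of two cocycles, so it is a cocycle without an appeal to `d² =
  -- 0`.
  have hm : differential 𝒜 X (j - 1) w ∈ cocycles 𝒜 X j := by
    rw [e]; exact Submodule.add_mem _ hx (Submodule.smul_mem _ _ hy)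
  have e2 : (⟨x, hx⟩ : cocycles 𝒜 X j) = ⟨y, hy⟩ + ⟨_, hm⟩ := Subtype.ext h
  have z : (Submodule.Quotient.mk ⟨_, hm⟩ : CohomologyDeg 𝒜 X j) = 0 :=
    (Submodule.Quotient.mk_eq_zero _).2 ⟨w, hw, rfl⟩
  rw [e2, Submodule.Quotient.mk_add, z, add_zero]

variable (hX : IsAInftyInner 𝒜 (triv k) X) (M : LocalModuli.{u, v, w} 𝒜 X)

/-- The class of the derivative of the universal deformation along a derivation. -/
def LocalModuli.derivativeClass (j : ℤ) (a : M.index) :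
    (M.obj a).derivations j →ₗ[k] CohomologyDeg 𝒜 X j where
  toFun ξ := Submodule.Quotient.mk ⟨_, (M.isDeformation a).derivative_mem hX ξ⟩
  map_add' ξ η := by
    rw [← Submodule.Quotient.mk_add]
    congr 1
    exact Subtype.ext (derivative_add j ξ.1 η.1 _)
  map_smul' c ξ := by
    rw [RingHom.id_apply, ← Submodule.Quotient.mk_smul]
    congr 1
    exact Subtype.ext (derivative_smul j c ξ.1 _)

/-- The universal families are compatible only up to equivalence. Their derivatives may therefore
differ, but only by a coboundary, so the classes agree. -/
theorem LocalModuli.derivativeClass_trans (h2 : (2 : k) ≠ 0) (j : ℤ) {a b : M.index} (h : a ≤ b)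
    (ξ : (M.obj a).derivations j) :
    M.derivativeClass hX j b (GradedArtin.Hom.derivations (M.trans h) j ξ) =
      M.derivativeClass hX j a ξ := by
  refine cohomologyDeg_mk_eq _ _ ?_
  have := (M.compatible h).push (GradedArtin.homOfDerivation ξ)
  rw [((M.isDeformation b).push _).push_homOfDerivation,
    (M.isDeformation a).push_homOfDerivation, derivative_push] at this
  exact (defEquiv_jet_iff h2 hX j _ _).1 this

open Classical in
/-- The map from the tangent space to the cohomology, in one degree. -/
def LocalModuli.tangentMap (h2 : (2 : k) ≠ 0) (j : ℤ) :
    M.toProArtin.TangentDeg j →ₗ[k] CohomologyDeg 𝒜 X j :=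
  Module.DirectLimit.lift k M.index (fun a => (M.obj a).derivations j)
    (fun _ _ h => (M.trans h).derivations j) (M.derivativeClass hX j)
    (fun _ _ h ξ => M.derivativeClass_trans hX h2 j h ξ)

theorem LocalModuli.tangentMap_tangentOf (h2 : (2 : k) ≠ 0) (j : ℤ) (a : M.index)
    (ξ : (M.obj a).derivations j) :
    M.tangentMap hX h2 j (M.toProArtin.tangentOf j a ξ) = M.derivativeClass hX j a ξ := by
  classical
  exact Module.DirectLimit.lift_of _ _ _

theorem LocalModuli.exists_tangentOf (j : ℤ) (x : M.toProArtin.TangentDeg j) :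
    ∃ a ξ, M.toProArtin.tangentOf j a ξ = x := by
  classical
  exact Module.DirectLimit.exists_of x

/-- If the derivative along `ξ` is a coboundary, then `ξ` and `0` induce equivalent families over
the dual numbers. Uniqueness of the classifying map makes the two homomorphisms agree after passing
to a later member of the system, so `ξ` dies in the direct limit. -/
theorem LocalModuli.eq_zero_of_tangentMap_eq_zero (h2 : (2 : k) ≠ 0) (j : ℤ)
    (x : M.toProArtin.TangentDeg j) (hx : M.tangentMap hX h2 j x = 0) : x = 0 := by
  obtain ⟨a, ξ, rfl⟩ := M.exists_tangentOf j x
  rw [M.tangentMap_tangentOf] at hx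
  obtain ⟨w, hw, hw'⟩ := (Submodule.Quotient.mk_eq_zero _).1 hx
  have hw' : differential 𝒜 X (j - 1) w = derivative 𝒜 j ξ.1 (M.univ a) := hw'
  have h0 : derivative 𝒜 j (0 : (M.obj a).derivations j).1 (M.univ a) = 0 := by
    have := derivative_smul (𝒜 := 𝒜) j 0 (0 : (M.obj a).carrier →ₗ[k] k) (M.univ a)
    rwa [zero_smul, zero_smul] at this
  have hd := (defEquiv_jet_iff h2 hX j (derivative 𝒜 j ξ.1 (M.univ a))
    (derivative 𝒜 j (0 : (M.obj a).derivations j).1 (M.univ a))).2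
    ⟨w, hw, by rw [h0, zero_add, hw']⟩
  rw [← (M.isDeformation a).push_homOfDerivation,
    ← (M.isDeformation a).push_homOfDerivation] at hd
  obtain ⟨b, h, hb⟩ := M.injective _ a _ _ hd
  have hz : (M.trans h).derivations j ξ = 0 := by
    refine Subtype.ext (LinearMap.ext fun x => ?_)
    have := congrArg (dualSnd k) (hb x)
    rw [GradedArtin.homOfDerivation_apply, GradedArtin.homOfDerivation_apply] at this
    simp only [dualSnd_apply, dualInl_apply, dualInr_apply, TrivSqZeroExt.snd_add,
      TrivSqZeroExt.snd_inl, TrivSqZeroExt.snd_inr, zero_add] at this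
    exact this
  classical
  have := Module.DirectLimit.of_f (R := k) (ι := M.index) (G := fun a => (M.obj a).derivations j)
    (f := fun _ _ h => (M.trans h).derivations j) (hij := h) (x := ξ)
  rw [hz, map_zero] at this
  exact this.symm

theorem LocalModuli.tangentMap_injective (h2 : (2 : k) ≠ 0) (j : ℤ) :
    Function.Injective (M.tangentMap hX h2 j) := by
  intro x y h
  have hz := M.eq_zero_of_tangentMap_eq_zero hX h2 j (x + (-1 : k) • y) (by
    rw [map_add, map_smul, h]; module)
  calc x = (x + (-1 : k) • y) + y := by module
    _ = y := by rw [hz, zero_add]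

/-- A cocycle defines a deformation over the dual numbers. Its classifying map comes from a
derivation of some member of the system, and the resulting equivalence of jets identifies the
cohomology classes. -/
theorem LocalModuli.tangentMap_surjective (h2 : (2 : k) ≠ 0) (j : ℤ) :
    Function.Surjective (M.tangentMap hX h2 j) := by
  intro y
  obtain ⟨⟨y, hy⟩, rfl⟩ := Submodule.Quotient.mk_surjective _ y
  have hdef : IsDeformation 𝒜 X (dualArtin k (j - 1)) (jet 𝒜 (j - 1) X y) :=
    ⟨(isAInftyInner_jet_iff hX j y).2 hy,
      Prod.ext (map_dualFst_jetFst _ _ _) (dualFst_jetSnd _ _ _)⟩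
  obtain ⟨a, φ, hφ⟩ := M.surjective _ _ hdef
  rw [← GradedArtin.homOfDerivation_derivationOfHom φ,
    (M.isDeformation a).push_homOfDerivation] at hφ
  refine ⟨M.toProArtin.tangentOf j a (GradedArtin.derivationOfHom φ), ?_⟩
  rw [M.tangentMap_tangentOf]
  exact cohomologyDeg_mk_eq _ _ ((defEquiv_jet_iff h2 hX j _ _).1 hφ)

/-- The tangent space is isomorphic to the cohomology, in one degree. -/
def LocalModuli.tangentEquiv (h2 : (2 : k) ≠ 0) (j : ℤ) :
    M.toProArtin.TangentDeg j ≃ₗ[k] CohomologyDeg 𝒜 X j :=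
  LinearEquiv.ofBijective (M.tangentMap hX h2 j)
    ⟨M.tangentMap_injective hX h2 j, M.tangentMap_surjective hX h2 j⟩

end Tangent

end

end InftyInner

/-! ### Assembling the degreewise isomorphisms -/

theorem mainTheorem3 {k : Type u} [Field k] (h2 : (2 : k) ≠ 0)
    {A : Type v} [AddCommGroup A] [Module k A]
    (𝒜 : ℤ → Submodule k A) [DirectSum.Decomposition 𝒜]
    (X : InftyInner.Cochain k A k)
    (hX : InftyInner.IsAInftyInner 𝒜 (InftyInner.triv k) X)
    (M : InftyInner.LocalModuli.{u, v, w} 𝒜 X) :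
    ∃ Φ : M.toProArtin.TangentSpace ≃ₗ[k] InftyInner.Cohomology 𝒜 X,
      ∀ (j : ℤ) (a : M.index) (ξ : (M.obj a).derivations j),
        ∃ hz : InftyInner.derivative 𝒜 j ξ.1 (M.univ a) ∈ InftyInner.cocycles 𝒜 X j,
          Φ (DirectSum.lof k ℤ M.toProArtin.TangentDeg j (M.toProArtin.tangentOf j a ξ)) =
            DirectSum.lof k ℤ (InftyInner.CohomologyDeg 𝒜 X) j
              (Submodule.Quotient.mk ⟨_, hz⟩) := by
  refine ⟨DFinsupp.mapRange.linearEquiv fun j => M.tangentEquiv hX h2 j, fun j a ξ =>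
    ⟨(M.isDeformation a).derivative_mem hX ξ, ?_⟩⟩
  refine (DFinsupp.mapRange_single (hf := fun j => map_zero (M.tangentEquiv hX h2 j))).trans ?_
  exact congrArg (DirectSum.lof k ℤ (InftyInner.CohomologyDeg 𝒜 X) j)
    (M.tangentMap_tangentOf hX h2 j a ξ)
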